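/- **Setting.** Let $\pi\colon E\to M$ and $\alpha$ be smooth real vector bundles of finite rank over a smooth $n$-dimensional manifold $M$, let $\mathcal F(\pi)$ be the algebra of smooth functions on $J^\infty(\pi)$ (each depending on finitely many derivatives), and let $F\in P(\pi)=\Gamma(\pi_\infty^*\alpha)$, defining the equation $\mathcal E=\{F=0\}$, prolonged to $J^\infty(\pi)$ (not necessarily in evolution form). Put $\kappa(\pi)=\Gamma(\pi_\infty^*\pi)$, $\hat Q=\mathrm{Hom}_{\mathcal F}(Q,\bar\Lambda^n)$ with $\bar\Lambda^n$ the horizontal $n$-forms, and identify $\hat{\hat Q}=Q$. A $\mathcal C$-differential operator is one of the form $(a^\sigma_{ij}D_\sigma)$ in local coordinates, $\Delta^*$ is the formal adjoint of $\Delta$, $\ell_p(\varphi)$ is the derivative of $p$ along the evolutionary field with generating function $\varphi$, and $\ell_{\Delta,p}=\ell_{\Delta(p)}-\Delta\circ\ell_p$. The restriction of $\ell_F$ to $\mathcal E$ is denoted by $\ell_{\mathcal E}$. *Bivectors and brackets.* A variational bivector on $\mathcal E$ (extended to $J^\infty(\pi)$) is a $\mathcal C$-differential operator $A\colon\hat P\to\kappa$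 for which there is a $\mathcal C$-differential operator $B\colon P\times\hat P\to P$ with $\ell_F\circ A-A^*\circ\ell_F^*=B(F,\cdot)$ on $J^\infty(\pi)$. Let $B^*\colon\hat P\times\hat P\to\hat P$ be the adjoint of $B$ in the first argument. The Schouten bracket of bivectors $A_1,A_2$ with associated $B_1,B_2$ is $$[\![A_1,A_2]\!](\psi_1,\psi_2)=\ell_{A_1,\psi_1}(A_2\psi_2)-\ell_{A_1,\psi_2}(A_2\psi_1)+\ell_{A_2,\psi_1}(A_1\psi_2)-\ell_{A_2,\psi_2}(A_1\psi_1)-A_1(B_2^*(\psi_1,\psi_2))-A_2(B_1^*(\psi_1,\psi_2)).$$ It vanishes on $\mathcal E$ modulo trivial terms if its restriction to $\mathcal E$ is $\square_1(\ell_{\mathcal E}^*(\psi_1),\psi_2)+\square_2(\psi_1,\ell_{\mathcal E}^*(\psi_2))$ for some $\mathcal C$-differential operators $\square_1\colon\hat\kappa\times\hat P\to\kappa$ and $\square_2\colon\hat P\times\hat\kappa\to\kappa$. **Theorem.** Let $A_1,A_2$ be variational bivectors for $F$, with associated operators $B_1,B_2$, that make $F=0$ bi-Hamiltonian in the sense that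 $[\![A_i,A_j]\!]=0$ on $J^\infty(\pi)$ for $i,j\in\{1,2\}$. Let $\hat\pi$ be the bundle $E^*\otimes\Lambda^n(T^*M)$, with fibre variable $w$, and let $\tilde{\mathcal E}\subset J^\infty(\pi)\times_MJ^\infty(\hat\pi)$ be the Kupershmidt deformation, given by $$\tilde F=(F+A_1^*(w),\,A_2^*(w))=0$$ in the unknowns $(u,w)$. Define $\tilde A_1,\tilde A_2\colon\hat P\oplus\hat P\to\kappa\oplus\hat\kappa$ by $$\tilde A_1=\begin{pmatrix}A_1&-A_1\\0&L\end{pmatrix},\qquad \tilde A_2=\begin{pmatrix}A_2&-A_2\\-L&0\end{pmatrix},\qquad L=\ell^*_{F+A_1^*(w)+A_2^*(w)},$$ where in $L$ the linearization is with respect to $u$ only. Then $\tilde{\mathcal E}$ is bi-Hamiltonian with respect to $\tilde A_1,\tilde A_2$: 1. $\tilde A_1$ and $\tilde A_2$ are variational bivectors on $\tilde{\mathcal E}$, that is, $\ell_{\tilde F}\circ\tilde A_i-\tilde A_i^*\circ\ell_{\tilde F}^*=\tilde B_i(\tilde F,\cdot)$ for some $\mathcal C$-differential operators $\tilde B_1,\tilde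 B_2$; and $\tilde B_1,\tilde B_2$ can be chosen so that all brackets $[\![\tilde A_i,\tilde A_j]\!]$, $i,j\in\{1,2\}$, vanish on $\tilde{\mathcal E}$ modulo trivial terms built from $\ell_{\tilde{\mathcal E}}^*$. 2. If $\tilde{\mathcal E}$ is regular (every function vanishing on $\tilde{\mathcal E}$ is $\Delta(\tilde F)$ for a $\mathcal C$-differential operator $\Delta$) and normal (for scalar-valued $\mathcal C$-differential operators $\Delta$ on $\tilde{\mathcal E}$, $\Delta\circ\ell_{\tilde{\mathcal E}}=0$ implies $\Delta=0$), then these brackets vanish on $\tilde{\mathcal E}$ modulo trivial terms for every choice of $\tilde B_1,\tilde B_2$. -/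

import Mathlib

open scoped Manifold ContDiff Bundle

noncomputable section

namespace Kupershmidt

/-! ## The line bundle of top-degree forms -/

section TopForms

theorem contDiff_det (n : ℕ) :
    ContDiff ℝ ∞ (fun f : EuclideanSpace ℝ (Fin n) →L[ℝ] EuclideanSpace ℝ (Fin n) => f.det) := by
  let b := (EuclideanSpace.basisFun (Fin n) ℝ).toBasis
  have h : (fun f : EuclideanSpace ℝ (Fin n) →L[ℝ] EuclideanSpace ℝ (Fin n) => f.det)
      = fun f => ∑ σ : Equiv.Perm (Fin n), ((Equiv.Perm.sign σ : ℤ) : ℝ) *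
          ∏ i, (f (b i)) (σ i) := by
    funext f
    have h1 : f.det = (LinearMap.toMatrix b b f.toLinearMap).det := by
      rw [LinearMap.det_toMatrix]
    rw [h1, Matrix.det_apply']
    refine Finset.sum_congr rfl fun σ _ => ?_
    refine congrArg _ (Finset.prod_congr rfl fun i _ => ?_)
    simp [LinearMap.toMatrix_apply, b]
  rw [h]
  refine ContDiff.sum fun σ _ => contDiff_const.mul (contDiff_prod fun i _ => ?_)
  have : ContDiff ℝ ∞ (fun f : EuclideanSpace ℝ (Fin n) →L[ℝ] EuclideanSpace ℝ (Fin n) =>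
      (EuclideanSpace.proj (𝕜 := ℝ) (σ i)) (f (b i))) :=
    (EuclideanSpace.proj (𝕜 := ℝ) (σ i)).contDiff.comp (contDiff_id.clm_apply contDiff_const)
  exact this

variable (n : ℕ) (M : Type*) [TopologicalSpace M] [ChartedSpace (EuclideanSpace ℝ (Fin n)) M]
  [IsManifold (𝓡 n) ∞ M]

/-- The real line bundle `Λⁿ(T*M)` of an `n`-dimensional manifold, given by its transition
functions: the coordinate of a top-degree form in the chart `j` is the coordinate in the chart `i`
times the determinant of the differential of the change of charts from `j` to `i`. -/
def topFormCore : VectorBundleCore ℝ M ℝ (atlas (EuclideanSpace ℝ (Fin n)) M) where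
  baseSet i := i.1.source
  isOpen_baseSet i := i.1.open_source
  indexAt := achart (EuclideanSpace ℝ (Fin n))
  mem_baseSet_at := mem_chart_source (EuclideanSpace ℝ (Fin n))
  coordChange i j x :=
    ((tangentBundleCore (𝓡 n) M).coordChange j i x).det • ContinuousLinearMap.id ℝ ℝ
  coordChange_self i x hx v := by
    have h : (tangentBundleCore (𝓡 n) M).coordChange i i x = ContinuousLinearMap.id ℝ _ := by
      ext1 w
      exact (tangentBundleCore (𝓡 n) M).coordChange_self i x hx w
    rw [h]
    simp [ContinuousLinearMap.det]
  continuousOn_coordChange i j := by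
    have h := (tangentBundleCore (𝓡 n) M).continuousOn_coordChange j i
    have h2 := (contDiff_det n).continuous.comp_continuousOn h
    rw [Set.inter_comm] at h2
    exact h2.smul continuousOn_const
  coordChange_comp i j k x hx v := by
    have h : ((tangentBundleCore (𝓡 n) M).coordChange j i x).comp
        ((tangentBundleCore (𝓡 n) M).coordChange k j x)
        = (tangentBundleCore (𝓡 n) M).coordChange k i x :=
      (tangentBundleCore (𝓡 n) M).coordChange_linear_comp k j i x ⟨⟨hx.2, hx.1.2⟩, hx.1.1⟩
    have h3 : ((tangentBundleCore (𝓡 n) M).coordChange k i x).det =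
        ((tangentBundleCore (𝓡 n) M).coordChange j i x).det *
        ((tangentBundleCore (𝓡 n) M).coordChange k j x).det := by
      rw [← h]
      simp [ContinuousLinearMap.det, LinearMap.det_comp]
    simp only [smul_apply, ContinuousLinearMap.id_apply, smul_eq_mul]
    rw [h3]; ring

instance topFormCore_isContMDiff : (topFormCore n M).IsContMDiff (𝓡 n) ∞ where
  contMDiffOn_coordChange i j := by
    have : IsManifold (𝓡 n) (∞ + 1) M := inferInstanceAs (IsManifold (𝓡 n) ∞ M)
    have h0 : (tangentBundleCore (𝓡 n) M).IsContMDiff (𝓡 n) ∞ := tangentBundleCore.isContMDiff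
    have h := (tangentBundleCore (𝓡 n) M).contMDiffOn_coordChange (n := ∞) (𝓡 n) j i
    have h2 := (contDiff_det n).contMDiff.comp_contMDiffOn h
    rw [Set.inter_comm] at h2
    exact h2.smul contMDiffOn_const

/-- The fibre at `x` of the line bundle `Λⁿ(T*M)`. -/
abbrev TopForm (x : M) : Type := (topFormCore n M).Fiber x

instance (x : M) : IsTopologicalAddGroup (TopForm n M x) :=
  inferInstanceAs (IsTopologicalAddGroup ℝ)

instance (x : M) : ContinuousSMul ℝ (TopForm n M x) :=
  inferInstanceAs (ContinuousSMul ℝ ℝ)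


end TopForms

/-! ## Jets and smooth families of sections

A smooth function on the jet space `Jᵏ(π)`, or more generally a section of the pull-back to
`Jᵏ(π)` of a vector bundle on `M`, is treated as the (nonlinear) differential operator on sections
of `π` that it defines: the section `p` of `π_∞^*(α)` is the operator `u ↦ p ∘ j_∞ u` from sections
of `π` to sections of `α`.  The total derivatives are then the ordinary derivatives of
`p ∘ j_∞ u` along `M`, and a point of `J^∞(π)` is a pair `(u, x)`, considered up to the jet of `u`
at `x`. -/

/-- Spaces of sections over `M` (of a vector bundle, or of a direct sum of vector bundles). -/
class SectionSpace (M : outParam (Type*)) (S : Type*) where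
  /-- `JetEq k x s s'`: the sections `s` and `s'` have the same `k`-jet at `x`.
  For `k = 0` this says that `s` and `s'` have the same value at `x`. -/
  JetEq : ℕ → M → S → S → Prop
  /-- the section `c a` depends smoothly on the point of `M` and on the parameter `a`, jointly -/
  SmoothFamily : {N : ℕ} → (EuclideanSpace ℝ (Fin N) → S) → Prop
  /-- `HasVelocity c v`: at each point of `M` the derivative of `t ↦ c t` at `t = 0` is `v` -/
  HasVelocity : (ℝ → S) → S → Prop

section Sections

variable {n : ℕ} {M : Type*} [TopologicalSpace M] [ChartedSpace (EuclideanSpace ℝ (Fin n)) M]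
  {F : Type*} [NormedAddCommGroup F] [NormedSpace ℝ F]
  {V : M → Type*} [TopologicalSpace (Bundle.TotalSpace F V)] [∀ x, TopologicalSpace (V x)]
  [FiberBundle F V]

/-- The representative of a section in the preferred chart and the preferred trivialization at
`x`. -/
def localRep (x : M) (s : ContMDiffSection (𝓡 n) F ∞ V) (y : EuclideanSpace ℝ (Fin n)) : F :=
  (trivializationAt F V x ⟨(extChartAt (𝓡 n) x).symm y, s ((extChartAt (𝓡 n) x).symm y)⟩).2

instance instSectionSpace : SectionSpace M (ContMDiffSection (𝓡 n) F ∞ V) where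
  JetEq k x s s' := ∀ j ≤ k,
    iteratedFDeriv ℝ j (localRep x s) (extChartAt (𝓡 n) x x) =
      iteratedFDeriv ℝ j (localRep x s') (extChartAt (𝓡 n) x x)
  SmoothFamily {N} c :=
    ContMDiff (𝓘(ℝ, EuclideanSpace ℝ (Fin N)).prod (𝓡 n)) ((𝓡 n).prod 𝓘(ℝ, F)) ∞
      (fun p : EuclideanSpace ℝ (Fin N) × M => (⟨p.2, c p.1 p.2⟩ : Bundle.TotalSpace F V))
  HasVelocity c v := ∀ x : M,
    HasDerivAt (fun t => (trivializationAt F V x ⟨x, c t x⟩).2)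
      (trivializationAt F V x ⟨x, v x⟩).2 0

end Sections

instance instSectionSpaceProd {M S T : Type*} [SectionSpace M S] [SectionSpace M T] :
    SectionSpace M (S × T) where
  JetEq k x s s' :=
    SectionSpace.JetEq k x s.1 s'.1 ∧ SectionSpace.JetEq k x s.2 s'.2
  SmoothFamily c :=
    SectionSpace.SmoothFamily (fun a => (c a).1) ∧ SectionSpace.SmoothFamily (fun a => (c a).2)
  HasVelocity c v :=
    SectionSpace.HasVelocity (fun t => (c t).1) v.1 ∧
      SectionSpace.HasVelocity (fun t => (c t).2) v.2

open SectionSpace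

/-! ## Differential operators, `𝒞`-differential operators, linearization -/

section Operators

variable {M : Type*} {U P Q R : Type*}
  [SectionSpace M U] [SectionSpace M P] [SectionSpace M Q] [SectionSpace M R]

/-- Nonlinear differential operators of finite order, that is, sections over some `Jᵏ`:
the value of `D u` at `x` depends only on the `k`-jet of `u` at `x`, and depends smoothly on it.
(Every `k`-jet near a point extends to a smooth finite-dimensional family of sections which
parametrizes these jets, so that smoothness in the `k`-jet means that `D` takes smooth families
to smooth families.) -/
def IsDiffOp (D : U → P) : Prop :=
  (∃ k : ℕ, ∀ (x : M) (u u' : U), JetEq k x u u' → JetEq 0 x (D u) (D u')) ∧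
  ∀ (N : ℕ) (c : EuclideanSpace ℝ (Fin N) → U),
    SmoothFamily c → SmoothFamily (fun a => D (c a))

variable [AddCommGroup U] [Module ℝ U] [AddCommGroup P] [Module ℝ P] [AddCommGroup Q] [Module ℝ Q]
  [AddCommGroup R] [Module ℝ R]

/-- `𝒞`-differential operators from `P(π)` to `Q(π)`: families `Δ u` of linear differential
operators from sections to sections, whose coefficients are functions of finite jets of `u`.
On a `u`-dependent argument `p` the operator acts by `Δ(p)(u) = Δ u (p u)`. -/
def IsCDiffOp (Δ : U → P → Q) : Prop :=
  (∀ u, IsLinearMap ℝ (Δ u)) ∧ IsDiffOp (fun z : U × P => Δ z.1 z.2)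

/-- `𝒞`-differential operators in two linear arguments. -/
def IsCBiDiffOp (B : U → P → Q → R) : Prop :=
  (∀ u q, IsLinearMap ℝ (fun p => B u p q)) ∧ (∀ u p, IsLinearMap ℝ (B u p)) ∧
    IsDiffOp (fun z : U × P × Q => B z.1 z.2.1 z.2.2)

open Classical in
/-- The derivative at `t = 0` of a curve of sections (and `0` if it does not exist; it does exist
for the curves `t ↦ D (u + t φ)` with a differential operator `D`). -/
def velocity (c : ℝ → P) : P :=
  if h : ∃ v, HasVelocity c v then h.choose else 0

/-- The universal linearization `ℓ_D(φ)` at `u`: the derivative of `D` along the evolutionary field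
with generating function `φ`. -/
def lin (D : U → P) (u φ : U) : P :=
  velocity fun t : ℝ => D (u + t • φ)

/-- For a `𝒞`-differential operator `Δ`, the operator `ℓ_{Δ,p} = ℓ_{Δ(p)} - Δ ∘ ℓ_p` for sections
`p` over `M`, for which `ℓ_p = 0`. -/
def linOp (Δ : U → P → Q) (p : P) (u φ : U) : Q :=
  lin (fun v => Δ v p) u φ

/-- The point `(u, x)` of the jet space lies on the infinite prolongation of the equation `F = 0`:
all derivatives of `F u` vanish at `x`. -/
def OnShell (F : U → P) (u : U) (x : M) : Prop :=
  ∀ k : ℕ, JetEq k x (F u) 0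

/-- The closed support of a section. -/
def secSupport [TopologicalSpace M] (p : P) : Set M :=
  closure {x : M | ¬ JetEq 0 x p 0}

end Operators

/-! ## Pairings with values in top-degree forms, formal adjoints -/

section Adjoint

variable {n : ℕ} {M : Type*} [TopologicalSpace M] [ChartedSpace (EuclideanSpace ℝ (Fin n)) M]
  [IsManifold (𝓡 n) ∞ M]

variable (n M) in
/-- Pairings of `Ŝ` and `S` with values in top-degree forms. -/
abbrev Pairing (S' S : Type*) : Type _ := S' → S → ∀ x : M, TopForm n M x

/-- Sections of the bundle `V̂ = V* ⊗ Λⁿ(T*M) = Hom(V, Λⁿ(T*M))`. -/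
abbrev HatSection (n : ℕ) {M : Type*} [TopologicalSpace M]
    [ChartedSpace (EuclideanSpace ℝ (Fin n)) M] [IsManifold (𝓡 n) ∞ M]
    (F : Type*) [NormedAddCommGroup F] [NormedSpace ℝ F]
    (V : M → Type*) [TopologicalSpace (Bundle.TotalSpace F V)] [∀ x, AddCommGroup (V x)]
    [∀ x, Module ℝ (V x)] [∀ x, TopologicalSpace (V x)] [FiberBundle F V] [VectorBundle ℝ F V] :
    Type _ :=
  ContMDiffSection (𝓡 n) (F →L[ℝ] ℝ) ∞ (fun x : M => V x →L[ℝ] TopForm n M x)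

/-- The natural pairing of sections of `V̂` and `V`. -/
def pairing (n : ℕ) {M : Type*} [TopologicalSpace M]
    [ChartedSpace (EuclideanSpace ℝ (Fin n)) M] [IsManifold (𝓡 n) ∞ M]
    (F : Type*) [NormedAddCommGroup F] [NormedSpace ℝ F]
    (V : M → Type*) [TopologicalSpace (Bundle.TotalSpace F V)] [∀ x, AddCommGroup (V x)]
    [∀ x, Module ℝ (V x)] [∀ x, TopologicalSpace (V x)] [FiberBundle F V] [VectorBundle ℝ F V] :
    Pairing n M (HatSection n F V) (ContMDiffSection (𝓡 n) F ∞ V) :=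
  fun η s x => η x (s x)

/-- The same pairing with the roles exchanged: the dual of `Ŝ` is `S`. -/
def Pairing.swap {S' S : Type*} (pr : Pairing n M S' S) : Pairing n M S S' :=
  fun s η => pr η s

/-- The pairing of direct sums: the dual of `S ⊕ T` is `Ŝ ⊕ T̂`. -/
def Pairing.sum {S' S T' T : Type*} (pr : Pairing n M S' S) (pr' : Pairing n M T' T) :
    Pairing n M (S' × T') (S × T) :=
  fun η s x => pr η.1 s.1 x + pr' η.2 s.2 x

/-- The integral of a top-degree form over the domain of a chart, in the coordinates of this
chart. -/
def chartIntegral (c : atlas (EuclideanSpace ℝ (Fin n)) M) (ρ : ∀ x : M, TopForm n M x) : ℝ :=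
  ∫ y in c.1.target, ((topFormCore n M).localTriv c ⟨c.1.symm y, ρ (c.1.symm y)⟩).2

variable {U P Q P' Q' : Type*}
  [SectionSpace M U] [SectionSpace M P] [SectionSpace M Q] [SectionSpace M P'] [SectionSpace M Q']
  [AddCommGroup U] [Module ℝ U] [AddCommGroup P] [Module ℝ P] [AddCommGroup Q] [Module ℝ Q]
  [AddCommGroup P'] [Module ℝ P'] [AddCommGroup Q'] [Module ℝ Q']

/-- `T'` is formally adjoint to `T`: one has `∫ ⟨q, T p⟩ = ∫ ⟨T' q, p⟩` whenever `p` has compact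
support in the domain of a chart. -/
def IsAdjoint (prP : Pairing n M P' P) (prQ : Pairing n M Q' Q) (T : P → Q) (T' : Q' → P') :
    Prop :=
  ∀ (c : atlas (EuclideanSpace ℝ (Fin n)) M) (p : P) (q : Q'),
    IsCompact (secSupport p) → secSupport p ⊆ c.1.source →
      chartIntegral c (prQ q (T p)) = chartIntegral c (prP (T' q) p)

/-- The `𝒞`-differential operator `Δ'` from `Q̂` to `P̂` is the adjoint of the
`𝒞`-differential operator `Δ` from `P` to `Q`. -/
def IsFormalAdjoint (prP : Pairing n M P' P) (prQ : Pairing n M Q' Q)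
    (Δ : U → P → Q) (Δ' : U → Q' → P') : Prop :=
  IsCDiffOp Δ' ∧ ∀ u, IsAdjoint prP prQ (Δ u) (Δ' u)

end Adjoint

/-! ## Variational bivectors and the Schouten bracket -/

section Bivectors

variable {n : ℕ} {M : Type*} [TopologicalSpace M] [ChartedSpace (EuclideanSpace ℝ (Fin n)) M]
  [IsManifold (𝓡 n) ∞ M]
  {U U' P P' : Type*}
  [SectionSpace M U] [SectionSpace M U'] [SectionSpace M P] [SectionSpace M P']
  [AddCommGroup U] [Module ℝ U] [AddCommGroup U'] [Module ℝ U']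
  [AddCommGroup P] [Module ℝ P] [AddCommGroup P'] [Module ℝ P']

/-- `A : P̂ → κ` is (the extension to the jet space of) a variational bivector on the equation
`F = 0`, with adjoint `A'` and with associated operator `B`:
`ℓ_F ∘ A - A* ∘ ℓ_F^* = B(F, ·)`; the operator `ell'` is `ℓ_F^*`, and `B'` is the adjoint `B^*` of
`B` in the first argument. -/
structure IsBivector (prU : Pairing n M U' U) (prP : Pairing n M P' P) (F : U → P)
    (ell' : U → P' → U') (A : U → P' → U) (A' : U → U' → P)
    (B : U → P → P' → P) (B' : U → P' → P' → P') : Prop where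
  ell_adjoint : IsFormalAdjoint prU prP (lin F) ell'
  cdiff : IsCDiffOp A
  adjoint : IsFormalAdjoint prP.swap prU A A'
  cbidiff : IsCBiDiffOp B
  cbidiff' : IsCBiDiffOp B'
  adjoint' : ∀ u ψ, IsAdjoint prP prP (fun p => B u p ψ) (fun q => B' u q ψ)
  eq : ∀ u ψ, lin F u (A u ψ) - A' u (ell' u ψ) = B u (F u) ψ

/-- The variational Schouten bracket of the bivectors `A₁` and `A₂`, where `B₁'` and `B₂'` are the
operators `B₁^*` and `B₂^*`. -/
def schouten (A₁ A₂ : U → P' → U) (B₁' B₂' : U → P' → P' → P') (u : U) (ψ₁ ψ₂ : P') : U :=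
  linOp A₁ ψ₁ u (A₂ u ψ₂) - linOp A₁ ψ₂ u (A₂ u ψ₁)
    + linOp A₂ ψ₁ u (A₁ u ψ₂) - linOp A₂ ψ₂ u (A₁ u ψ₁)
    - A₁ u (B₂' u ψ₁ ψ₂) - A₂ u (B₁' u ψ₁ ψ₂)

/-- On the equation `F = 0` the operator `T : P̂ × P̂ → κ` is of the form
`□₁(ℓ_E^*(·), ·) + □₂(·, ℓ_E^*(·))`; here `ell'` is `ℓ_F^*`. -/
def IsTrivialOnShell (F : U → P) (ell' : U → P' → U') (T : U → P' → P' → U) : Prop :=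
  ∃ (box₁ : U → U' → P' → U) (box₂ : U → P' → U' → U),
    IsCBiDiffOp box₁ ∧ IsCBiDiffOp box₂ ∧
    ∀ (u : U) (x : M), OnShell F u x → ∀ ψ₁ ψ₂ : P',
      JetEq 0 x (T u ψ₁ ψ₂) (box₁ u (ell' u ψ₁) ψ₂ + box₂ u ψ₁ (ell' u ψ₂))

/-- The operators `A 0` and `A 1` are variational bivectors on the equation `F = 0`, with the
adjoint and associated operators listed. -/
def AreBivectors (prU : Pairing n M U' U) (prP : Pairing n M P' P) (F : U → P)
    (ell' : U → P' → U') (A : Fin 2 → U → P' → U) (A' : Fin 2 → U → U' → P)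
    (B : Fin 2 → U → P → P' → P) (B' : Fin 2 → U → P' → P' → P') : Prop :=
  ∀ i, IsBivector prU prP F ell' (A i) (A' i) (B i) (B' i)

/-- On the equation `F = 0` all Schouten brackets of `A 0` and `A 1` vanish up to trivial terms. -/
def BracketsVanish (F : U → P) (ell' : U → P' → U') (A : Fin 2 → U → P' → U)
    (B' : Fin 2 → U → P' → P' → P') : Prop :=
  ∀ i j, IsTrivialOnShell F ell' (schouten (A i) (A j) (B' i) (B' j))

variable (n M) in
/-- Smooth functions on `M`. -/
abbrev Fun : Type _ := ContMDiffSection (𝓡 n) ℝ ∞ (Bundle.Trivial M ℝ)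

variable (n) in
/-- The equation `F = 0` is regular: every function on the jet space that vanishes on the equation
is of the form `Δ(F)` with a `𝒞`-differential operator `Δ`. -/
def IsRegular (F : U → P) : Prop :=
  ∀ f : U → Fun n M, IsDiffOp f → (∀ u x, OnShell F u x → JetEq 0 x (f u) 0) →
    ∃ Δ : U → P → Fun n M, IsCDiffOp Δ ∧ ∀ u, f u = Δ u (F u)

variable (n) in
/-- The equation `E` given by `F = 0` is normal: if `Δ ∘ ℓ_E = 0` for a `𝒞`-differential operator
`Δ` on `E` from `P` to functions, then `Δ = 0` on `E`. -/
def IsNormal (F : U → P) : Prop :=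
  ∀ Δ : U → P → Fun n M, IsCDiffOp Δ →
    (∀ u x, OnShell F u x → ∀ φ, JetEq 0 x (Δ u (lin F u φ)) 0) →
    ∀ u x, OnShell F u x → ∀ p, JetEq 0 x (Δ u p) 0

end Bivectors

/-! ## The Kupershmidt deformation -/

section Deformation

variable {U U' P P' : Type*} [AddCommGroup P] [AddCommGroup U] [AddCommGroup U']
  [AddCommGroup P']

/-- The left-hand side `F̃ = (F + A₁^*(w), A₂^*(w))` of the Kupershmidt deformation, in the unknowns
`(u, w)`; here `A' 0` and `A' 1` are `A₁^*` and `A₂^*`. -/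
def deformation (F : U → P) (A' : Fin 2 → U → U' → P) (z : U × U') : P × P :=
  (F z.1 + A' 0 z.1 z.2, A' 1 z.1 z.2)

/-- The operators `Ã₁` and `Ã₂` of the deformation,
`Ã₁ = (A₁, -A₁; 0, L)` and `Ã₂ = (A₂, -A₂; -L, 0)`, where `L` is the operator
`ℓ^*_{F + A₁^*(w) + A₂^*(w)}`. -/
def deformedBivector (A : Fin 2 → U → P' → U) (L : U × U' → P' → U') :
    Fin 2 → U × U' → P' × P' → U × U' :=
  ![fun z ψ => (A 0 z.1 ψ.1 - A 0 z.1 ψ.2, L z ψ.2),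
    fun z ψ => (A 1 z.1 ψ.1 - A 1 z.1 ψ.2, - L z ψ.1)]

end Deformation

end Kupershmidt

end

/-!
The proof computes with spaces of sections and operators on them rather than with coordinates on the
infinite jet space. It has an analytic part, which provides linearizations and formal adjoints, and
an algebraic part.

*Linearizations.* A smooth family of sections `c t` differs from `c 0` by `t` times a smooth family
(`JetModel.hadamard`). An operator that depends on finitely many derivatives and preserves smooth
families therefore has a linearization which is again such an operator; the chain rule
`IsDiffOp.lin_comp`, the product rule `IsCDiffOp.lin_apply` and the symmetry of second
linearizations `IsDiffOp.lin_comm` follow. In coordinates a linear differential operator is a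
combination of finitely many of its own values, the coefficients being smooth and depending linearly
on a jet (`exists_linear_rep`). Hence it maps sections that vanish at a point with all derivatives
to such sections (`flat_of_flat_section`). Modulo expressions of this kind, one may compute on an
equation as if `F` were zero.

*Adjoints.* The fundamental lemma of the calculus of variations is proved in a form that takes care
of equations: let `K` be an operator of order zero whose values have the same integrals as those of
a linear differential operator `D`, all of whose values vanish at `x` with all derivatives; then the
values of `K` vanish at `x`. Indeed, for a bump function of size `ε` in dimension `n` the integral
of `K` would be of size `ε ^ n`, while that of `D` is at most of size `ε ^ (n + 1)`
(`apply_eq_zero_of_chartIntegral_eq`). With `D = 0` this gives the uniqueness of adjoints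
(`IsAdjoint.unique`). Differentiation under the integral sign shows that the derivatives of adjoint
operators are adjoint (`IsFormalAdjoint.null_linOp`).

*The bivectors.* Moving all operators from the first argument of the bracket to `w` turns
`⟦Aᵢ, Aⱼ⟧ = 0` into an identity for the linearizations of `Aᵢ^*(w)` and `Aⱼ^*(w)`
(`bivector_identity_of_schouten_eq_zero`). For `i = j` it says that `Aᵢ` satisfies a bivector
equation for `Aᵢ^*(w)`; together with the identity for `i ≠ j` and the bivector equations for `F`,
this yields the bivector equations of `Ã₁` and `Ã₂` with explicit operators `B̃ᵢ`
(`IsBiHamiltonian.areBivectors_deformedBivector`).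

*The brackets.* For these `B̃ᵢ`, the first component of `⟦Ãᵢ, Ãⱼ⟧` is a bracket of `Aᵢ` and `Aⱼ`
and vanishes identically. The second one is made of derivatives of `L` along the fields `Ãᵢψ`. If
`e = A₁ψ₁ + A₂ψ₂` denotes the component of `ℓ^*ψ` with values in `κ`, then `Ãᵢψ` is, up to the summand
`± (e, 0)`, a field of the form `-(Aλ, -Lλ)` with `A = A₁ + A₂`. The derivative of the bivector
equation for `A` and `F + A₁^*(w) + A₂^*(w)`, passed to adjoints, expresses the skew-symmetrized
derivative of `L` along the latter fields by the operators `Bᵢ^*`, modulo terms that vanish on the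
deformation (`linOp_adjoint_sub_linOp_adjoint`). What remains contains `e`, so that it is trivial
(`IsBiHamiltonian.bracketsVanish_deformedBivector`).

*Independence of the choice.* The difference `Δ` of two choices of `B̃ᵢ`, with its second argument
fixed, annihilates `F̃`. Linearizing, one finds that `Δ ∘ ℓ` vanishes on the equation, so that `Δ`
vanishes there by normality, and so do all its derivatives by regularity. By the fundamental lemma
the adjoint of `Δ` vanishes on the equation as well, and again with all derivatives. Hence the
bracket does not depend there on the choice (`BracketsVanish.of_isRegular_isNormal`).
-/

noncomputable section

set_option linter.unusedSectionVars false

namespace Kupershmidt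

open SectionSpace Filter Topology

/-! ### Section spaces with well-behaved jets and families -/

/-- Smooth families of sections parametrized by an arbitrary normed space. -/
def SmFam {M S X : Type*} [SectionSpace M S] [NormedAddCommGroup X] [NormedSpace ℝ X]
    (c : X → S) : Prop :=
  ∀ (N : ℕ) (g : EuclideanSpace ℝ (Fin N) → X), ContDiff ℝ ∞ g → SmoothFamily (fun b => c (g b))

section Families

variable {M S T X Y : Type*} [SectionSpace M S] [SectionSpace M T] [NormedAddCommGroup X]
  [NormedSpace ℝ X] [NormedAddCommGroup Y] [NormedSpace ℝ Y]

theorem SmFam.comp {c : X → S} (hc : SmFam c) {g : Y → X} (hg : ContDiff ℝ ∞ g) :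
    SmFam (fun y => c (g y)) :=
  fun N _ hh => hc N _ (hg.comp hh)

theorem SmFam.prodMk {c : X → S} {c' : X → T} (hc : SmFam c) (hc' : SmFam c') :
    SmFam (fun a => (c a, c' a)) :=
  fun N g hg => ⟨hc N g hg, hc' N g hg⟩

end Families

/-- The properties of spaces of sections used in the calculus of differential operators.  The
value of a section at `x` is seen through a set `evalAt x` of real-valued functionals; `hadamard`
is division by the parameter of a smooth family, and replaces the Taylor formula. -/
class JetModel {M : outParam (Type*)} [TopologicalSpace M] (S : Type*) [SectionSpace M S]
    [AddCommGroup S] [Module ℝ S] where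
  evalAt : M → Set (S →ₗ[ℝ] ℝ)
  jetEq_iff_sub : ∀ {k : ℕ} {x : M} {s s' : S}, JetEq k x s s' ↔ JetEq k x (s - s') 0
  jet_zero : ∀ (k : ℕ) (x : M), JetEq k x (0 : S) 0
  jet_add : ∀ {k : ℕ} {x : M} {s s' : S}, JetEq k x s 0 → JetEq k x s' 0 → JetEq k x (s + s') 0
  jet_smul : ∀ {k : ℕ} {x : M} {s : S} (r : ℝ), JetEq k x s 0 → JetEq k x (r • s) 0
  jet_mono : ∀ {j k : ℕ} {x : M} {s s' : S}, j ≤ k → JetEq k x s s' → JetEq j x s s'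
  jet_germ : ∀ {k : ℕ} {x : M} {s s' : S}, (∀ᶠ y in 𝓝 x, JetEq 0 y s s') → JetEq k x s s'
  jet_zero_iff : ∀ {x : M} {s s' : S}, JetEq 0 x s s' ↔ ∀ l ∈ evalAt x, l s = l s'
  ext_jet : ∀ {s s' : S}, (∀ x, JetEq 0 x s s') → s = s'
  fam_comp : ∀ {N N' : ℕ} {c : EuclideanSpace ℝ (Fin N) → S}
    {g : EuclideanSpace ℝ (Fin N') → EuclideanSpace ℝ (Fin N)},
    SmoothFamily c → ContDiff ℝ ∞ g → SmoothFamily (fun b => c (g b))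
  fam_const : ∀ (N : ℕ) (s : S), SmoothFamily (fun _ : EuclideanSpace ℝ (Fin N) => s)
  fam_add : ∀ {N : ℕ} {c c' : EuclideanSpace ℝ (Fin N) → S},
    SmoothFamily c → SmoothFamily c' → SmoothFamily (fun b => c b + c' b)
  fam_smul : ∀ {N : ℕ} {f : EuclideanSpace ℝ (Fin N) → ℝ} {c : EuclideanSpace ℝ (Fin N) → S},
    ContDiff ℝ ∞ f → SmoothFamily c → SmoothFamily (fun b => f b • c b)
  fam_eval : ∀ {N : ℕ} {c : EuclideanSpace ℝ (Fin N) → S} {x : M} {l : S →ₗ[ℝ] ℝ},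
    SmoothFamily c → l ∈ evalAt x → ContDiff ℝ ∞ (fun b => l (c b))
  hasVelocity_iff : ∀ {c : ℝ → S} {v : S},
    HasVelocity c v ↔ ∀ x, ∀ l ∈ evalAt x, HasDerivAt (fun t => l (c t)) (l v) 0
  hadamard : ∀ {N : ℕ} (c : EuclideanSpace ℝ (Fin N) × ℝ → S), SmFam c →
    ∃ f : EuclideanSpace ℝ (Fin N) × ℝ → S, SmFam f ∧ ∀ a t, c (a, t) = c (a, 0) + t • f (a, t)

open JetModel

section Basic

variable {M : Type*} [TopologicalSpace M] {S T : Type*} [SectionSpace M S] [SectionSpace M T]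
  [AddCommGroup S] [Module ℝ S] [AddCommGroup T] [Module ℝ T] [JetModel S] [JetModel T]

theorem jet_refl (k : ℕ) (x : M) (s : S) : JetEq k x s s := by
  rw [jetEq_iff_sub, sub_self]; exact jet_zero k x

theorem jet_neg {k : ℕ} {x : M} {s : S} (h : JetEq k x s 0) : JetEq k x (-s) 0 := by
  rw [← neg_one_smul ℝ s]; exact jet_smul _ h

theorem jet_sub {k : ℕ} {x : M} {s s' : S} (h : JetEq k x s 0) (h' : JetEq k x s' 0) :
    JetEq k x (s - s') 0 := by
  rw [sub_eq_add_neg]; exact jet_add h (jet_neg h')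

theorem jet_symm {k : ℕ} {x : M} {s s' : S} (h : JetEq k x s s') : JetEq k x s' s := by
  rw [jetEq_iff_sub] at h ⊢; rw [← neg_sub]; exact jet_neg h

theorem jet_trans {k : ℕ} {x : M} {s s' s'' : S} (h : JetEq k x s s') (h' : JetEq k x s' s'') :
    JetEq k x s s'' := by
  rw [jetEq_iff_sub] at h h' ⊢; rw [← sub_add_sub_cancel s s' s'']; exact jet_add h h'

theorem jet_add_add {k : ℕ} {x : M} {s s' r r' : S} (h : JetEq k x s s') (h' : JetEq k x r r') :
    JetEq k x (s + r) (s' + r') := by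
  rw [jetEq_iff_sub] at h h' ⊢; rw [add_sub_add_comm]; exact jet_add h h'

theorem jet_smul_smul {k : ℕ} {x : M} {s s' : S} (a : ℝ) (h : JetEq k x s s') :
    JetEq k x (a • s) (a • s') := by
  rw [jetEq_iff_sub] at h ⊢; rw [← smul_sub]; exact jet_smul a h

theorem ext_eval {s s' : S} (h : ∀ (x : M), ∀ l ∈ evalAt x, (l : S →ₗ[ℝ] ℝ) s = l s') : s = s' :=
  ext_jet fun x => jet_zero_iff.2 (h x)

section Families

variable {X Y : Type*} [NormedAddCommGroup X] [NormedSpace ℝ X] [NormedAddCommGroup Y]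
  [NormedSpace ℝ Y]

theorem smFam_iff {N : ℕ} {c : EuclideanSpace ℝ (Fin N) → S} : SmFam c ↔ SmoothFamily c :=
  ⟨fun h => h N _ contDiff_id, fun h _ _ hg => fam_comp h hg⟩

theorem SmFam.const (s : S) : SmFam (fun _ : X => s) := fun N _ _ => fam_const N s

theorem SmFam.add {c c' : X → S} (hc : SmFam c) (hc' : SmFam c') : SmFam (fun a => c a + c' a) :=
  fun N g hg => fam_add (hc N g hg) (hc' N g hg)

theorem SmFam.smul {f : X → ℝ} {c : X → S} (hf : ContDiff ℝ ∞ f) (hc : SmFam c) :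
    SmFam (fun a => f a • c a) :=
  fun N g hg => fam_smul (hf.comp hg) (hc N g hg)

theorem SmFam.eval [FiniteDimensional ℝ X] {c : X → S} (hc : SmFam c) {x : M} {l : S →ₗ[ℝ] ℝ}
    (hl : l ∈ evalAt x) : ContDiff ℝ ∞ (fun a => l (c a)) := by
  let e : X ≃L[ℝ] EuclideanSpace ℝ (Fin (Module.finrank ℝ X)) := toEuclidean
  have h := (fam_eval (hc _ e.symm e.symm.contDiff) hl).comp e.contDiff
  simpa [Function.comp_def] using h

theorem SmFam.hadamard_line {c : ℝ → S} (hc : SmFam c) :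
    ∃ f : ℝ → S, SmFam f ∧ (∀ t, c t = c 0 + t • f t) ∧ HasVelocity c (f 0) := by
  obtain ⟨f, hf, h⟩ := hadamard (N := 0) (fun p => c p.2) (hc.comp contDiff_snd)
  have hf' : SmFam (fun t : ℝ => f (0, t)) := hf.comp (contDiff_const.prodMk contDiff_id)
  refine ⟨fun t => f (0, t), hf', fun t => h 0 t, hasVelocity_iff.2 fun x l hl => ?_⟩
  have h1 : (fun t => l (c t)) = fun t => l (c 0) + t * l (f (0, t)) := by
    funext t; rw [h 0 t]; simp
  have h2 := ((hf'.eval hl).differentiable (by simp) 0).hasDerivAt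
  rw [h1]
  simpa using ((hasDerivAt_id (0 : ℝ)).mul h2).const_add (l (c 0))

end Families

theorem hasVelocity_unique {c : ℝ → S} {v v' : S} (h : HasVelocity c v) (h' : HasVelocity c v') :
    v = v' :=
  ext_eval fun x l hl => (hasVelocity_iff.1 h x l hl).unique (hasVelocity_iff.1 h' x l hl)

theorem velocity_eq {c : ℝ → S} {v : S} (h : HasVelocity c v) : velocity c = v := by
  have hex : ∃ v, HasVelocity c v := ⟨v, h⟩
  rw [velocity, dif_pos hex]
  exact hasVelocity_unique (Exists.choose_spec hex) h

end Basic

instance instJetModelProd {M : Type*} [TopologicalSpace M] {S T : Type*} [SectionSpace M S]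
    [SectionSpace M T] [AddCommGroup S] [Module ℝ S] [AddCommGroup T] [Module ℝ T] [JetModel S]
    [JetModel T] : JetModel (S × T) where
  evalAt x := {l | (∃ l₁ ∈ evalAt (S := S) x, l = l₁ ∘ₗ LinearMap.fst ℝ S T) ∨
    ∃ l₂ ∈ evalAt (S := T) x, l = l₂ ∘ₗ LinearMap.snd ℝ S T}
  jetEq_iff_sub := and_congr jetEq_iff_sub jetEq_iff_sub
  jet_zero k x := ⟨jet_zero k x, jet_zero k x⟩
  jet_add h h' := ⟨jet_add h.1 h'.1, jet_add h.2 h'.2⟩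
  jet_smul r h := ⟨jet_smul r h.1, jet_smul r h.2⟩
  jet_mono h h' := ⟨jet_mono h h'.1, jet_mono h h'.2⟩
  jet_germ h := ⟨jet_germ (h.mono fun _ h => h.1), jet_germ (h.mono fun _ h => h.2)⟩
  jet_zero_iff {x s s'} := by
    constructor
    · rintro ⟨h1, h2⟩ l (⟨l, hl, rfl⟩ | ⟨l, hl, rfl⟩)
      · exact jet_zero_iff.1 h1 l hl
      · exact jet_zero_iff.1 h2 l hl
    · intro h
      exact ⟨jet_zero_iff.2 fun l hl => h _ (Or.inl ⟨l, hl, rfl⟩),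
        jet_zero_iff.2 fun l hl => h _ (Or.inr ⟨l, hl, rfl⟩)⟩
  ext_jet h := Prod.ext (ext_jet fun x => (h x).1) (ext_jet fun x => (h x).2)
  fam_comp h hg := ⟨fam_comp h.1 hg, fam_comp h.2 hg⟩
  fam_const N s := ⟨fam_const N s.1, fam_const N s.2⟩
  fam_add h h' := ⟨fam_add h.1 h'.1, fam_add h.2 h'.2⟩
  fam_smul hf h := ⟨fam_smul hf h.1, fam_smul hf h.2⟩
  fam_eval := by
    rintro N c x l hc (⟨l, hl, rfl⟩ | ⟨l, hl, rfl⟩)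
    · exact (fam_eval (S := S) hc.1 hl)
    · exact (fam_eval (S := T) hc.2 hl)
  hasVelocity_iff {c v} := by
    constructor
    · rintro ⟨h1, h2⟩ x l (⟨l, hl, rfl⟩ | ⟨l, hl, rfl⟩)
      · exact hasVelocity_iff.1 h1 x l hl
      · exact hasVelocity_iff.1 h2 x l hl
    · intro h
      exact ⟨hasVelocity_iff.2 fun x l hl => h x _ (Or.inl ⟨l, hl, rfl⟩),
        hasVelocity_iff.2 fun x l hl => h x _ (Or.inr ⟨l, hl, rfl⟩)⟩
  hadamard c hc := by
    obtain ⟨f, hf, h⟩ := hadamard (fun p => (c p).1) (fun N g hg => (hc N g hg).1)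
    obtain ⟨f', hf', h'⟩ := hadamard (fun p => (c p).2) (fun N g hg => (hc N g hg).2)
    exact ⟨fun p => (f p, f' p), hf.prodMk hf', fun a t => Prod.ext (h a t) (h' a t)⟩

/-! ### Calculus of differential operators -/

/-- Maps between section spaces that preserve jets of every order and smooth families: the
differential operators of order zero used to rearrange arguments. -/
@[fun_prop]
structure JetMap {M U P : Type*} [SectionSpace M U] [SectionSpace M P] (g : U → P) : Prop where
  jet : ∀ {k : ℕ} {x : M} {u u' : U}, JetEq k x u u' → JetEq k x (g u) (g u')
  fam : ∀ {N : ℕ} {c : EuclideanSpace ℝ (Fin N) → U}, SmoothFamily c →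
    SmoothFamily (fun a => g (c a))

section JetMaps

variable {M U V P : Type*} [SectionSpace M U] [SectionSpace M V] [SectionSpace M P]

@[fun_prop]
theorem JetMap.id : JetMap (fun u : U => u) := ⟨fun h => h, fun h => h⟩

@[fun_prop]
theorem JetMap.comp {g : V → P} {f : U → V} (hg : JetMap g) (hf : JetMap f) :
    JetMap (fun u => g (f u)) :=
  ⟨fun h => hg.jet (hf.jet h), fun h => hg.fam (hf.fam h)⟩

@[fun_prop]
theorem JetMap.fst {f : U → V × P} (hf : JetMap f) : JetMap (fun u => (f u).1) :=
  ⟨fun h => (hf.jet h).1, fun h => (hf.fam h).1⟩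

@[fun_prop]
theorem JetMap.snd {f : U → V × P} (hf : JetMap f) : JetMap (fun u => (f u).2) :=
  ⟨fun h => (hf.jet h).2, fun h => (hf.fam h).2⟩

@[fun_prop]
theorem JetMap.prodMk {f : U → V} {g : U → P} (hf : JetMap f) (hg : JetMap g) :
    JetMap (fun u => (f u, g u)) :=
  ⟨fun h => ⟨hf.jet h, hg.jet h⟩, fun h => ⟨hf.fam h, hg.fam h⟩⟩

variable [TopologicalSpace M] [AddCommGroup P] [Module ℝ P] [JetModel P]

@[fun_prop]
theorem JetMap.const (p : P) : JetMap (fun _ : U => p) :=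
  ⟨fun _ => jet_refl _ _ _, fun _ => fam_const _ _⟩

@[fun_prop]
theorem JetMap.add {f g : U → P} (hf : JetMap f) (hg : JetMap g) : JetMap (fun u => f u + g u) :=
  ⟨fun h => jet_add_add (hf.jet h) (hg.jet h), fun h => fam_add (hf.fam h) (hg.fam h)⟩

@[fun_prop]
theorem JetMap.const_smul (r : ℝ) {f : U → P} (hf : JetMap f) : JetMap (fun u => r • f u) :=
  ⟨fun h => jet_smul_smul r (hf.jet h), fun h => fam_smul contDiff_const (hf.fam h)⟩

@[fun_prop]
theorem JetMap.neg {f : U → P} (hf : JetMap f) : JetMap (fun u => - f u) := by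
  simpa using hf.const_smul (-1)

@[fun_prop]
theorem JetMap.sub {f g : U → P} (hf : JetMap f) (hg : JetMap g) : JetMap (fun u => f u - g u) := by
  simpa [sub_eq_add_neg] using hf.add hg.neg

end JetMaps

section Calculus

variable {M : Type*} [TopologicalSpace M] {U V P Q R : Type*}
  [SectionSpace M U] [SectionSpace M V] [SectionSpace M P] [SectionSpace M Q] [SectionSpace M R]
  [AddCommGroup U] [Module ℝ U] [AddCommGroup V] [Module ℝ V] [AddCommGroup P] [Module ℝ P]
  [AddCommGroup Q] [Module ℝ Q] [AddCommGroup R] [Module ℝ R]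
  [JetModel U] [JetModel V] [JetModel P] [JetModel Q] [JetModel R]

theorem JetMap.isDiffOp {g : U → P} (hg : JetMap g) : IsDiffOp g :=
  ⟨⟨0, fun _ _ _ h => hg.jet h⟩, fun _ _ hc => hg.fam hc⟩

theorem IsDiffOp.comp_jetMap {D : V → P} (hD : IsDiffOp D) {g : U → V} (hg : JetMap g) :
    IsDiffOp (fun u => D (g u)) := by
  obtain ⟨⟨k, hk⟩, h⟩ := hD
  exact ⟨⟨k, fun x u u' hu => hk x _ _ (hg.jet hu)⟩, fun N c hc => h N _ (hg.fam hc)⟩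

theorem JetMap.comp_isDiffOp {g : V → P} (hg : JetMap g) {D : U → V} (hD : IsDiffOp D) :
    IsDiffOp (fun u => g (D u)) := by
  obtain ⟨⟨k, hk⟩, h⟩ := hD
  exact ⟨⟨k, fun x u u' hu => hg.jet (hk x _ _ hu)⟩, fun N c hc => hg.fam (h N _ hc)⟩

theorem IsDiffOp.prodMk {D : U → P} {E : U → Q} (hD : IsDiffOp D) (hE : IsDiffOp E) :
    IsDiffOp (fun u => (D u, E u)) := by
  obtain ⟨⟨k, hk⟩, h⟩ := hD
  obtain ⟨⟨k', hk'⟩, h'⟩ := hE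
  exact ⟨⟨max k k', fun x u u' hu => ⟨hk x _ _ (jet_mono (le_max_left _ _) hu),
    hk' x _ _ (jet_mono (le_max_right _ _) hu)⟩⟩, fun N c hc => ⟨h N _ hc, h' N _ hc⟩⟩

theorem IsDiffOp.add {D E : U → P} (hD : IsDiffOp D) (hE : IsDiffOp E) :
    IsDiffOp (fun u => D u + E u) :=
  JetMap.comp_isDiffOp (g := fun z : P × P => z.1 + z.2) (by fun_prop) (hD.prodMk hE)

theorem IsDiffOp.sub {D E : U → P} (hD : IsDiffOp D) (hE : IsDiffOp E) :
    IsDiffOp (fun u => D u - E u) :=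
  JetMap.comp_isDiffOp (g := fun z : P × P => z.1 - z.2) (by fun_prop) (hD.prodMk hE)

theorem IsDiffOp.neg {D : U → P} (hD : IsDiffOp D) : IsDiffOp (fun u => - D u) :=
  JetMap.comp_isDiffOp (g := fun z : P => - z) (by fun_prop) hD

theorem IsDiffOp.smFam {X : Type*} [NormedAddCommGroup X] [NormedSpace ℝ X] {D : U → P}
    (hD : IsDiffOp D) {c : X → U} (hc : SmFam c) : SmFam (fun a => D (c a)) :=
  fun N g hg => hD.2 N _ (hc N g hg)

/-- A differential operator is local: its value at `x` depends on the germ of its argument. -/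
theorem IsDiffOp.local {D : U → P} (hD : IsDiffOp D) {x : M} {u u' : U}
    (h : ∀ᶠ y in 𝓝 x, JetEq 0 y u u') : JetEq 0 x (D u) (D u') := by
  obtain ⟨⟨k, hk⟩, -⟩ := hD
  exact hk x _ _ (jet_germ h)

theorem smFam_line (u φ : U) : SmFam (fun t : ℝ => u + t • φ) :=
  (SmFam.const u).add (SmFam.smul contDiff_id (SmFam.const φ))

theorem IsDiffOp.hasVelocity_lin {D : U → P} (hD : IsDiffOp D) (u φ : U) :
    HasVelocity (fun t : ℝ => D (u + t • φ)) (lin D u φ) := by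
  obtain ⟨f, -, -, h⟩ := (hD.smFam (smFam_line u φ)).hadamard_line
  rw [lin, velocity_eq h]
  exact h

theorem IsDiffOp.hasDerivAt_lin {D : U → P} (hD : IsDiffOp D) (u φ : U) {x : M}
    {l : P →ₗ[ℝ] ℝ} (hl : l ∈ evalAt x) :
    HasDerivAt (fun t : ℝ => l (D (u + t • φ))) (l (lin D u φ)) 0 :=
  hasVelocity_iff.1 (hD.hasVelocity_lin u φ) x l hl

/-- Finite-dimensional families of directions: the linearization is the Fréchet derivative. -/
theorem IsDiffOp.eval_lin_eq_fderiv {X : Type*} [NormedAddCommGroup X] [NormedSpace ℝ X]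
    [FiniteDimensional ℝ X] {D : U → P} (hD : IsDiffOp D) {u : U} {T : X → U} (hT : SmFam T)
    (hT' : IsLinearMap ℝ T) {x : M} {l : P →ₗ[ℝ] ℝ} (hl : l ∈ evalAt x) (a b : X) :
    l (lin D (u + T a) (T b)) = fderiv ℝ (fun a => l (D (u + T a))) a b := by
  have hg : ContDiff ℝ ∞ (fun a => l (D (u + T a))) :=
    (hD.smFam ((SmFam.const u).add hT)).eval hl
  have h1 : HasFDerivAt (fun a => l (D (u + T a))) (fderiv ℝ (fun a => l (D (u + T a))) a)
      (a + (0 : ℝ) • b) := by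
    rw [zero_smul, add_zero]
    exact (hg.differentiable (by simp) a).hasFDerivAt
  have h2 : HasDerivAt (fun t : ℝ => a + t • b) b 0 := by
    simpa using ((hasDerivAt_id (0 : ℝ)).smul_const b).const_add a
  have h3 := h1.comp_hasDerivAt (0 : ℝ) h2
  have h4 := hD.hasDerivAt_lin (u + T a) (T b) hl
  have h5 : (fun t : ℝ => l (D (u + T a + t • T b))) =
      (fun a => l (D (u + T a))) ∘ fun t : ℝ => a + t • b := by
    funext t; simp [hT'.map_add, hT'.map_smul, add_assoc]
  rw [h5] at h4
  exact h4.unique h3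

theorem smFam_plane (φ ψ : U) : SmFam (fun a : ℝ × ℝ => a.1 • φ + a.2 • ψ) :=
  (SmFam.smul contDiff_fst (SmFam.const φ)).add (SmFam.smul contDiff_snd (SmFam.const ψ))

theorem isLinearMap_plane (φ ψ : U) :
    IsLinearMap ℝ (fun a : ℝ × ℝ => a.1 • φ + a.2 • ψ) :=
  ⟨fun a b => by simp only [Prod.fst_add, Prod.snd_add]; module,
    fun r a => by simp only [Prod.smul_fst, Prod.smul_snd, smul_eq_mul]; module⟩

theorem IsDiffOp.isLinearMap_lin {D : U → P} (hD : IsDiffOp D) (u : U) :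
    IsLinearMap ℝ (lin D u) := by
  have key : ∀ (φ ψ : U) (x : M) (l : P →ₗ[ℝ] ℝ), l ∈ evalAt x → ∀ r s : ℝ,
      l (lin D u (r • φ + s • ψ)) =
        fderiv ℝ (fun a : ℝ × ℝ => l (D (u + (a.1 • φ + a.2 • ψ)))) 0 (r, s) := by
    intro φ ψ x l hl r s
    have h := hD.eval_lin_eq_fderiv (u := u) (smFam_plane φ ψ) (isLinearMap_plane φ ψ) hl 0 (r, s)
    simpa using h
  refine ⟨fun φ ψ => ext_eval fun x l hl => ?_, fun r φ => ext_eval fun x l hl => ?_⟩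
  · have h1 := key φ ψ x l hl 1 1
    have h2 := key φ ψ x l hl 1 0
    have h3 := key φ ψ x l hl 0 1
    simp only [one_smul, zero_smul, add_zero, zero_add] at h1 h2 h3
    rw [map_add, h1, h2, h3, ← map_add]
    simp
  · have h1 := key φ 0 x l hl r 0
    have h2 := key φ 0 x l hl 1 0
    simp only [one_smul, zero_smul, add_zero] at h1 h2
    rw [map_smul, h1, h2, ← map_smul]
    simp

/-- Second derivatives are symmetric. -/
theorem IsDiffOp.lin_lin_comm {D : U → P} (hD : IsDiffOp D) (u φ ψ : U)
    (h₁ : IsDiffOp (fun v => lin D v φ)) (h₂ : IsDiffOp (fun v => lin D v ψ)) :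
    lin (fun v => lin D v φ) u ψ = lin (fun v => lin D v ψ) u φ := by
  refine ext_eval fun x l hl => ?_
  set T : ℝ × ℝ → U := fun a => a.1 • φ + a.2 • ψ with hTdef
  have hT : SmFam T := smFam_plane φ ψ
  have hT' : IsLinearMap ℝ T := isLinearMap_plane φ ψ
  set g : ℝ × ℝ → ℝ := fun a => l (D (u + T a)) with hgdef
  have hg : ContDiff ℝ ∞ g := (hD.smFam ((SmFam.const u).add hT)).eval hl
  have hd : Differentiable ℝ (fderiv ℝ g) :=
    (hg.fderiv_right (m := ∞) (by simp)).differentiable (by simp)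
  -- the derivative along `b` of the derivative along `a`
  have key : ∀ a b : ℝ × ℝ, IsDiffOp (fun v => lin D v (T a)) →
      l (lin (fun v => lin D v (T a)) u (T b)) = fderiv ℝ (fderiv ℝ g) 0 b a := by
    intro a b hab
    have h1 := hab.eval_lin_eq_fderiv (u := u) hT hT' hl 0 b
    have h2 : (fun c => l (lin D (u + T c) (T a))) = fun c => fderiv ℝ g c a := by
      funext c; exact hD.eval_lin_eq_fderiv hT hT' hl c a
    rw [h2, hT'.map_zero, add_zero] at h1
    rw [h1, fderiv_clm_apply hd.differentiableAt (differentiableAt_const a)]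
    simp
  have ha : T (1, 0) = φ := by simp [hTdef]
  have hb : T (0, 1) = ψ := by simp [hTdef]
  have k1 := key (1, 0) (0, 1) (by rw [ha]; exact h₁)
  have k2 := key (0, 1) (1, 0) (by rw [hb]; exact h₂)
  rw [ha, hb] at k1 k2
  rw [k1, k2]
  have hs : IsSymmSndFDerivAt ℝ g 0 :=
    (hg.contDiffAt (x := 0)).isSymmSndFDerivAt (by simpa using WithTop.coe_le_coe.2 (le_top (a := (2 : ℕ∞))))
  exact hs _ _

/-- The linearization is a differential operator in the point and the direction jointly. -/
theorem IsDiffOp.isDiffOp_lin {D : U → P} (hD : IsDiffOp D) :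
    IsDiffOp (fun z : U × U => lin D z.1 z.2) := by
  constructor
  · obtain ⟨⟨k, hk⟩, -⟩ := id hD
    refine ⟨k, fun x z z' h => jet_zero_iff.2 fun l hl => ?_⟩
    have h1 := hD.hasDerivAt_lin z.1 z.2 hl
    have h2 := hD.hasDerivAt_lin z'.1 z'.2 hl
    have h3 : (fun t : ℝ => l (D (z.1 + t • z.2))) = fun t : ℝ => l (D (z'.1 + t • z'.2)) := by
      funext t
      exact jet_zero_iff.1 (hk x _ _ (jet_add_add h.1 (jet_smul_smul t h.2))) l hl
    rw [h3] at h1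
    exact h1.unique h2
  · intro N c hc
    have hfam : SmFam (fun p : EuclideanSpace ℝ (Fin N) × ℝ => D ((c p.1).1 + p.2 • (c p.1).2)) :=
      hD.smFam (SmFam.add ((smFam_iff.2 hc.1).comp contDiff_fst)
        (SmFam.smul contDiff_snd ((smFam_iff.2 hc.2).comp contDiff_fst)))
    obtain ⟨f, hf, h⟩ := hadamard _ hfam
    have hf0 : SmFam (fun a : EuclideanSpace ℝ (Fin N) => f (a, 0)) :=
      hf.comp (contDiff_id.prodMk contDiff_const)
    convert smFam_iff.1 hf0 using 2 with a
    refine hasVelocity_unique (hD.hasVelocity_lin _ _) (hasVelocity_iff.2 fun x l hl => ?_)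
    have hf1 : SmFam (fun t : ℝ => f (a, t)) := hf.comp (contDiff_const.prodMk contDiff_id)
    have h1 : (fun t : ℝ => l (D ((c a).1 + t • (c a).2))) =
        fun t => l (D ((c a).1 + (0 : ℝ) • (c a).2)) + t * l (f (a, t)) := by
      funext t; rw [h a t]; simp
    have h2 := ((hf1.eval hl).differentiable (by simp) 0).hasDerivAt
    rw [h1]
    simpa using ((hasDerivAt_id (0 : ℝ)).mul h2).const_add
      (l (D ((c a).1 + (0 : ℝ) • (c a).2)))

theorem IsDiffOp.lin_comm {D : U → P} (hD : IsDiffOp D) (u φ ψ : U) :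
    lin (fun v => lin D v φ) u ψ = lin (fun v => lin D v ψ) u φ :=
  hD.lin_lin_comm u φ ψ (hD.isDiffOp_lin.comp_jetMap (g := fun v => (v, φ)) (by fun_prop))
    (hD.isDiffOp_lin.comp_jetMap (g := fun v => (v, ψ)) (by fun_prop))

/-- The chain rule along a curve. -/
theorem IsDiffOp.hasVelocity_comp {D : U → P} (hD : IsDiffOp D) {c : ℝ → U} (hc : SmFam c) {v : U}
    (hv : HasVelocity c v) : HasVelocity (fun t => D (c t)) (lin D (c 0) v) := by
  obtain ⟨f, hf, hcf, h0⟩ := hc.hadamard_line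
  obtain rfl := hasVelocity_unique hv h0
  refine hasVelocity_iff.2 fun x l hl => ?_
  -- `D (c₀ + s f_t)` on the diagonal; it is constant in `t` for `s = 0`
  set g : ℝ × ℝ → ℝ := fun p => l (D (c 0 + p.1 • f p.2)) with hgdef
  have hg : ContDiff ℝ ∞ g := (hD.smFam ((SmFam.const (c 0)).add
    (SmFam.smul contDiff_fst (hf.comp contDiff_snd)))).eval hl
  have hg' : HasFDerivAt g (fderiv ℝ g (0, 0)) (0, 0) :=
    (hg.differentiable (by simp) _).hasFDerivAt
  have d1 : HasDerivAt (fun t : ℝ => g (t, t)) (fderiv ℝ g (0, 0) (1, 1)) 0 :=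
    HasFDerivAt.comp_hasDerivAt (f := fun t : ℝ => (t, t)) (0 : ℝ) hg'
      ((hasDerivAt_id (0 : ℝ)).prodMk (hasDerivAt_id (0 : ℝ)))
  have d2 : HasDerivAt (fun t : ℝ => g (t, 0)) (fderiv ℝ g (0, 0) (1, 0)) 0 :=
    HasFDerivAt.comp_hasDerivAt (f := fun t : ℝ => (t, 0)) (0 : ℝ) hg'
      ((hasDerivAt_id (0 : ℝ)).prodMk (hasDerivAt_const (0 : ℝ) (0 : ℝ)))
  have d3 : HasDerivAt (fun t : ℝ => g (0, t)) (fderiv ℝ g (0, 0) (0, 1)) 0 :=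
    HasFDerivAt.comp_hasDerivAt (f := fun t : ℝ => (0, t)) (0 : ℝ) hg'
      ((hasDerivAt_const (0 : ℝ) (0 : ℝ)).prodMk (hasDerivAt_id (0 : ℝ)))
  have e3 : fderiv ℝ g (0, 0) (0, 1) = 0 := by
    refine d3.unique ?_
    simpa [hgdef] using hasDerivAt_const (0 : ℝ) (l (D (c 0)))
  have e2 : fderiv ℝ g (0, 0) (1, 0) = l (lin D (c 0) (f 0)) :=
    d2.unique (hD.hasDerivAt_lin (c 0) (f 0) hl)
  have e1 : fderiv ℝ g (0, 0) (1, 1) = l (lin D (c 0) (f 0)) := by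
    have h11 : ((1, 1) : ℝ × ℝ) = (1, 0) + (0, 1) := by simp
    rw [h11, map_add, e2, e3, add_zero]
  rw [e1] at d1
  have e4 : (fun t => l (D (c t))) = fun t => g (t, t) := by
    funext t; rw [hgdef, hcf t]
  rw [e4]; exact d1

theorem IsDiffOp.lin_comp {D : V → P} {E : U → V} (hD : IsDiffOp D) (hE : IsDiffOp E) (u φ : U) :
    lin (fun v => D (E v)) u φ = lin D (E u) (lin E u φ) := by
  have h := hD.hasVelocity_comp (hE.smFam (smFam_line u φ)) (hE.hasVelocity_lin u φ)
  simp only [zero_smul, add_zero] at h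
  exact velocity_eq h

theorem lin_eq_of_linear {D : U → P} (hl : IsLinearMap ℝ D) (u φ : U) :
    lin D u φ = D φ := by
  refine (velocity_eq (hasVelocity_iff.2 fun x l hx => ?_))
  have h1 : (fun t : ℝ => l (D (u + t • φ))) = fun t => l (D u) + t * l (D φ) := by
    funext t; rw [hl.map_add, hl.map_smul]; simp
  rw [h1]
  simpa using ((hasDerivAt_id (0 : ℝ)).mul_const (l (D φ))).const_add (l (D u))

theorem IsDiffOp.lin_prodMk {D : U → P} {E : U → Q} (hD : IsDiffOp D) (hE : IsDiffOp E) (u φ : U) :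
    lin (fun v => (D v, E v)) u φ = (lin D u φ, lin E u φ) :=
  velocity_eq ⟨hD.hasVelocity_lin u φ, hE.hasVelocity_lin u φ⟩

theorem IsDiffOp.lin_add {D E : U → P} (hD : IsDiffOp D) (hE : IsDiffOp E) (u φ : U) :
    lin (fun v => D v + E v) u φ = lin D u φ + lin E u φ := by
  refine velocity_eq (hasVelocity_iff.2 fun x l hl => ?_)
  simpa only [map_add] using (hD.hasDerivAt_lin u φ hl).fun_add (hE.hasDerivAt_lin u φ hl)

theorem IsDiffOp.lin_neg {D : U → P} (hD : IsDiffOp D) (u φ : U) :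
    lin (fun v => - D v) u φ = - lin D u φ := by
  have h : JetMap (fun z : P => - z) := by fun_prop
  rw [h.isDiffOp.lin_comp hD u φ,
    lin_eq_of_linear ⟨fun a b => by abel, fun r a => by simp⟩]

theorem IsDiffOp.lin_sub {D E : U → P} (hD : IsDiffOp D) (hE : IsDiffOp E) (u φ : U) :
    lin (fun v => D v - E v) u φ = lin D u φ - lin E u φ := by
  simp only [sub_eq_add_neg]
  rw [hD.lin_add hE.neg, hE.lin_neg]

theorem lin_const (p : P) (u φ : U) : lin (fun _ : U => p) u φ = 0 :=
  velocity_eq (hasVelocity_iff.2 fun _ l _ => by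
    simpa using hasDerivAt_const (0 : ℝ) (l p))

/-! ### `𝒞`-differential operators and the product rule -/

theorem IsCDiffOp.isDiffOp_apply {Δ : U → P → Q} (h : IsCDiffOp Δ) (u : U) : IsDiffOp (Δ u) :=
  h.2.comp_jetMap (g := fun p => (u, p)) (by fun_prop)

theorem IsCDiffOp.isDiffOp_coeff {Δ : U → P → Q} (h : IsCDiffOp Δ) (p : P) :
    IsDiffOp (fun u => Δ u p) :=
  h.2.comp_jetMap (g := fun u => (u, p)) (by fun_prop)

theorem linOp_eq_lin {Δ : U → P → Q} (p : P) (u φ : U) :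
    linOp Δ p u φ = lin (fun z : U × P => Δ z.1 z.2) (u, p) (φ, 0) := by
  simp [linOp, lin]

/-- `ℓ_{Δ,p}(φ)` is a differential operator in `Δ`'s base point, `p` and `φ` jointly. -/
theorem IsCDiffOp.isDiffOp_linOp {Δ : U → P → Q} (h : IsCDiffOp Δ) :
    IsDiffOp (fun z : U × P × U => linOp Δ z.2.1 z.1 z.2.2) := by
  simp only [linOp_eq_lin]
  exact h.2.isDiffOp_lin.comp_jetMap (g := fun z : U × P × U => ((z.1, z.2.1), (z.2.2, 0)))
    (by fun_prop)

theorem IsCDiffOp.linear_linOp_dir {Δ : U → P → Q} (h : IsCDiffOp Δ) (p : P) (u : U) :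
    IsLinearMap ℝ (linOp Δ p u) :=
  (h.isDiffOp_coeff p).isLinearMap_lin u

theorem IsCDiffOp.linear_linOp_arg {Δ : U → P → Q} (h : IsCDiffOp Δ) (u φ : U) :
    IsLinearMap ℝ (fun p => linOp Δ p u φ) := by
  refine ⟨fun p q => ?_, fun r p => ?_⟩
  · have : (fun v => Δ v (p + q)) = fun v => Δ v p + Δ v q := by
      funext v; exact (h.1 v).map_add p q
    simp only [linOp, this]
    exact (h.isDiffOp_coeff p).lin_add (h.isDiffOp_coeff q) u φ
  · have hr : (fun v => Δ v (r • p)) = fun v => r • Δ v p := by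
      funext v; exact (h.1 v).map_smul r p
    have hj : JetMap (fun z : Q => r • z) := by fun_prop
    simp only [linOp, hr]
    rw [hj.isDiffOp.lin_comp (h.isDiffOp_coeff p),
      lin_eq_of_linear ⟨fun a b => smul_add r a b, fun s a => smul_comm r s a⟩]

/-- The product rule `ℓ_{Δ(E)} = ℓ_{Δ,E} + Δ ∘ ℓ_E`. -/
theorem IsCDiffOp.lin_apply {Δ : U → P → Q} (h : IsCDiffOp Δ) {E : U → P} (hE : IsDiffOp E)
    (u φ : U) : lin (fun v => Δ v (E v)) u φ = linOp Δ (E u) u φ + Δ u (lin E u φ) := by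
  have hid : JetMap (fun v : U => v) := by fun_prop
  have h1 := h.2.lin_comp (hid.isDiffOp.prodMk hE) u φ
  rw [hid.isDiffOp.lin_prodMk hE, lin_eq_of_linear (D := fun v : U => v)
    ⟨fun _ _ => rfl, fun _ _ => rfl⟩] at h1
  have h2 : ((φ, lin E u φ) : U × P) = (φ, 0) + (0, lin E u φ) := by simp
  rw [h1, h2, (h.2.isLinearMap_lin _).map_add, linOp_eq_lin]
  congr 1
  have h3 := lin_eq_of_linear (h.1 u) (E u) (lin E u φ)
  rw [← h3]
  simp [lin]

/-- The linearization in two unknowns is the sum of the partial linearizations. -/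
theorem IsDiffOp.lin_prod {D : U × V → P} (hD : IsDiffOp D) (u φ : U) (v ψ : V) :
    lin D (u, v) (φ, ψ) = lin (fun u' => D (u', v)) u φ + lin (fun v' => D (u, v')) v ψ := by
  have h2 : ((φ, ψ) : U × V) = (φ, 0) + (0, ψ) := by simp
  rw [h2, (hD.isLinearMap_lin _).map_add]
  simp [lin]

end Calculus

open JetModel

/-! ### Vanishing derivatives of smooth maps between normed spaces -/

section Calc

variable {D E F G : Type*} [NormedAddCommGroup D] [NormedSpace ℝ D] [NormedAddCommGroup E]
  [NormedSpace ℝ E] [NormedAddCommGroup F] [NormedSpace ℝ F] [NormedAddCommGroup G]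
  [NormedSpace ℝ G]

/-- The derivatives of `f` of order at most `k` vanish at `y`. -/
def DerivZero (k : ℕ) (f : E → F) (y : E) : Prop := ∀ j ≤ k, iteratedFDeriv ℝ j f y = 0

theorem DerivZero.congr {k : ℕ} {f g : E → F} {y : E} (h : DerivZero k f y) (hfg : g =ᶠ[𝓝 y] f) :
    DerivZero k g y := fun j hj => by
  rw [(hfg.iteratedFDeriv ℝ j).eq_of_nhds]; exact h j hj

theorem DerivZero.apply {k : ℕ} {f : E → F} {y : E} (h : DerivZero k f y) : f y = 0 := by
  have := congrArg (fun m => m 0) (h 0 (Nat.zero_le k))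
  simpa using this

theorem derivZero_zero_iff {f : E → F} {y : E} : DerivZero 0 f y ↔ f y = 0 := by
  refine ⟨fun h => h.apply, fun h j hj => ?_⟩
  obtain rfl := Nat.le_zero.1 hj
  ext m; simpa using h

theorem exists_open_contDiffOn {f : E → F} {y : E} (hf : ContDiffAt ℝ ∞ f y) (k : ℕ) :
    ∃ u : Set E, IsOpen u ∧ y ∈ u ∧ ContDiffOn ℝ k f u := by
  obtain ⟨u, hu, hyu, h⟩ := (hf.contDiffWithinAt (s := Set.univ)).contDiffOn' (m := (k : WithTop ℕ∞))
    (by exact_mod_cast le_top) (by simp)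
  exact ⟨u, hu, hyu, h.mono fun z hz => ⟨Or.inr trivial, hz⟩⟩

theorem DerivZero.bilin (B : E →L[ℝ] F →L[ℝ] G) {f : D → E} {g : D → F} {y : D} {k : ℕ}
    (hf : ContDiffAt ℝ ∞ f y) (hg : ContDiffAt ℝ ∞ g y) (h : DerivZero k g y) :
    DerivZero k (fun z => B (f z) (g z)) y := by
  intro j hj
  obtain ⟨u, hu, hyu, hfu⟩ := exists_open_contDiffOn hf j
  obtain ⟨v, hv, hyv, hgv⟩ := exists_open_contDiffOn hg j
  have huv : IsOpen (u ∩ v) := hu.inter hv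
  have h1 := B.norm_iteratedFDerivWithin_le_of_bilinear (hfu.mono Set.inter_subset_left)
    (hgv.mono Set.inter_subset_right) huv.uniqueDiffOn ⟨hyu, hyv⟩ (n := j) le_rfl
  rw [← norm_eq_zero]
  refine le_antisymm ?_ (norm_nonneg _)
  rw [iteratedFDerivWithin_of_isOpen _ huv ⟨hyu, hyv⟩] at h1
  refine h1.trans (le_of_eq ?_)
  rw [Finset.sum_eq_zero, mul_zero]
  intro i _
  rw [iteratedFDerivWithin_of_isOpen (j - i) huv ⟨hyu, hyv⟩, h _ ((Nat.sub_le _ _).trans hj)]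
  simp

theorem DerivZero.comp {f : D → E} {g : E → F} {y : D} {k : ℕ}
    (hg : ContDiffAt ℝ ∞ g (f y)) (hf : ContDiffAt ℝ ∞ f y) (h : DerivZero k g (f y)) :
    DerivZero k (fun z => g (f z)) y := by
  intro j hj
  obtain ⟨v, hv, hyv, hgv⟩ := exists_open_contDiffOn hg j
  obtain ⟨u, hu, hyu, hfu⟩ := exists_open_contDiffOn hf j
  have huv : IsOpen (u ∩ f ⁻¹' v) := hfu.continuousOn.isOpen_inter_preimage hu hv
  have hy : y ∈ u ∩ f ⁻¹' v := ⟨hyu, hyv⟩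
  -- a common bound for the finitely many derivatives of `f`
  set K : ℝ := 1 + ∑ i ∈ Finset.range (j + 1), ‖iteratedFDeriv ℝ i f y‖ with hK
  have hsum : 0 ≤ ∑ i ∈ Finset.range (j + 1), ‖iteratedFDeriv ℝ i f y‖ :=
    Finset.sum_nonneg fun _ _ => norm_nonneg _
  have h1 := norm_iteratedFDerivWithin_comp_le hgv (hfu.mono Set.inter_subset_left) le_rfl
    hv.uniqueDiffOn huv.uniqueDiffOn (fun z hz => hz.2) hy (C := 0) (D := K) (n := j)
    (fun i hi => by
      rw [iteratedFDerivWithin_of_isOpen i hv hyv, h i (hi.trans hj), norm_zero])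
    (fun i hi1 hi => by
      rw [iteratedFDerivWithin_of_isOpen i huv hy]
      have h2 : ‖iteratedFDeriv ℝ i f y‖ ≤ ∑ i ∈ Finset.range (j + 1), ‖iteratedFDeriv ℝ i f y‖ :=
        Finset.single_le_sum (f := fun i => ‖iteratedFDeriv ℝ i f y‖)
          (fun _ _ => norm_nonneg _) (Finset.mem_range.2 (by omega))
      calc ‖iteratedFDeriv ℝ i f y‖ ≤ K := by rw [hK]; linarith
        _ ≤ K ^ i := le_self_pow₀ (by rw [hK]; linarith) (by omega))
  rw [iteratedFDerivWithin_of_isOpen _ huv hy] at h1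
  rw [← norm_eq_zero]
  exact le_antisymm (by simpa [Function.comp_def] using h1) (norm_nonneg _)

theorem derivZero_sub_iff {f g : E → F} {y : E} {k : ℕ} (hf : ContDiffAt ℝ ∞ f y)
    (hg : ContDiffAt ℝ ∞ g y) : DerivZero k (fun z => f z - g z) y ↔
      ∀ j ≤ k, iteratedFDeriv ℝ j f y = iteratedFDeriv ℝ j g y := by
  refine forall₂_congr fun j _ => ?_
  have hj : (j : WithTop ℕ∞) ≤ ∞ := by exact_mod_cast le_top
  rw [show (fun z => f z - g z) = f - g from rfl,
    iteratedFDeriv_sub_apply (hf.of_le hj) (hg.of_le hj), sub_eq_zero]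

theorem DerivZero.add {f g : E → F} {y : E} {k : ℕ} (hf : ContDiffAt ℝ ∞ f y)
    (hg : ContDiffAt ℝ ∞ g y) (h : DerivZero k f y) (h' : DerivZero k g y) :
    DerivZero k (fun z => f z + g z) y := by
  intro j hj
  have hj' : (j : WithTop ℕ∞) ≤ ∞ := by exact_mod_cast le_top
  rw [show (fun z => f z + g z) = f + g from rfl,
    iteratedFDeriv_add_apply (hf.of_le hj') (hg.of_le hj'), h j hj, h' j hj, add_zero]

theorem DerivZero.sum {ι : Type*} (t : Finset ι) {f : ι → E → F} {y : E} {k : ℕ}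
    (hf : ∀ i, ContDiffAt ℝ ∞ (f i) y) (h : ∀ i, DerivZero k (f i) y) :
    DerivZero k (fun z => ∑ i ∈ t, f i z) y := by
  classical
  induction t using Finset.induction_on with
  | empty =>
    intro j _
    simp only [Finset.sum_empty]
    rw [iteratedFDeriv_fun_zero]; rfl
  | insert i t hi ih =>
    simp only [Finset.sum_insert hi]
    exact DerivZero.add (hf i) (ContDiffAt.sum fun j _ => hf j) (h i) ih

theorem DerivZero.isometry_comp (L : F ≃ₗᵢ[ℝ] G) {f : E → F} {y : E} {k : ℕ}
    (h : DerivZero k f y) : DerivZero k (fun z => L (f z)) y := by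
  intro j hj
  rw [← norm_eq_zero]
  refine (L.norm_iteratedFDeriv_comp_left f y j).trans ?_
  rw [h j hj, norm_zero]

theorem DerivZero.fderiv {f : E → F} {y : E} {k : ℕ} (h : DerivZero (k + 1) f y) :
    DerivZero k (fderiv ℝ f) y := by
  intro j hj
  rw [← norm_eq_zero, norm_iteratedFDeriv_fderiv, h (j + 1) (by omega), norm_zero]

set_option synthInstance.maxHeartbeats 400000 in
set_option maxHeartbeats 1000000 in
/-- If all derivatives of `f` vanish at `y`, so do all derivatives of its derivatives. -/
theorem derivZero_iteratedFDeriv {f : E → F} {y : E} (h : ∀ k, DerivZero k f y) (i : ℕ) :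
    ∀ k, DerivZero k (iteratedFDeriv ℝ i f) y := by
  induction i with
  | zero =>
    intro k
    exact (h k).isometry_comp (continuousMultilinearCurryFin0 ℝ E F).symm
  | succ i ih =>
    intro k
    let L : (E →L[ℝ] E [×i]→L[ℝ] F) ≃ₗᵢ[ℝ] (E [×(i + 1)]→L[ℝ] F) :=
      (continuousMultilinearCurryLeftEquiv ℝ (fun _ : Fin (i + 1) => E) F).symm
    exact (ih (k + 1)).fderiv.isometry_comp L

end Calc

section Hadamard

variable {P F : Type*} [NormedAddCommGroup P] [NormedSpace ℝ P] [NormedAddCommGroup F]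
  [NormedSpace ℝ F] [CompleteSpace F]

open MeasureTheory in
/-- Integrals over `[0, 1]` depend smoothly on parameters. -/
theorem contDiffOn_integral_Icc {s : Set P} (hs : IsOpen s) {g : P × ℝ → F}
    (hg : ContDiffOn ℝ ∞ g (s ×ˢ Set.univ)) :
    ContDiffOn ℝ ∞ (fun p => ∫ t in Set.Icc (0 : ℝ) 1, g (p, t)) s := by
  -- the integral is a convolution with the characteristic function of `[0, 1]`
  let κ : ContDiffBump (0 : ℝ) := ⟨1, 2, by norm_num, by norm_num⟩
  let f : ℝ → ℝ := Set.indicator (Set.Icc (0 : ℝ) 1) (fun _ => 1)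
  have hf : LocallyIntegrable f :=
    (integrable_indicator_iff measurableSet_Icc |>.2
      (continuousOn_const.integrableOn_compact isCompact_Icc)).locallyIntegrable
  let G : P → ℝ → F := fun p x => κ x • g (p, -x)
  have hG : ContDiffOn ℝ ∞ (↿G) (s ×ˢ Set.univ) := by
    have h1 : ContDiff ℝ ∞ (fun q : P × ℝ => κ q.2) := κ.contDiff.comp contDiff_snd
    have h2 : ContDiffOn ℝ ∞ (fun q : P × ℝ => g (q.1, -q.2)) (s ×ˢ Set.univ) :=
      hg.comp (contDiff_fst.prodMk contDiff_snd.neg).contDiffOn fun q hq => ⟨hq.1, trivial⟩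
    exact h1.contDiffOn.smul h2
  have h := contDiffOn_convolution_right_with_param (μ := volume) (n := ⊤)
    (ContinuousLinearMap.lsmul ℝ ℝ) (g := G) (k := Metric.closedBall (0 : ℝ) 2) hs
    (isCompact_closedBall _ _)
    (fun p x _ hx => by
      have : κ x = 0 := κ.zero_of_le_dist (by simpa using (not_le.1 (by simpa using hx)).le)
      simp [G, this]) hf hG
  have h2 := h.comp (f := fun p : P => (p, (0 : ℝ))) (s := s)
    (contDiff_id.prodMk contDiff_const).contDiffOn fun p hp => ⟨hp, trivial⟩
  refine h2.congr fun p _ => ?_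
  simp only [Function.comp, convolution]
  rw [← integral_indicator measurableSet_Icc]
  congr 1
  funext t
  by_cases ht : t ∈ Set.Icc (0 : ℝ) 1
  · have : κ (-t) = 1 := by
      rw [← zero_sub]
      exact κ.one_of_mem_closedBall (by
        simp only [zero_sub, Metric.mem_closedBall, dist_zero_right, norm_neg, Real.norm_eq_abs]
        exact abs_le.2 ⟨by linarith [ht.1], ht.2⟩)
    simp [f, G, ht, this]
  · simp [f, ht]

open MeasureTheory in
/-- Division by the parameter of a smooth family of functions. -/
theorem contDiffOn_dslope {s : Set P} (hs : IsOpen s) {h : P × ℝ → F}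
    (hh : ContDiffOn ℝ ∞ h (s ×ˢ Set.univ)) :
    ContDiffOn ℝ ∞ (fun q : P × ℝ => dslope (fun t => h (q.1, t)) 0 q.2) (s ×ˢ Set.univ) := by
  have hs' : IsOpen (s ×ˢ (Set.univ : Set ℝ)) := hs.prod isOpen_univ
  have hd : ∀ p ∈ s, ∀ t : ℝ, HasDerivAt (fun t => h (p, t)) (fderiv ℝ h (p, t) (0, 1)) t := by
    intro p hp t
    have h1 : HasFDerivAt h (fderiv ℝ h (p, t)) (p, t) :=
      ((hh.contDiffAt (hs'.mem_nhds ⟨hp, trivial⟩)).differentiableAt (by simp)).hasFDerivAt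
    exact HasFDerivAt.comp_hasDerivAt (f := fun t : ℝ => (p, t)) t h1
      ((hasDerivAt_const t p).prodMk (hasDerivAt_id t))
  have hg : ContDiffOn ℝ ∞ (fun q : P × ℝ => fderiv ℝ h q (0, 1)) (s ×ˢ Set.univ) :=
    (hh.fderiv_of_isOpen hs' (m := ∞) (by simp)).clm_apply contDiffOn_const
  have hg2 : ContDiffOn ℝ ∞ (fun q : (P × ℝ) × ℝ => fderiv ℝ h (q.1.1, q.2 * q.1.2) (0, 1))
      ((s ×ˢ Set.univ) ×ˢ Set.univ) :=
    hg.comp ((contDiff_fst.comp contDiff_fst).prodMk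
      (contDiff_snd.mul (contDiff_snd.comp contDiff_fst))).contDiffOn
      fun q hq => ⟨hq.1.1, trivial⟩
  refine (contDiffOn_integral_Icc hs' hg2).congr fun q hq => ?_
  obtain ⟨p, t⟩ := q
  have hp : p ∈ s := hq.1
  simp only
  rcases eq_or_ne t 0 with rfl | ht
  · rw [dslope_same, (hd p hp 0).deriv]; simp
  · rw [dslope_of_ne _ ht, slope_def_module]
    have hcont : Continuous (fun τ : ℝ => fderiv ℝ h (p, τ) (0, 1)) := by
      have : ContinuousOn (fun τ : ℝ => fderiv ℝ h (p, τ) (0, 1)) Set.univ :=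
        hg.continuousOn.comp (Continuous.continuousOn (by fun_prop)) fun τ _ => ⟨hp, trivial⟩
      exact continuousOn_univ.1 this
    have h1 := intervalIntegral.integral_eq_sub_of_hasDerivAt
      (f := fun σ : ℝ => h (p, σ * t)) (f' := fun σ => t • fderiv ℝ h (p, σ * t) (0, 1))
      (a := 0) (b := 1) (fun σ _ => by
        have := (hd p hp (σ * t)).scomp σ ((hasDerivAt_id σ).mul_const t)
        simpa [Function.comp_def] using this)
      ((((hcont.comp (continuous_id.mul continuous_const)).const_smul t)).intervalIntegrable _ _)
    rw [intervalIntegral.integral_smul, intervalIntegral.integral_of_le zero_le_one,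
      ← integral_Icc_eq_integral_Ioc] at h1
    simp only [one_mul, zero_mul] at h1
    rw [← h1, sub_zero, smul_smul, inv_mul_cancel₀ ht, one_smul]

end Hadamard

/-! ### Sections of a vector bundle in local coordinates -/

section Local

variable {n : ℕ} {M : Type*} [TopologicalSpace M] [ChartedSpace (EuclideanSpace ℝ (Fin n)) M]
  [IsManifold (𝓡 n) ∞ M]
  {F : Type*} [NormedAddCommGroup F] [NormedSpace ℝ F]
  {V : M → Type*} [TopologicalSpace (Bundle.TotalSpace F V)] [∀ x, AddCommGroup (V x)]
  [∀ x, Module ℝ (V x)] [∀ x, TopologicalSpace (V x)] [FiberBundle F V] [VectorBundle ℝ F V]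
  [ContMDiffVectorBundle ∞ F V (𝓡 n)]

variable (F V) in
/-- The part of the preferred chart at `x` over which the preferred trivialization is defined. -/
def localDomain (x : M) : Set (EuclideanSpace ℝ (Fin n)) :=
  (extChartAt (𝓡 n) x).target ∩
    (extChartAt (𝓡 n) x).symm ⁻¹' (trivializationAt F V x).baseSet

variable (F V) in
theorem isOpen_localDomain (x : M) : IsOpen (localDomain (n := n) F V x) :=
  (continuousOn_extChartAt_symm x).isOpen_inter_preimage (isOpen_extChartAt_target x)
    (trivializationAt F V x).open_baseSet

variable (F V) in
theorem mem_localDomain (x : M) : extChartAt (𝓡 n) x x ∈ localDomain (n := n) F V x :=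
  ⟨mem_extChartAt_target x, by
    simpa using mem_baseSet_trivializationAt F V x⟩

theorem mem_localDomain_of {x p : M} (hp : p ∈ (extChartAt (𝓡 n) x).source)
    (hp' : p ∈ (trivializationAt F V x).baseSet) :
    extChartAt (𝓡 n) x p ∈ localDomain (n := n) F V x :=
  ⟨(extChartAt (𝓡 n) x).map_source hp, by
    rw [Set.mem_preimage, (extChartAt (𝓡 n) x).left_inv hp]; exact hp'⟩

/-- The coordinate of the value `s p` in the preferred trivialization at `x`. -/
def triv (x : M) (s : ContMDiffSection (𝓡 n) F ∞ V) (p : M) : F :=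
  (trivializationAt F V x ⟨p, s p⟩).2

theorem localRep_eq_triv (x : M) (s : ContMDiffSection (𝓡 n) F ∞ V)
    (y : EuclideanSpace ℝ (Fin n)) : localRep x s y = triv x s ((extChartAt (𝓡 n) x).symm y) := rfl

theorem triv_eq_localRep {x p : M} (hp : p ∈ (extChartAt (𝓡 n) x).source)
    (s : ContMDiffSection (𝓡 n) F ∞ V) : triv x s p = localRep x s (extChartAt (𝓡 n) x p) := by
  rw [localRep_eq_triv, (extChartAt (𝓡 n) x).left_inv hp]

theorem triv_add {x p : M} (hp : p ∈ (trivializationAt F V x).baseSet)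
    (s s' : ContMDiffSection (𝓡 n) F ∞ V) : triv x (s + s') p = triv x s p + triv x s' p :=
  ((trivializationAt F V x).linear ℝ hp).map_add _ _

theorem triv_smul {x p : M} (hp : p ∈ (trivializationAt F V x).baseSet) (r : ℝ)
    (s : ContMDiffSection (𝓡 n) F ∞ V) : triv x (r • s) p = r • triv x s p :=
  ((trivializationAt F V x).linear ℝ hp).map_smul _ _

theorem triv_sub {x p : M} (hp : p ∈ (trivializationAt F V x).baseSet)
    (s s' : ContMDiffSection (𝓡 n) F ∞ V) : triv x (s - s') p = triv x s p - triv x s' p :=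
  ((trivializationAt F V x).linear ℝ hp).map_sub _ _

theorem triv_zero {x p : M} (hp : p ∈ (trivializationAt F V x).baseSet) :
    triv x (0 : ContMDiffSection (𝓡 n) F ∞ V) p = 0 :=
  ((trivializationAt F V x).linear ℝ hp).map_zero

theorem triv_inj {x p : M} (hp : p ∈ (trivializationAt F V x).baseSet)
    {s s' : ContMDiffSection (𝓡 n) F ∞ V} (h : triv x s p = triv x s' p) : s p = s' p := by
  have h1 := (trivializationAt F V x).symm_apply_apply_mk hp (s p)
  have h2 := (trivializationAt F V x).symm_apply_apply_mk hp (s' p)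
  rw [← h1, ← h2]
  exact congrArg _ h

theorem triv_congr {x p : M} {s s' : ContMDiffSection (𝓡 n) F ∞ V} (h : s p = s' p) :
    triv x s p = triv x s' p := by
  simp only [triv, h]

theorem localRep_add {x : M} {y : EuclideanSpace ℝ (Fin n)} (hy : y ∈ localDomain F V x)
    (s s' : ContMDiffSection (𝓡 n) F ∞ V) :
    localRep x (s + s') y = localRep x s y + localRep x s' y := triv_add hy.2 s s'

theorem localRep_smul {x : M} {y : EuclideanSpace ℝ (Fin n)} (hy : y ∈ localDomain F V x) (r : ℝ)
    (s : ContMDiffSection (𝓡 n) F ∞ V) : localRep x (r • s) y = r • localRep x s y :=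
  triv_smul hy.2 r s

theorem localRep_sub {x : M} {y : EuclideanSpace ℝ (Fin n)} (hy : y ∈ localDomain F V x)
    (s s' : ContMDiffSection (𝓡 n) F ∞ V) :
    localRep x (s - s') y = localRep x s y - localRep x s' y := triv_sub hy.2 s s'

/-- A family of sections is smooth at `(a, p)` if its coordinates at `x` are, provided `p` lies in
the domain of the preferred chart and trivialization at `x`. -/
theorem contMDiffAt_family_iff {X : Type*} [NormedAddCommGroup X] [NormedSpace ℝ X]
    {c : X → (p : M) → V p} {x p : M} (hp : p ∈ (extChartAt (𝓡 n) x).source)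
    (hp' : p ∈ (trivializationAt F V x).baseSet) (a : X) :
    ContMDiffAt (𝓘(ℝ, X).prod (𝓡 n)) ((𝓡 n).prod 𝓘(ℝ, F)) ∞
      (fun q : X × M => (⟨q.2, c q.1 q.2⟩ : Bundle.TotalSpace F V)) (a, p) ↔
    ContDiffAt ℝ ∞ (fun q : X × EuclideanSpace ℝ (Fin n) =>
      (trivializationAt F V x ⟨(extChartAt (𝓡 n) x).symm q.2,
        c q.1 ((extChartAt (𝓡 n) x).symm q.2)⟩).2) (a, extChartAt (𝓡 n) x p) := by
  rw [(trivializationAt F V x).contMDiffAt_iff (by simpa [Bundle.Trivialization.mem_source] using hp')]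
  simp only [contMDiffAt_snd, true_and]
  have hsymm : ContMDiffAt 𝓘(ℝ, X × EuclideanSpace ℝ (Fin n)) (𝓘(ℝ, X).prod (𝓡 n)) ∞
      (fun q : X × EuclideanSpace ℝ (Fin n) => (q.1, (extChartAt (𝓡 n) x).symm q.2))
      (a, extChartAt (𝓡 n) x p) := by
    refine ContMDiffAt.prodMk contDiff_fst.contMDiff.contMDiffAt ?_
    refine ContMDiffAt.comp (I' := 𝓡 n) (a, extChartAt (𝓡 n) x p)
      (g := (extChartAt (𝓡 n) x).symm) (f := fun q : X × EuclideanSpace ℝ (Fin n) => q.2) ?_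
      contDiff_snd.contMDiff.contMDiffAt
    exact (contMDiffOn_extChartAt_symm x).contMDiffAt
      ((isOpen_extChartAt_target x).mem_nhds ((extChartAt (𝓡 n) x).map_source hp))
  have hchart : ContMDiffAt (𝓘(ℝ, X).prod (𝓡 n)) 𝓘(ℝ, X × EuclideanSpace ℝ (Fin n)) ∞
      (fun q : X × M => (q.1, extChartAt (𝓡 n) x q.2)) (a, p) := by
    rw [modelWithCornersSelf_prod, ← chartedSpaceSelf_prod]
    exact contMDiffAt_fst.prodMk
      ((contMDiffAt_extChartAt' (by simpa using hp)).comp _ contMDiffAt_snd)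
  rw [← contMDiffAt_iff_contDiffAt]
  constructor
  · intro h
    refine ContMDiffAt.comp (I' := 𝓘(ℝ, X).prod (𝓡 n)) (a, extChartAt (𝓡 n) x p)
      (g := fun q : X × M => (trivializationAt F V x ⟨q.2, c q.1 q.2⟩).2)
      (f := fun q : X × EuclideanSpace ℝ (Fin n) => (q.1, (extChartAt (𝓡 n) x).symm q.2)) ?_ hsymm
    rw [(extChartAt (𝓡 n) x).left_inv hp]
    exact h
  · intro h
    have h1 := ContMDiffAt.comp (I' := 𝓘(ℝ, X × EuclideanSpace ℝ (Fin n))) (a, p)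
      (f := fun q : X × M => (q.1, extChartAt (𝓡 n) x q.2)) h hchart
    refine h1.congr_of_eventuallyEq ?_
    have : ∀ᶠ q : X × M in 𝓝 (a, p), q.2 ∈ (extChartAt (𝓡 n) x).source :=
      continuousAt_snd.eventually_mem ((isOpen_extChartAt_source x).mem_nhds hp)
    filter_upwards [this] with q hq
    simp only [Function.comp]
    rw [(extChartAt (𝓡 n) x).left_inv hq]

/-- Smooth families in local coordinates. -/
theorem smoothFamily_iff {N : ℕ} {c : EuclideanSpace ℝ (Fin N) → ContMDiffSection (𝓡 n) F ∞ V} :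
    SmoothFamily c ↔ ∀ x : M, ContDiffOn ℝ ∞
      (fun q : EuclideanSpace ℝ (Fin N) × EuclideanSpace ℝ (Fin n) => localRep x (c q.1) q.2)
      (Set.univ ×ˢ localDomain F V x) := by
  constructor
  · intro h x q hq
    have hy := hq.2
    have := (contMDiffAt_family_iff (c := fun a p => c a p) (x := x)
      ((extChartAt (𝓡 n) x).map_target hy.1) hy.2 q.1).1 (h _)
    rw [(extChartAt (𝓡 n) x).right_inv hy.1] at this
    exact this.contDiffWithinAt
  · intro h q
    refine (contMDiffAt_family_iff (c := fun a p => c a p) (x := q.2)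
      (mem_extChartAt_source q.2) (mem_baseSet_trivializationAt F V q.2) q.1).2 ?_
    exact (h q.2).contDiffAt
      ((isOpen_univ.prod (isOpen_localDomain F V q.2)).mem_nhds ⟨trivial, mem_localDomain F V q.2⟩)

theorem SmFam.contDiffOn {X : Type*} [NormedAddCommGroup X] [NormedSpace ℝ X]
    [FiniteDimensional ℝ X] {c : X → ContMDiffSection (𝓡 n) F ∞ V} (hc : SmFam c) (x : M) :
    ContDiffOn ℝ ∞ (fun q : X × EuclideanSpace ℝ (Fin n) => localRep x (c q.1) q.2)
      (Set.univ ×ˢ localDomain F V x) := by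
  let e : X ≃L[ℝ] EuclideanSpace ℝ (Fin (Module.finrank ℝ X)) := toEuclidean
  have h := smoothFamily_iff.1 (hc _ e.symm e.symm.contDiff) x
  have h2 := h.comp (f := fun q : X × EuclideanSpace ℝ (Fin n) => (e q.1, q.2))
    (s := Set.univ ×ˢ localDomain F V x)
    ((e.contDiff.comp contDiff_fst).prodMk contDiff_snd).contDiffOn fun q hq => ⟨trivial, hq.2⟩
  simpa [Function.comp_def] using h2

theorem contDiffOn_localRep (x : M) (s : ContMDiffSection (𝓡 n) F ∞ V) :
    ContDiffOn ℝ ∞ (localRep x s) (localDomain F V x) := by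
  intro y hy
  have h := (contMDiffAt_family_iff (X := ℝ) (F := F) (V := V) (c := fun _ p => s p) (x := x)
    ((extChartAt (𝓡 n) x).map_target hy.1) hy.2 0).1 ((s.contMDiff _).comp _ contMDiffAt_snd)
  rw [(extChartAt (𝓡 n) x).right_inv hy.1] at h
  exact (h.comp y (f := fun y => ((0 : ℝ), y))
    (contDiffAt_const.prodMk contDiffAt_id)).contDiffWithinAt

theorem contDiffAt_localRep {x : M} {y : EuclideanSpace ℝ (Fin n)} (hy : y ∈ localDomain F V x)
    (s : ContMDiffSection (𝓡 n) F ∞ V) : ContDiffAt ℝ ∞ (localRep x s) y :=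
  (contDiffOn_localRep x s).contDiffAt ((isOpen_localDomain F V x).mem_nhds hy)

/-- Two sections have the same `k`-jet at `x` if and only if the derivatives of their difference
vanish in local coordinates. -/
theorem jetEq_iff_derivZero {k : ℕ} {x : M} {s s' : ContMDiffSection (𝓡 n) F ∞ V} :
    JetEq k x s s' ↔
      DerivZero k (fun y => localRep x s y - localRep x s' y) (extChartAt (𝓡 n) x x) :=
  (derivZero_sub_iff (contDiffAt_localRep (mem_localDomain F V x) s)
    (contDiffAt_localRep (mem_localDomain F V x) s')).symm

theorem eventually_mem_localDomain {x : M} {y : EuclideanSpace ℝ (Fin n)}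
    (hy : y ∈ localDomain F V x) : ∀ᶠ z in 𝓝 y, z ∈ localDomain F V x :=
  (isOpen_localDomain F V x).mem_nhds hy

theorem jetEq_zero_iff_derivZero {k : ℕ} {x : M} {s : ContMDiffSection (𝓡 n) F ∞ V} :
    JetEq k x s 0 ↔ DerivZero k (localRep x s) (extChartAt (𝓡 n) x x) := by
  rw [jetEq_iff_derivZero]
  have h : (fun y => localRep x s y - localRep x (0 : ContMDiffSection (𝓡 n) F ∞ V) y)
      =ᶠ[𝓝 (extChartAt (𝓡 n) x x)] localRep x s := by
    filter_upwards [eventually_mem_localDomain (mem_localDomain F V x)] with y hy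
    rw [localRep_eq_triv x 0, triv_zero hy.2, sub_zero]
  exact ⟨fun h' => h'.congr h.symm, fun h' => h'.congr h⟩

/-- Having the same `0`-jet means having the same value. -/
theorem jetEq_zero_order_iff {x : M} {s s' : ContMDiffSection (𝓡 n) F ∞ V} :
    JetEq 0 x s s' ↔ s x = s' x := by
  rw [jetEq_iff_derivZero, derivZero_zero_iff, sub_eq_zero,
    ← triv_eq_localRep (mem_extChartAt_source x), ← triv_eq_localRep (mem_extChartAt_source x)]
  exact ⟨triv_inj (mem_baseSet_trivializationAt F V x), triv_congr⟩

/-- Change of coordinates: the jet at `p` is determined by the derivatives in the coordinates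
around a nearby point `x`. -/
theorem jetEq_of_localRep {k : ℕ} {x p : M} (hp : p ∈ (extChartAt (𝓡 n) x).source)
    (hp' : p ∈ (trivializationAt F V x).baseSet) {s s' : ContMDiffSection (𝓡 n) F ∞ V}
    (h : DerivZero k (fun y => localRep x s y - localRep x s' y) (extChartAt (𝓡 n) x p)) :
    JetEq k p s s' := by
  rw [jetEq_iff_derivZero]
  set φ := extChartAt (𝓡 n) x
  set ψ := extChartAt (𝓡 n) p
  have hpψ : p ∈ ψ.source := mem_extChartAt_source p
  have hpp : p ∈ (trivializationAt F V p).baseSet := mem_baseSet_trivializationAt F V p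
  have hsymm : ContMDiffAt (𝓡 n) (𝓡 n) ∞ ψ.symm (ψ p) :=
    (contMDiffOn_extChartAt_symm p).contMDiffAt
      ((isOpen_extChartAt_target p).mem_nhds (ψ.map_source hpψ))
  have hψp : ψ.symm (ψ p) = p := ψ.left_inv hpψ
  have hτ : ContDiffAt ℝ ∞ (fun z => φ (ψ.symm z)) (ψ p) := by
    rw [← contMDiffAt_iff_contDiffAt]
    refine ContMDiffAt.comp (I' := 𝓡 n) (ψ p) (g := φ) ?_ hsymm
    rw [hψp]
    exact contMDiffAt_extChartAt' (by simpa [φ] using hp)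
  have hC : ContDiffAt ℝ ∞ (fun z => ((trivializationAt F V x).coordChangeL ℝ
      (trivializationAt F V p) (ψ.symm z) : F →L[ℝ] F)) (ψ p) := by
    rw [← contMDiffAt_iff_contDiffAt]
    refine ContMDiffAt.comp (I' := 𝓡 n) (ψ p) (g := fun q =>
      ((trivializationAt F V x).coordChangeL ℝ (trivializationAt F V p) q : F →L[ℝ] F)) ?_ hsymm
    rw [hψp]
    exact contMDiffAt_coordChangeL hp' hpp
  have hloc : φ p ∈ localDomain F V x := mem_localDomain_of hp hp'
  have hd : ContDiffAt ℝ ∞ (fun y => localRep x s y - localRep x s' y) (φ (ψ.symm (ψ p))) := by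
    rw [hψp]
    exact (contDiffAt_localRep hloc s).sub (contDiffAt_localRep hloc s')
  have h1 : DerivZero k (fun z => localRep x s (φ (ψ.symm z)) - localRep x s' (φ (ψ.symm z)))
      (ψ p) := DerivZero.comp (f := fun z => φ (ψ.symm z)) hd hτ (by simpa only [hψp] using h)
  have h2 := DerivZero.bilin (ContinuousLinearMap.id ℝ (F →L[ℝ] F)) hC (hd.comp (ψ p) hτ) h1
  refine h2.congr ?_
  have hev : ∀ᶠ z in 𝓝 (ψ p), ψ.symm z ∈ φ.source ∧ ψ.symm z ∈ (trivializationAt F V x).baseSet ∧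
      ψ.symm z ∈ (trivializationAt F V p).baseSet := by
    have hc := hsymm.continuousAt
    rw [ContinuousAt, hψp] at hc
    exact (hc.eventually_mem ((isOpen_extChartAt_source x).mem_nhds hp)).and
      ((hc.eventually_mem ((trivializationAt F V x).open_baseSet.mem_nhds hp')).and
        (hc.eventually_mem ((trivializationAt F V p).open_baseSet.mem_nhds hpp)))
  filter_upwards [hev] with z hz
  have key : ∀ r : ContMDiffSection (𝓡 n) F ∞ V, localRep p r z =
      (trivializationAt F V x).coordChangeL ℝ (trivializationAt F V p) (ψ.symm z)
        (localRep x r (φ (ψ.symm z))) := by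
    intro r
    rw [← triv_eq_localRep hz.1, localRep_eq_triv,
      Bundle.Trivialization.coordChangeL_apply _ _ ⟨hz.2.1, hz.2.2⟩, triv, triv,
      Bundle.Trivialization.symm_apply_apply_mk _ hz.2.1]
  simp only [key, Function.comp, ContinuousLinearMap.id_apply, ContinuousLinearEquiv.coe_coe,
    map_sub]

end Local

/-! ### Spaces of sections of a vector bundle are jet models -/

section Model

variable {n : ℕ} {M : Type*} [TopologicalSpace M] [ChartedSpace (EuclideanSpace ℝ (Fin n)) M]
  [IsManifold (𝓡 n) ∞ M]
  {F : Type*} [NormedAddCommGroup F] [NormedSpace ℝ F] [FiniteDimensional ℝ F]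
  {V : M → Type*} [TopologicalSpace (Bundle.TotalSpace F V)] [∀ x, AddCommGroup (V x)]
  [∀ x, Module ℝ (V x)] [∀ x, TopologicalSpace (V x)] [FiberBundle F V] [VectorBundle ℝ F V]
  [ContMDiffVectorBundle ∞ F V (𝓡 n)]

theorem hasDerivAt_iff_forall_dual {f : ℝ → F} {v : F} {t : ℝ} :
    HasDerivAt f v t ↔ ∀ l : F →L[ℝ] ℝ, HasDerivAt (fun t => l (f t)) (l v) t := by
  refine ⟨fun h l => l.hasFDerivAt.comp_hasDerivAt t h, fun h => ?_⟩
  let e := (Module.finBasis ℝ F).equivFunL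
  have h1 : HasDerivAt (fun t => e (f t)) (e v) t :=
    hasDerivAt_pi.2 fun i => h ((ContinuousLinearMap.proj (R := ℝ) (φ := fun _ => ℝ) i).comp
    (e : F →L[ℝ] (Fin (Module.finrank ℝ F) → ℝ)))
  have h2 := (e.symm : _ →L[ℝ] F).hasFDerivAt.comp_hasDerivAt t h1
  simpa [Function.comp_def] using h2

theorem eq_iff_forall_dual {v w : F} : v = w ↔ ∀ l : F →L[ℝ] ℝ, l v = l w := by
  refine ⟨fun h l => h ▸ rfl, fun h => ?_⟩
  let e := (Module.finBasis ℝ F).equivFunL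
  refine e.injective (funext fun i => ?_)
  exact h ((ContinuousLinearMap.proj (R := ℝ) (φ := fun _ => ℝ) i).comp
    (e : F →L[ℝ] (Fin (Module.finrank ℝ F) → ℝ)))

theorem triv_self_add (x : M) (s s' : ContMDiffSection (𝓡 n) F ∞ V) :
    triv x (s + s') x = triv x s x + triv x s' x :=
  triv_add (mem_baseSet_trivializationAt F V x) s s'

theorem derivZero_const_zero {E G : Type*} [NormedAddCommGroup E] [NormedSpace ℝ E]
    [NormedAddCommGroup G] [NormedSpace ℝ G] (k : ℕ) (y : E) :
    DerivZero k (fun _ : E => (0 : G)) y := fun j _ => by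
  rw [iteratedFDeriv_fun_zero]; rfl

theorem localRep_eventually_eq {x : M} {s s' : ContMDiffSection (𝓡 n) F ∞ V}
    (h : ∀ᶠ p in 𝓝 x, s p = s' p) :
    localRep x s =ᶠ[𝓝 (extChartAt (𝓡 n) x x)] localRep x s' := by
  have hc := continuousAt_extChartAt_symm (I := 𝓡 n) x
  rw [ContinuousAt, extChartAt_to_inv] at hc
  filter_upwards [hc.eventually h] with y hy
  exact triv_congr hy

/-- The difference quotients of a smooth family of sections, with the derivative at `0`. -/
def quotFamily {N : ℕ} (c : EuclideanSpace ℝ (Fin N) × ℝ → ContMDiffSection (𝓡 n) F ∞ V)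
    (q : EuclideanSpace ℝ (Fin N) × ℝ) (p : M) : V p :=
  (trivializationAt F V p).symm p (dslope (fun τ => triv p (c (q.1, τ)) p) 0 q.2)

theorem differentiable_triv {c : ℝ → ContMDiffSection (𝓡 n) F ∞ V} (hc : SmFam c) {x p : M}
    (hp : p ∈ (extChartAt (𝓡 n) x).source) (hp' : p ∈ (trivializationAt F V x).baseSet) :
    Differentiable ℝ (fun τ => triv x (c τ) p) := by
  have h := (hc.contDiffOn x).comp (f := fun τ : ℝ => (τ, extChartAt (𝓡 n) x p)) (s := Set.univ)
    (contDiff_id.prodMk contDiff_const).contDiffOn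
    fun τ _ => ⟨trivial, mem_localDomain_of hp hp'⟩
  rw [contDiffOn_univ] at h
  simp only [triv_eq_localRep hp]
  exact h.differentiable (by simp)

theorem triv_quotFamily {N : ℕ}
    {c : EuclideanSpace ℝ (Fin N) × ℝ → ContMDiffSection (𝓡 n) F ∞ V} (hc : SmFam c)
    (q : EuclideanSpace ℝ (Fin N) × ℝ) {x p : M}
    (hp' : p ∈ (trivializationAt F V x).baseSet) :
    (trivializationAt F V x ⟨p, quotFamily c q p⟩).2 =
      dslope (fun τ => triv x (c (q.1, τ)) p) 0 q.2 := by
  have hpp := mem_baseSet_trivializationAt F V p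
  set T : F →L[ℝ] F := ContinuousLinearEquiv.toContinuousLinearMap
    ((trivializationAt F V p).coordChangeL ℝ (trivializationAt F V x) p)
  have hT : ∀ w, (trivializationAt F V x ⟨p, (trivializationAt F V p).symm p w⟩).2 = T w :=
    fun w => (Bundle.Trivialization.coordChangeL_apply _ _ ⟨hpp, hp'⟩ w).symm
  rw [quotFamily, hT, ← ContinuousLinearMap.dslope_comp]
  · congr 1
    funext τ
    rw [Function.comp, ← hT, triv, Bundle.Trivialization.symm_apply_apply_mk _ hpp, triv]
  · intro _
    exact differentiable_triv (hc.comp (contDiff_const.prodMk contDiff_id))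
      (mem_extChartAt_source p) hpp _

theorem contMDiff_quotFamily {N : ℕ}
    {c : EuclideanSpace ℝ (Fin N) × ℝ → ContMDiffSection (𝓡 n) F ∞ V} (hc : SmFam c) :
    ContMDiff (𝓘(ℝ, EuclideanSpace ℝ (Fin N) × ℝ).prod (𝓡 n)) ((𝓡 n).prod 𝓘(ℝ, F)) ∞
      (fun q : (EuclideanSpace ℝ (Fin N) × ℝ) × M =>
        (⟨q.2, quotFamily c q.1 q.2⟩ : Bundle.TotalSpace F V)) := by
  rintro ⟨⟨a, t⟩, p⟩
  refine (contMDiffAt_family_iff (c := quotFamily c) (x := p) (mem_extChartAt_source p)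
    (mem_baseSet_trivializationAt F V p) (a, t)).2 ?_
  set O := localDomain (n := n) F V p
  have hO : IsOpen O := isOpen_localDomain F V p
  have h1 : ContDiffOn ℝ ∞ (fun q : (EuclideanSpace ℝ (Fin N) × EuclideanSpace ℝ (Fin n)) × ℝ =>
      localRep p (c (q.1.1, q.2)) q.1.2) ((Set.univ ×ˢ O) ×ˢ Set.univ) :=
    (hc.contDiffOn p).comp (f := fun q : (EuclideanSpace ℝ (Fin N) × EuclideanSpace ℝ (Fin n)) × ℝ =>
      ((q.1.1, q.2), q.1.2)) (by fun_prop) fun q hq => ⟨trivial, hq.1.2⟩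
  have h2 := contDiffOn_dslope (isOpen_univ.prod hO) h1
  have h3 : ContDiffOn ℝ ∞ (fun q : (EuclideanSpace ℝ (Fin N) × ℝ) × EuclideanSpace ℝ (Fin n) =>
      dslope (fun τ => localRep p (c (q.1.1, τ)) q.2) 0 q.1.2) (Set.univ ×ˢ O) :=
    h2.comp (f := fun q : (EuclideanSpace ℝ (Fin N) × ℝ) × EuclideanSpace ℝ (Fin n) =>
      ((q.1.1, q.2), q.1.2)) (by fun_prop) fun q hq => ⟨⟨trivial, hq.2⟩, trivial⟩
  have hO' : IsOpen ((Set.univ : Set (EuclideanSpace ℝ (Fin N) × ℝ)) ×ˢ O) := isOpen_univ.prod hO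
  have hmem : ((a, t), extChartAt (𝓡 n) p p) ∈
      (Set.univ : Set (EuclideanSpace ℝ (Fin N) × ℝ)) ×ˢ O := ⟨trivial, mem_localDomain F V p⟩
  refine (h3.contDiffAt (hO'.mem_nhds hmem)).congr_of_eventuallyEq ?_
  filter_upwards [hO'.mem_nhds hmem] with q hq
  exact triv_quotFamily hc q.1 hq.2.2

instance instJetModelSection : JetModel (ContMDiffSection (𝓡 n) F ∞ V) where
  evalAt x := {l | ∃ lam : F →L[ℝ] ℝ, ∀ s, l s = lam (triv x s x)}
  jetEq_iff_sub {k x s s'} := by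
    rw [jetEq_zero_iff_derivZero, jetEq_iff_derivZero]
    have h : localRep x (s - s') =ᶠ[𝓝 (extChartAt (𝓡 n) x x)]
        fun y => localRep x s y - localRep x s' y := by
      filter_upwards [eventually_mem_localDomain (mem_localDomain F V x)] with y hy
      exact localRep_sub hy s s'
    exact ⟨fun h' => h'.congr h, fun h' => h'.congr h.symm⟩
  jet_zero k x := fun _ _ => rfl
  jet_add {k x s s'} h h' := by
    rw [jetEq_zero_iff_derivZero] at h h' ⊢
    refine (DerivZero.add (contDiffAt_localRep (mem_localDomain F V x) s)
      (contDiffAt_localRep (mem_localDomain F V x) s') h h').congr ?_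
    filter_upwards [eventually_mem_localDomain (mem_localDomain F V x)] with y hy
    exact localRep_add hy s s'
  jet_smul {k x s} r h := by
    rw [jetEq_zero_iff_derivZero] at h ⊢
    refine (DerivZero.bilin (ContinuousLinearMap.lsmul ℝ ℝ) (f := fun _ => r) contDiffAt_const
      (contDiffAt_localRep (mem_localDomain F V x) s) h).congr ?_
    filter_upwards [eventually_mem_localDomain (mem_localDomain F V x)] with y hy
    exact localRep_smul hy r s
  jet_mono h h' := fun j hj => h' j (hj.trans h)
  jet_germ {k x s s'} h := by
    rw [jetEq_iff_derivZero]
    refine (derivZero_const_zero k _).congr ?_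
    filter_upwards [localRep_eventually_eq (h.mono fun p hp => jetEq_zero_order_iff.1 hp)] with y hy
    rw [hy, sub_self]
  jet_zero_iff {x s s'} := by
    rw [jetEq_zero_order_iff]
    constructor
    · rintro h l ⟨lam, hl⟩
      rw [hl, hl, triv_congr h]
    · intro h
      refine triv_inj (mem_baseSet_trivializationAt F V x) (eq_iff_forall_dual.2 fun lam => ?_)
      exact h
        { toFun := fun s => lam (triv x s x)
          map_add' := fun s s' => by rw [triv_self_add, map_add]
          map_smul' := fun r s => by
            rw [triv_smul (mem_baseSet_trivializationAt F V x), map_smul]; rfl } ⟨lam, fun _ => rfl⟩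
  ext_jet h := ContMDiffSection.ext fun x => jetEq_zero_order_iff.1 (h x)
  fam_comp h hg := h.comp ((hg.contMDiff.comp contMDiff_fst).prodMk contMDiff_snd)
  fam_const N s := s.contMDiff.comp contMDiff_snd
  fam_add {N c c'} h h' := by
    rw [smoothFamily_iff] at h h' ⊢
    exact fun x => ((h x).add (h' x)).congr fun q hq => localRep_add hq.2 _ _
  fam_smul {N f c} hf h := by
    rw [smoothFamily_iff] at h ⊢
    exact fun x => ((hf.comp contDiff_fst).contDiffOn.smul (h x)).congr
      fun q hq => localRep_smul hq.2 _ _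
  fam_eval {N c x l} h hl := by
    obtain ⟨lam, hl⟩ := hl
    have h1 := (smoothFamily_iff.1 h x).comp
      (f := fun a : EuclideanSpace ℝ (Fin N) => (a, extChartAt (𝓡 n) x x)) (s := Set.univ)
      (contDiff_id.prodMk contDiff_const).contDiffOn fun a _ => ⟨trivial, mem_localDomain F V x⟩
    rw [contDiffOn_univ] at h1
    simp only [hl, triv_eq_localRep (mem_extChartAt_source x)]
    exact lam.contDiff.comp h1
  hasVelocity_iff {c v} := by
    constructor
    · rintro h x l ⟨lam, hl⟩
      simp only [hl]
      exact hasDerivAt_iff_forall_dual.1 (h x) lam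
    · intro h x
      refine hasDerivAt_iff_forall_dual.2 fun lam => ?_
      exact h x
        { toFun := fun s => lam (triv x s x)
          map_add' := fun s s' => by rw [triv_self_add, map_add]
          map_smul' := fun r s => by
            rw [triv_smul (mem_baseSet_trivializationAt F V x), map_smul]; rfl } ⟨lam, fun _ => rfl⟩
  hadamard {N} c hc := by
    have hsm := contMDiff_quotFamily hc
    refine ⟨fun q => ⟨quotFamily c q, hsm.comp (contMDiff_const.prodMk contMDiff_id)⟩,
      fun N' g hg => hsm.comp ((hg.contMDiff.comp contMDiff_fst).prodMk contMDiff_snd),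
      fun a t => ContMDiffSection.ext fun p => ?_⟩
    have hpp := mem_baseSet_trivializationAt F V p
    refine triv_inj hpp ?_
    rw [triv_add hpp, triv_smul hpp]
    have h1 := triv_quotFamily hc (a, t) hpp
    have h2 := sub_smul_dslope (fun τ => triv p (c (a, τ)) p) 0 t
    rw [sub_zero] at h2
    rw [show triv p ⟨quotFamily c (a, t), _⟩ p = _ from h1, h2, add_sub_cancel]

end Model

/-! ### Jet frames and sections with prescribed coordinates -/

section SmoothMaps

variable (E F : Type*) [NormedAddCommGroup E] [NormedSpace ℝ E] [NormedAddCommGroup F]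
  [NormedSpace ℝ F]

/-- The vector space of smooth maps. -/
def smoothMaps : Submodule ℝ (E → F) where
  carrier := {f | ContDiff ℝ ∞ f}
  add_mem' {f g} (hf : ContDiff ℝ ∞ f) (hg : ContDiff ℝ ∞ g) := hf.add hg
  zero_mem' := (contDiff_const : ContDiff ℝ ∞ (fun _ : E => (0 : F)))
  smul_mem' r f (hf : ContDiff ℝ ∞ f) := hf.const_smul r

/-- The space of values of `k`-jets of maps, without the symmetry condition. -/
abbrev JetSpace (k : ℕ) : Type _ := (i : Fin (k + 1)) → E [×i]→L[ℝ] F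

instance [FiniteDimensional ℝ E] [FiniteDimensional ℝ F] (i : ℕ) :
    FiniteDimensional ℝ (E [×i]→L[ℝ] F) :=
  Module.Finite.of_injective
    (ContinuousMultilinearMap.toMultilinearMapLinear :
      (E [×i]→L[ℝ] F) →ₗ[ℝ] MultilinearMap ℝ (fun _ : Fin i => E) F)
    ContinuousMultilinearMap.toMultilinearMap_injective

variable {E F}

theorem contDiff_smoothMaps (f : smoothMaps E F) : ContDiff ℝ ∞ (f : E → F) := f.2

theorem natCast_le_infty (j : ℕ) : (j : WithTop ℕ∞) ≤ ∞ := by exact_mod_cast le_top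

/-- The `k`-jet at `y`. -/
def jet (k : ℕ) (f : E → F) (y : E) : JetSpace E F k := fun i => iteratedFDeriv ℝ i f y

/-- The `k`-jet at `y` as a linear map. -/
def jetL (k : ℕ) (y : E) : smoothMaps E F →ₗ[ℝ] JetSpace E F k where
  toFun f := jet k (f : E → F) y
  map_add' f g := funext fun _ =>
    iteratedFDeriv_add_apply ((contDiff_smoothMaps f).contDiffAt.of_le (natCast_le_infty _))
      ((contDiff_smoothMaps g).contDiffAt.of_le (natCast_le_infty _))
  map_smul' _ f := funext fun _ =>
    iteratedFDeriv_const_smul_apply ((contDiff_smoothMaps f).contDiffAt.of_le (natCast_le_infty _))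

theorem contDiff_jet (k : ℕ) (f : smoothMaps E F) : ContDiff ℝ ∞ (jet k (f : E → F)) :=
  contDiff_pi.2 fun i => (contDiff_smoothMaps f).iteratedFDeriv_right (m := ∞) (by rfl)

/-- Translating the maps shows that the jets at different points fill the same space. -/
theorem jet_mem_range (k : ℕ) (y₀ y : E) (f : smoothMaps E F) :
    jetL k y f ∈ LinearMap.range (jetL (E := E) (F := F) k y₀) := by
  refine ⟨⟨fun z => (f : E → F) (z + (y - y₀)),
    (contDiff_smoothMaps f).comp (contDiff_id.add contDiff_const)⟩,
    funext fun i => ?_⟩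
  change iteratedFDeriv ℝ i (fun z => (f : E → F) (z + (y - y₀))) y₀ = _
  rw [iteratedFDeriv_comp_add_right, add_sub_cancel]; rfl

theorem exists_quasiInverse {K X Y : Type*} [Field K] [AddCommGroup X] [Module K X]
    [AddCommGroup Y] [Module K Y] (J : X →ₗ[K] Y) :
    ∃ σ : Y →ₗ[K] X, ∀ w ∈ LinearMap.range J, J (σ w) = w := by
  obtain ⟨r, hr⟩ := J.rangeRestrict.exists_rightInverse_of_surjective J.range_rangeRestrict
  obtain ⟨σ, hσ⟩ := LinearMap.exists_extend r
  refine ⟨σ, fun w hw => ?_⟩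
  have h1 : σ w = r ⟨w, hw⟩ := LinearMap.congr_fun hσ ⟨w, hw⟩
  rw [h1]
  exact congrArg Subtype.val (LinearMap.congr_fun hr ⟨w, hw⟩)

/-- Near `y₀` the jets of maps are, with smooth coefficients, combinations of the jets of finitely
many fixed maps. -/
theorem exists_jet_frame [FiniteDimensional ℝ E] [FiniteDimensional ℝ F] (k : ℕ) (y₀ : E) :
    ∃ (σ : JetSpace E F k →ₗ[ℝ] smoothMaps E F) (Λ : E → JetSpace E F k →L[ℝ] JetSpace E F k),
      ContDiffAt ℝ ∞ Λ y₀ ∧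
      ∀ᶠ y in 𝓝 y₀, ∀ f : smoothMaps E F, jet k (σ (Λ y (jet k f y)) : E → F) y = jet k f y := by
  obtain ⟨σ, hσ⟩ := exists_quasiInverse (jetL (E := E) (F := F) k y₀)
  have hfd : FiniteDimensional ℝ (JetSpace E F k) := inferInstance
  have hcs : CompleteSpace (JetSpace E F k) := FiniteDimensional.complete ℝ _
  let P : JetSpace E F k →L[ℝ] JetSpace E F k :=
    LinearMap.toContinuousLinearMap ((jetL k y₀) ∘ₗ σ)
  let T : E → JetSpace E F k →L[ℝ] JetSpace E F k := fun y =>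
    LinearMap.toContinuousLinearMap ((jetL k y) ∘ₗ σ) + (1 - P)
  have hP : ∀ w ∈ LinearMap.range (jetL (E := E) (F := F) k y₀), P w = w := hσ
  have hPr : ∀ w, P w ∈ LinearMap.range (jetL (E := E) (F := F) k y₀) := fun w => ⟨σ w, rfl⟩
  have hT : ContDiff ℝ ∞ T := by
    refine ContDiff.add ?_ contDiff_const
    exact contDiff_clm_apply_iff.2 fun w => contDiff_jet k (σ w)
  have hT0 : T y₀ = 1 := by
    change P + (1 - P) = 1
    abel
  have hinv : ContDiffAt ℝ ∞ (fun y => Ring.inverse (T y)) y₀ := by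
    have h1 := contDiffAt_ringInverse (n := ∞) (R := JetSpace E F k →L[ℝ] JetSpace E F k) ℝ 1
    rw [Units.val_one, ← hT0] at h1
    exact h1.comp y₀ hT.contDiffAt
  have hunit : ∀ᶠ y in 𝓝 y₀, IsUnit (T y) := by
    have h2 := Units.isOpen (R := JetSpace E F k →L[ℝ] JetSpace E F k)
    exact hT.continuous.continuousAt.eventually (h2.mem_nhds (by rw [hT0]; exact isUnit_one))
  refine ⟨σ, fun y => Ring.inverse (T y), hinv, ?_⟩
  filter_upwards [hunit] with y hy f
  set w := Ring.inverse (T y) (jet k (f : E → F) y) with hw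
  have h3 : T y w = jet k (f : E → F) y := by
    rw [hw, ← mul_apply_eq_comp, Ring.mul_inverse_cancel _ hy]; rfl
  have h4 : jetL k y (σ w) + (w - P w) = jetL k y f := h3
  have h5 : w - P w ∈ LinearMap.range (jetL (E := E) (F := F) k y₀) := by
    rw [← eq_sub_iff_add_eq'] at h4
    rw [h4]
    exact Submodule.sub_mem _ (jet_mem_range k y₀ y f) (jet_mem_range k y₀ y _)
  have h6 : w - P w = 0 := by
    rw [← hP _ h5, map_sub, hP _ (hPr w), sub_self]
  rw [h6, add_zero] at h4
  exact h4

/-- A smooth map vanishing to order `N` is `O(‖y - y₀‖ ^ N)`. -/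
theorem DerivZero.exists_norm_le {E : Type} [NormedAddCommGroup E] [NormedSpace ℝ E] (N : ℕ) :
    ∀ {F : Type} [NormedAddCommGroup F] [NormedSpace ℝ F] {f : E → F} {y₀ : E},
      ContDiffAt ℝ ∞ f y₀ → DerivZero N f y₀ →
      ∃ C : ℝ, ∀ᶠ y in 𝓝 y₀, ‖f y‖ ≤ C * ‖y - y₀‖ ^ N := by
  induction N with
  | zero =>
    intro F _ _ f y₀ hf h
    refine ⟨1, ?_⟩
    have h1 : ∀ᶠ y in 𝓝 y₀, ‖f y‖ < 1 :=
      hf.continuousAt.norm.eventually (gt_mem_nhds (by simp [h.apply]))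
    filter_upwards [h1] with y hy
    simpa using hy.le
  | succ N ih =>
    intro F _ _ f y₀ hf h
    obtain ⟨C, hC⟩ := ih (hf.fderiv_right (m := ∞) (by rfl)) h.fderiv
    obtain ⟨u, hu, hyu, hfu⟩ := exists_open_contDiffOn hf 1
    obtain ⟨r, hr, hball⟩ := Metric.eventually_nhds_iff_ball.1 (hC.and (hu.mem_nhds hyu))
    refine ⟨|C|, Metric.eventually_nhds_iff_ball.2 ⟨r, hr, fun y hy => ?_⟩⟩
    have h2 : ∀ z ∈ Metric.closedBall y₀ ‖y - y₀‖, z ∈ Metric.ball y₀ r := fun z hz => by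
      rw [Metric.mem_closedBall, dist_eq_norm] at hz
      rw [Metric.mem_ball, dist_eq_norm] at hy ⊢
      exact hz.trans_lt hy
    have h3 := (convex_closedBall y₀ ‖y - y₀‖).norm_image_sub_le_of_norm_fderiv_le (𝕜 := ℝ)
      (f := f) (C := |C| * ‖y - y₀‖ ^ N) (x := y₀) (y := y)
      (fun z hz => (hfu.differentiableOn (by simp)).differentiableAt
        (hu.mem_nhds (hball z (h2 z hz)).2))
      (fun z hz => ((hball z (h2 z hz)).1.trans (by
        rw [Metric.mem_closedBall, dist_eq_norm] at hz
        gcongr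
        exact le_abs_self C)))
      (Metric.mem_closedBall_self (norm_nonneg _)) (by rw [Metric.mem_closedBall, dist_eq_norm])
    rw [h.apply, sub_zero] at h3
    rw [pow_succ, ← mul_assoc]
    exact h3

end SmoothMaps

section Sections

variable {n : ℕ} {M : Type*} [TopologicalSpace M] [T2Space M]
  [ChartedSpace (EuclideanSpace ℝ (Fin n)) M] [IsManifold (𝓡 n) ∞ M]
  {F : Type*} [NormedAddCommGroup F] [NormedSpace ℝ F] [FiniteDimensional ℝ F]
  {V : M → Type*} [TopologicalSpace (Bundle.TotalSpace F V)] [∀ x, AddCommGroup (V x)]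
  [∀ x, Module ℝ (V x)] [∀ x, TopologicalSpace (V x)] [FiberBundle F V] [VectorBundle ℝ F V]
  [ContMDiffVectorBundle ∞ F V (𝓡 n)]

variable (n F V) in
theorem exists_cutoff (x : M) : ∃ κ : ContDiffBump (extChartAt (𝓡 n) x x),
    Metric.closedBall (extChartAt (𝓡 n) x x) κ.rOut ⊆ localDomain (n := n) F V x := by
  obtain ⟨r, hr, h⟩ := Metric.nhds_basis_closedBall.mem_iff.1
    ((isOpen_localDomain (n := n) F V x).mem_nhds (mem_localDomain F V x))
  exact ⟨⟨r / 2, r, by positivity, by linarith⟩, h⟩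

variable (n F V) in
/-- A cutoff function in the coordinates at `x`, equal to `1` near `x` and supported in the domain
of the coordinates. -/
def cutoff (x : M) : ContDiffBump (extChartAt (𝓡 n) x x) := (exists_cutoff n F V x).choose

variable (n F V) in
theorem closedBall_cutoff (x : M) :
    Metric.closedBall (extChartAt (𝓡 n) x x) (cutoff n F V x).rOut ⊆ localDomain (n := n) F V x :=
  (exists_cutoff n F V x).choose_spec

variable (n F V) in
/-- The compact set in `M` that contains the supports of the sections `secOf x f`. -/
def cutoffSupport (x : M) : Set M :=
  (extChartAt (𝓡 n) x).symm '' Metric.closedBall (extChartAt (𝓡 n) x x) (cutoff n F V x).rOut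

variable (n F V) in
theorem isCompact_cutoffSupport (x : M) : IsCompact (cutoffSupport n F V x) :=
  (isCompact_closedBall _ _).image_of_continuousOn
    ((continuousOn_extChartAt_symm x).mono fun _ hy => (closedBall_cutoff n F V x hy).1)

variable (n F V) in
theorem cutoffSupport_subset (x : M) :
    cutoffSupport n F V x ⊆ (extChartAt (𝓡 n) x).source := by
  rintro _ ⟨y, hy, rfl⟩
  exact (extChartAt (𝓡 n) x).map_target (closedBall_cutoff n F V x hy).1

open Classical in
/-- The values of the section with the given coordinates, cut off outside a neighbourhood. -/
def secVal (x : M) (f : EuclideanSpace ℝ (Fin n) → F) (p : M) : V p :=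
  if p ∈ (extChartAt (𝓡 n) x).source then
    (trivializationAt F V x).symmL ℝ p
      (cutoff n F V x (extChartAt (𝓡 n) x p) • f (extChartAt (𝓡 n) x p))
  else 0

theorem triv_secVal {x p : M} (f : EuclideanSpace ℝ (Fin n) → F)
    (hp : p ∈ (extChartAt (𝓡 n) x).source) (hp' : p ∈ (trivializationAt F V x).baseSet) :
    (trivializationAt F V x ⟨p, secVal x f p⟩).2 =
      cutoff n F V x (extChartAt (𝓡 n) x p) • f (extChartAt (𝓡 n) x p) := by
  rw [secVal, if_pos hp, Bundle.Trivialization.symmL_apply _ hp',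
    Bundle.Trivialization.apply_mk_symm _ hp']

theorem secVal_eq_zero {x p : M} (f : EuclideanSpace ℝ (Fin n) → F)
    (hp : p ∉ cutoffSupport n F V x) : secVal (V := V) x f p = 0 := by
  by_cases h : p ∈ (extChartAt (𝓡 n) x).source
  · have h1 : cutoff n F V x (extChartAt (𝓡 n) x p) = 0 := by
      refine (cutoff n F V x).zero_of_le_dist (not_lt.1 fun h2 => hp ⟨_, h2.le, ?_⟩)
      exact (extChartAt (𝓡 n) x).left_inv h
    rw [secVal, if_pos h, h1, zero_smul, map_zero]
  · rw [secVal, if_neg h]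

theorem contMDiff_secVal (x : M) (f : smoothMaps (EuclideanSpace ℝ (Fin n)) F) :
    ContMDiff (𝓡 n) ((𝓡 n).prod 𝓘(ℝ, F)) ∞
      (fun p => (⟨p, secVal x (f : EuclideanSpace ℝ (Fin n) → F) p⟩ : Bundle.TotalSpace F V)) := by
  intro p
  by_cases hp : p ∈ cutoffSupport n F V x
  · obtain ⟨y, hy, rfl⟩ := hp
    have hy' := closedBall_cutoff n F V x hy
    have h0 := (extChartAt (𝓡 n) x).map_target hy'.1
    have h1 := (contMDiffAt_family_iff (X := ℝ) (F := F) (V := V) (c := fun _ p => secVal x (f : EuclideanSpace ℝ (Fin n) → F) p)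
      (x := x) h0 hy'.2 0).2 ?_
    · exact h1.comp ((extChartAt (𝓡 n) x).symm y)
        (f := fun p : M => ((0 : ℝ), p)) (contMDiffAt_const.prodMk contMDiffAt_id)
    · rw [(extChartAt (𝓡 n) x).right_inv hy'.1]
      have h2 : ContDiff ℝ ∞ (fun q : ℝ × EuclideanSpace ℝ (Fin n) =>
          cutoff n F V x q.2 • (f : EuclideanSpace ℝ (Fin n) → F) q.2) :=
        ((cutoff n F V x).contDiff.comp contDiff_snd).smul ((contDiff_smoothMaps f).comp contDiff_snd)
      refine h2.contDiffAt.congr_of_eventuallyEq ?_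
      filter_upwards [(isOpen_univ.prod (isOpen_localDomain F V x)).mem_nhds
        (show ((0 : ℝ), y) ∈ Set.univ ×ˢ localDomain F V x from ⟨trivial, hy'⟩)] with q hq
      have h3 := triv_secVal (V := V) f.1 ((extChartAt (𝓡 n) x).map_target hq.2.1) hq.2.2
      rw [(extChartAt (𝓡 n) x).right_inv hq.2.1] at h3
      exact h3
  · have h1 := (0 : ContMDiffSection (𝓡 n) F ∞ V).contMDiff p
    refine h1.congr_of_eventuallyEq ?_
    filter_upwards [(isCompact_cutoffSupport n F V x).isClosed.isOpen_compl.mem_nhds hp] with q hq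
    rw [secVal_eq_zero _ hq]; rfl

/-- The section whose coordinates at `x` are given near `x` by the smooth map `f`. -/
def secOf (x : M) : smoothMaps (EuclideanSpace ℝ (Fin n)) F →ₗ[ℝ] ContMDiffSection (𝓡 n) F ∞ V where
  toFun f := ⟨secVal (V := V) x (f : EuclideanSpace ℝ (Fin n) → F), contMDiff_secVal x f⟩
  map_add' f g := ContMDiffSection.ext fun p => by
    change secVal (V := V) x (f.1 + g.1) p = secVal x f.1 p + secVal x g.1 p
    simp only [secVal]
    split_ifs with h
    · rw [← map_add, ← smul_add]; rfl
    · simp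
  map_smul' r f := ContMDiffSection.ext fun p => by
    change secVal (V := V) x (r • f.1) p = r • secVal x f.1 p
    simp only [secVal]
    split_ifs with h
    · rw [← map_smul, smul_comm]; rfl
    · simp

theorem localRep_secOf {x : M} {y : EuclideanSpace ℝ (Fin n)} (hy : y ∈ localDomain F V x)
    (f : smoothMaps (EuclideanSpace ℝ (Fin n)) F) :
    localRep x (secOf (V := V) x f) y =
      cutoff n F V x y • (f : EuclideanSpace ℝ (Fin n) → F) y := by
  have h := triv_secVal (V := V) f.1 ((extChartAt (𝓡 n) x).map_target hy.1) hy.2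
  rw [(extChartAt (𝓡 n) x).right_inv hy.1] at h
  exact h

theorem secSupport_secOf (x : M) (f : smoothMaps (EuclideanSpace ℝ (Fin n)) F) :
    secSupport (secOf (V := V) x f) ⊆ cutoffSupport n F V x := by
  refine closure_minimal (fun p hp => ?_) (isCompact_cutoffSupport n F V x).isClosed
  by_contra h
  exact hp (jetEq_zero_order_iff.2 (secVal_eq_zero _ h))

theorem isCompact_secSupport_secOf (x : M) (f : smoothMaps (EuclideanSpace ℝ (Fin n)) F) :
    IsCompact (secSupport (secOf (V := V) x f)) :=
  (isCompact_cutoffSupport n F V x).of_isClosed_subset isClosed_closure (secSupport_secOf x f)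

end Sections

/-! ### Flat sections and linear differential operators in coordinates -/

section Flat

variable {E F : Type*} [NormedAddCommGroup E] [NormedSpace ℝ E] [NormedAddCommGroup F]
  [NormedSpace ℝ F]

theorem contDiffAt_jet (k : ℕ) {f : E → F} {y : E} (hf : ContDiffAt ℝ ∞ f y) :
    ContDiffAt ℝ ∞ (jet k f) y :=
  contDiffAt_pi.2 fun i => hf.iteratedFDeriv_right (m := ∞) (by rfl)

theorem jet_congr {k : ℕ} {f g : E → F} {y : E} (h : f =ᶠ[𝓝 y] g) : jet k f y = jet k g y :=
  funext fun i => (h.iteratedFDeriv ℝ i).eq_of_nhds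

theorem DerivZero.clm_apply {D W G : Type*} [NormedAddCommGroup D] [NormedSpace ℝ D]
    [NormedAddCommGroup W] [NormedSpace ℝ W] [NormedAddCommGroup G] [NormedSpace ℝ G]
    {f : D → W →L[ℝ] G} {g : D → W} {y : D} {k : ℕ} (hf : ContDiffAt ℝ ∞ f y)
    (hg : ContDiffAt ℝ ∞ g y) (h : DerivZero k g y) : DerivZero k (fun z => f z (g z)) y :=
  DerivZero.bilin (ContinuousLinearMap.id ℝ (W →L[ℝ] G)) hf hg h

theorem eventually_abs_clm_le {D W ι : Type*} [TopologicalSpace D] [Fintype ι]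
    [NormedAddCommGroup W] [NormedSpace ℝ W] {Λ : D → W →L[ℝ] W} {y₀ : D}
    (hΛ : ContinuousAt Λ y₀) (co : ι → W →L[ℝ] ℝ) :
    ∀ᶠ y in 𝓝 y₀, ∀ i w, |co i (Λ y w)| ≤ (∑ i, ‖co i‖) * (‖Λ y₀‖ + 1) * ‖w‖ := by
  have h1 : ∀ᶠ y in 𝓝 y₀, ‖Λ y‖ < ‖Λ y₀‖ + 1 :=
    hΛ.norm.eventually (gt_mem_nhds (lt_add_one _))
  filter_upwards [h1] with y hy i w
  rw [← Real.norm_eq_abs]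
  calc _ ≤ ‖co i‖ * (‖Λ y‖ * ‖w‖) :=
        ((co i).le_opNorm _).trans (by gcongr; exact (Λ y).le_opNorm _)
    _ ≤ (∑ i, ‖co i‖) * ((‖Λ y₀‖ + 1) * ‖w‖) := by
        gcongr
        exact Finset.single_le_sum (f := fun i => ‖co i‖) (fun i _ => norm_nonneg (co i))
          (Finset.mem_univ i)
    _ = _ := by ring

theorem derivZero_jet {f : E → F} {y : E} (hf : ContDiffAt ℝ ∞ f y) (h : ∀ K, DerivZero K f y)
    (k K : ℕ) : DerivZero K (jet k f) y := by
  have h1 : jet k f = fun z => ∑ i : Fin (k + 1),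
      (fun _ : E => ContinuousLinearMap.single ℝ (fun i : Fin (k + 1) => E [×i]→L[ℝ] F) i) z
        (iteratedFDeriv ℝ i f z) := by
    funext z
    simp only [ContinuousLinearMap.single_apply]
    exact (Finset.univ_sum_single (jet k f z)).symm
  have hs : ∀ i : Fin (k + 1), ContDiffAt ℝ ∞ (iteratedFDeriv ℝ i f) y := fun i =>
    hf.iteratedFDeriv_right (m := ∞) (by rfl)
  rw [h1]
  refine DerivZero.sum _ (fun i => ?_) fun i => ?_
  · exact ContDiffAt.clm_apply contDiffAt_const (hs i)
  · exact DerivZero.clm_apply contDiffAt_const (hs i) (derivZero_iteratedFDeriv h i K)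

end Flat

section Rep

variable {n : ℕ} {M : Type*} [TopologicalSpace M] [T2Space M]
  [ChartedSpace (EuclideanSpace ℝ (Fin n)) M] [IsManifold (𝓡 n) ∞ M]
  {F : Type*} [NormedAddCommGroup F] [NormedSpace ℝ F] [FiniteDimensional ℝ F]
  {V : M → Type*} [TopologicalSpace (Bundle.TotalSpace F V)] [∀ x, AddCommGroup (V x)]
  [∀ x, Module ℝ (V x)] [∀ x, TopologicalSpace (V x)] [FiberBundle F V] [VectorBundle ℝ F V]
  [ContMDiffVectorBundle ∞ F V (𝓡 n)]
  {F' : Type*} [NormedAddCommGroup F'] [NormedSpace ℝ F'] [FiniteDimensional ℝ F']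
  {V' : M → Type*} [TopologicalSpace (Bundle.TotalSpace F' V')] [∀ x, AddCommGroup (V' x)]
  [∀ x, Module ℝ (V' x)] [∀ x, TopologicalSpace (V' x)] [FiberBundle F' V'] [VectorBundle ℝ F' V']
  [ContMDiffVectorBundle ∞ F' V' (𝓡 n)]

/-- The coordinates of a section at a point of the domain, as a linear map. -/
def localRepL {x : M} {y : EuclideanSpace ℝ (Fin n)} (hy : y ∈ localDomain F V x) :
    ContMDiffSection (𝓡 n) F ∞ V →ₗ[ℝ] F where
  toFun s := localRep x s y
  map_add' := localRep_add hy
  map_smul' := localRep_smul hy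

variable (n F V) in
theorem eventually_cutoff_eq_one {x : M} {y : EuclideanSpace ℝ (Fin n)}
    (hy : y ∈ Metric.ball (extChartAt (𝓡 n) x x) (cutoff n F V x).rIn) :
    ∀ᶠ z in 𝓝 y, cutoff n F V x z = 1 ∧ z ∈ localDomain F V x := by
  filter_upwards [Metric.isOpen_ball.mem_nhds hy] with z hz
  refine ⟨(cutoff n F V x).one_of_mem_closedBall (Metric.ball_subset_closedBall hz), ?_⟩
  exact closedBall_cutoff n F V x (Metric.closedBall_subset_closedBall
    (cutoff n F V x).rIn_lt_rOut.le (Metric.ball_subset_closedBall hz))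

theorem localRep_secOf_eventually {x : M} {y : EuclideanSpace ℝ (Fin n)}
    (hy : y ∈ Metric.ball (extChartAt (𝓡 n) x x) (cutoff n F V x).rIn)
    (f : smoothMaps (EuclideanSpace ℝ (Fin n)) F) :
    localRep x (secOf (V := V) x f) =ᶠ[𝓝 y] (f : EuclideanSpace ℝ (Fin n) → F) := by
  filter_upwards [eventually_cutoff_eq_one n F V hy] with z hz
  rw [localRep_secOf hz.2, hz.1, one_smul]

theorem exists_smoothMaps_eq_localRep {x : M} (φ : ContMDiffSection (𝓡 n) F ∞ V) :
    ∃ f : smoothMaps (EuclideanSpace ℝ (Fin n)) F,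
      ∀ y ∈ Metric.ball (extChartAt (𝓡 n) x x) (cutoff n F V x).rIn,
        (f : EuclideanSpace ℝ (Fin n) → F) =ᶠ[𝓝 y] localRep x φ := by
  have hs : ContDiff ℝ ∞ (fun y => cutoff n F V x y • localRep x φ y) := by
    refine contDiff_iff_contDiffAt.2 fun y => ?_
    by_cases hy : y ∈ Metric.closedBall (extChartAt (𝓡 n) x x) (cutoff n F V x).rOut
    · exact (cutoff n F V x).contDiff.contDiffAt.smul
        (contDiffAt_localRep (closedBall_cutoff n F V x hy) φ)
    · refine (contDiffAt_const (c := (0 : F))).congr_of_eventuallyEq ?_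
      filter_upwards [Metric.isClosed_closedBall.isOpen_compl.mem_nhds hy] with z hz
      rw [(cutoff n F V x).zero_of_le_dist (not_le.1 fun h => hz h).le, zero_smul]
  refine ⟨⟨_, hs⟩, fun y hy => ?_⟩
  filter_upwards [eventually_cutoff_eq_one n F V hy] with z hz
  rw [hz.1, one_smul]

/-- In coordinates a linear differential operator is a combination, with coefficients depending on
the jets of the argument, of its values on finitely many sections. -/
theorem exists_linear_rep
    {S : ContMDiffSection (𝓡 n) F ∞ V → ContMDiffSection (𝓡 n) F' ∞ V'}
    (hl : IsLinearMap ℝ S) (hS : IsDiffOp S) (x : M) :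
    ∃ (k m : ℕ) (g : Fin m → ContMDiffSection (𝓡 n) F ∞ V)
      (c : Fin m → ContMDiffSection (𝓡 n) F ∞ V → EuclideanSpace ℝ (Fin n) → ℝ) (C : ℝ),
      (∀ᶠ y in 𝓝 (extChartAt (𝓡 n) x x), ∀ φ,
        localRep x (S φ) y = ∑ i, c i φ y • localRep x (S (g i)) y) ∧
      (∀ i φ, ContDiffAt ℝ ∞ (c i φ) (extChartAt (𝓡 n) x x)) ∧
      (∀ i φ, (∀ K, JetEq K x φ 0) → ∀ K, DerivZero K (c i φ) (extChartAt (𝓡 n) x x)) ∧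
      (∀ᶠ y in 𝓝 (extChartAt (𝓡 n) x x), ∀ i φ, |c i φ y| ≤ C * ‖jet k (localRep x φ) y‖) := by
  obtain ⟨k, hk⟩ := hS.1
  set y₀ := extChartAt (𝓡 n) x x with hy₀
  obtain ⟨σ, Λ, hΛ, hfr⟩ := exists_jet_frame (E := EuclideanSpace ℝ (Fin n)) (F := F) k y₀
  let W := JetSpace (EuclideanSpace ℝ (Fin n)) F k
  let b := Module.finBasis ℝ W
  let co : Fin (Module.finrank ℝ W) → W →L[ℝ] ℝ := fun i =>
    LinearMap.toContinuousLinearMap (b.coord i)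
  have hjet : ∀ φ : ContMDiffSection (𝓡 n) F ∞ V, ContDiffAt ℝ ∞ (jet k (localRep x φ)) y₀ :=
    fun φ => contDiffAt_jet k (contDiffAt_localRep (mem_localDomain F V x) φ)
  refine ⟨k, Module.finrank ℝ W, fun i => secOf x (σ (b i)),
    fun i φ y => co i (Λ y (jet k (localRep x φ) y)), (∑ i, ‖co i‖) * (‖Λ y₀‖ + 1),
    ?_, fun i φ => ?_, fun i φ h => ?_, ?_⟩
  · filter_upwards [hfr, Metric.ball_mem_nhds y₀ (cutoff n F V x).rIn_pos,
      (isOpen_localDomain F V x).mem_nhds (mem_localDomain F V x),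
      (isOpen_localDomain F' V' x).mem_nhds (mem_localDomain F' V' x)] with y h1 h2 h3 h4 φ
    obtain ⟨f, hf⟩ := exists_smoothMaps_eq_localRep (x := x) φ
    set w := Λ y (jet k (localRep x φ) y) with hw
    have hp := (extChartAt (𝓡 n) x).map_target h3.1
    have h5 : JetEq k ((extChartAt (𝓡 n) x).symm y) φ (secOf x (σ w)) := by
      refine jetEq_of_localRep hp h3.2 ?_
      rw [(extChartAt (𝓡 n) x).right_inv h3.1]
      refine (derivZero_sub_iff (contDiffAt_localRep h3 _) (contDiffAt_localRep h3 _)).2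
        fun j hj => ?_
      have h6 := h1 f
      rw [jet_congr (hf y h2), ← hw, ← jet_congr (localRep_secOf_eventually (V := V) h2 (σ w))] at h6
      exact (congrFun h6 ⟨j, Nat.lt_succ_of_le hj⟩).symm
    have h7 : localRep x (S φ) y = localRep x (S (secOf x (σ w))) y :=
      triv_congr (jetEq_zero_order_iff.1 (hk _ _ _ h5))
    let Lm : W →ₗ[ℝ] F' := (localRepL h4) ∘ₗ hl.mk' S ∘ₗ (secOf (V := V) x) ∘ₗ σ
    have h8 : Lm w = ∑ i, co i w • Lm (b i) := by
      conv_lhs => rw [← b.sum_repr w, map_sum]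
      simp only [map_smul]; rfl
    rw [h7]
    exact h8
  · exact (co i).contDiff.contDiffAt.comp y₀ (hΛ.clm_apply (hjet φ))
  · intro K
    have h1 : ∀ K, DerivZero K (localRep x φ) y₀ := fun K => jetEq_zero_iff_derivZero.1 (h K)
    have h2 := derivZero_jet (contDiffAt_localRep (mem_localDomain F V x) φ) h1 k K
    have h3 := DerivZero.clm_apply hΛ (hjet φ) h2
    exact DerivZero.clm_apply (f := fun _ => co i)
      contDiffAt_const (hΛ.clm_apply (hjet φ)) h3
  · filter_upwards [eventually_abs_clm_le hΛ.continuousAt co] with y hy i φ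
    exact hy i _

/-- A linear differential operator maps sections that are flat at `x` to sections that are flat at
`x`. This does not follow from the dependence on finitely many derivatives alone, which controls
only the value of the image: it needs the smoothness of the coefficients. -/
theorem flat_of_flat_section
    {S : ContMDiffSection (𝓡 n) F ∞ V → ContMDiffSection (𝓡 n) F' ∞ V'}
    (hl : IsLinearMap ℝ S) (hS : IsDiffOp S) {x : M} {φ : ContMDiffSection (𝓡 n) F ∞ V}
    (h : ∀ k, JetEq k x φ 0) (k : ℕ) : JetEq k x (S φ) 0 := by
  obtain ⟨-, m, g, c, -, h1, h2, h3, -⟩ := exists_linear_rep hl hS x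
  rw [jetEq_zero_iff_derivZero]
  have h4 : localRep x (S φ) =ᶠ[𝓝 (extChartAt (𝓡 n) x x)]
      fun y => ∑ i, c i φ y • localRep x (S (g i)) y := h1.mono fun y hy => hy φ
  have h5 : ∀ i, ContDiffAt ℝ ∞ (localRep x (S (g i))) (extChartAt (𝓡 n) x x) := fun i =>
    contDiffAt_localRep (mem_localDomain F' V' x) _
  refine DerivZero.congr (DerivZero.sum _ (fun i => (h2 i φ).smul (h5 i)) fun i => ?_) h4
  exact DerivZero.bilin (ContinuousLinearMap.lsmul ℝ ℝ).flip (h5 i) (h2 i φ) (h3 i φ h k)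

end Rep

/-- Linear differential operators from `X` to `Y` take sections that vanish at a point with all
their derivatives to such sections. -/
def PreservesFlat {M : Type*} (X Y : Type*) [SectionSpace M X] [SectionSpace M Y]
    [AddCommGroup X] [Module ℝ X] [AddCommGroup Y] [Module ℝ Y] : Prop :=
  ∀ S : X → Y, IsLinearMap ℝ S → IsDiffOp S → ∀ (x : M) (φ : X),
    (∀ k, JetEq k x φ 0) → ∀ k, JetEq k x (S φ) 0

section PreservesFlat

variable {M : Type*} [TopologicalSpace M] {X Y Z : Type*} [SectionSpace M X] [SectionSpace M Y]
  [SectionSpace M Z] [AddCommGroup X] [Module ℝ X] [AddCommGroup Y] [Module ℝ Y] [AddCommGroup Z]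
  [Module ℝ Z] [JetModel X] [JetModel Y] [JetModel Z]

theorem PreservesFlat.prod_left (hX : PreservesFlat X Z) (hY : PreservesFlat Y Z) :
    PreservesFlat (X × Y) Z := by
  intro S hl hS x φ h k
  have h1 : S φ = S (φ.1, 0) + S (0, φ.2) := by
    rw [← hl.map_add]; simp
  rw [h1]
  refine jet_add (hX (fun a => S (a, 0)) ⟨fun a b => ?_, fun r a => ?_⟩
    (hS.comp_jetMap (g := fun a => (a, 0)) (by fun_prop)) x φ.1 (fun k => (h k).1) k)
    (hY (fun a => S (0, a)) ⟨fun a b => ?_, fun r a => ?_⟩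
    (hS.comp_jetMap (g := fun a => (0, a)) (by fun_prop)) x φ.2 (fun k => (h k).2) k)
  · rw [← hl.map_add]; simp
  · rw [← hl.map_smul]; simp
  · rw [← hl.map_add]; simp
  · rw [← hl.map_smul]; simp

end PreservesFlat

open MeasureTheory

/-! ### The fundamental lemma of the calculus of variations -/

section Scaling

variable {E F : Type*} [NormedAddCommGroup E] [NormedSpace ℝ E] [FiniteDimensional ℝ E]
  [NormedAddCommGroup F] [NormedSpace ℝ F]

/-- A bump function at `0`, equal to `1` on the unit ball. -/
def unitBump (E : Type*) [NormedAddCommGroup E] [NormedSpace ℝ E] : ContDiffBump (0 : E) :=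
  ⟨1, 2, one_pos, one_lt_two⟩

/-- The bump function of size `ε` at `y₀` with value `v`. -/
def scaledBump (y₀ : E) (v : F) (ε : ℝ) (y : E) : F := unitBump E (ε⁻¹ • (y - y₀)) • v

theorem contDiff_scaledBump (y₀ : E) (v : F) (ε : ℝ) : ContDiff ℝ ∞ (scaledBump y₀ v ε) :=
  ((unitBump E).contDiff.comp (contDiff_const.smul (contDiff_id.sub contDiff_const))).smul
    contDiff_const

theorem norm_jet_scaledBump_le (k : ℕ) (y₀ : E) (v : F) : ∃ C, 0 ≤ C ∧ ∀ ε, 0 < ε → ε ≤ 1 →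
    ∀ y, ‖jet k (scaledBump y₀ v ε) y‖ ≤ C * ε⁻¹ ^ k := by
  have hs : ContDiff ℝ ∞ (fun z : E => unitBump E z • v) := (unitBump E).contDiff.smul contDiff_const
  have hc : HasCompactSupport (fun z : E => unitBump E z • v) :=
    (unitBump E).hasCompactSupport.smul_right
  have hb : ∀ i : Fin (k + 1), ∃ C, ∀ z, ‖iteratedFDeriv ℝ i (fun z : E => unitBump E z • v) z‖ ≤ C :=
    fun i => (hc.iteratedFDeriv i).exists_bound_of_continuous
      (hs.continuous_iteratedFDeriv (natCast_le_infty i))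
  choose C hC using hb
  have hC0 : ∀ i, 0 ≤ C i := fun i => (norm_nonneg _).trans (hC i 0)
  refine ⟨∑ i, C i, Finset.sum_nonneg fun i _ => hC0 i, fun ε hε hε1 y => ?_⟩
  have h1 : 1 ≤ ε⁻¹ := (one_le_inv₀ hε).2 hε1
  refine (pi_norm_le_iff_of_nonneg (by
    have := Finset.sum_nonneg fun i (_ : i ∈ Finset.univ) => hC0 i
    positivity)).2 fun i => ?_
  have h2 : jet k (scaledBump y₀ v ε) y i =
      ε⁻¹ ^ (i : ℕ) • iteratedFDeriv ℝ i (fun z : E => unitBump E z • v) (ε⁻¹ • (y - y₀)) := by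
    change iteratedFDeriv ℝ i (fun y => (fun z => unitBump E (ε⁻¹ • z) • v) (y - y₀)) y = _
    rw [iteratedFDeriv_comp_sub (f := fun z => unitBump E (ε⁻¹ • z) • v),
      iteratedFDeriv_comp_const_smul (f := fun z : E => unitBump E z • v) _
        (hs.of_le (natCast_le_infty i))]
  rw [h2, norm_smul, norm_pow, norm_inv, Real.norm_of_nonneg hε.le, mul_comm]
  have h3 : C i ≤ ∑ i, C i := Finset.single_le_sum (fun i _ => hC0 i) (Finset.mem_univ i)
  gcongr
  · exact (hC0 i).trans h3
  · exact (hC i _).trans h3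
  · exact Nat.lt_succ_iff.1 i.2

theorem scaledBump_eq_zero {y₀ : E} (v : F) {ε : ℝ} (hε : 0 < ε) {y : E}
    (hy : y ∉ Metric.closedBall y₀ (2 * ε)) : scaledBump y₀ v ε y = 0 := by
  rw [scaledBump, (unitBump E).zero_of_le_dist, zero_smul]
  rw [Metric.mem_closedBall, not_le, dist_eq_norm] at hy
  rw [dist_zero_right, norm_smul, norm_inv, Real.norm_of_nonneg hε.le, le_inv_mul_iff₀ hε, mul_comm]
  exact hy.le

theorem unitBump_eq_one {y₀ : E} {ε : ℝ} (hε : 0 < ε) {y : E}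
    (hy : y ∈ Metric.closedBall y₀ ε) : unitBump E (ε⁻¹ • (y - y₀)) = 1 := by
  refine (unitBump E).one_of_mem_closedBall ?_
  rw [Metric.mem_closedBall, dist_eq_norm] at hy
  rw [Metric.mem_closedBall, dist_zero_right, norm_smul, norm_inv, Real.norm_of_nonneg hε.le,
    inv_mul_le_iff₀ hε]
  change _ ≤ ε * 1
  rw [mul_one]; exact hy

end Scaling

section Fundamental

variable {n : ℕ} {M : Type*} [TopologicalSpace M] [T2Space M]
  [ChartedSpace (EuclideanSpace ℝ (Fin n)) M] [IsManifold (𝓡 n) ∞ M]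
  {F : Type*} [NormedAddCommGroup F] [NormedSpace ℝ F] [FiniteDimensional ℝ F]
  {V : M → Type*} [TopologicalSpace (Bundle.TotalSpace F V)] [∀ x, AddCommGroup (V x)]
  [∀ x, Module ℝ (V x)] [∀ x, TopologicalSpace (V x)] [FiberBundle F V] [VectorBundle ℝ F V]
  [ContMDiffVectorBundle ∞ F V (𝓡 n)]

variable (n M) in
/-- Smooth top-degree forms. -/
abbrev TopSection : Type _ := ContMDiffSection (𝓡 n) ℝ ∞ (TopForm n M)

theorem chartIntegral_achart (x : M) (ρ : TopSection n M) :
    chartIntegral (achart (EuclideanSpace ℝ (Fin n)) x) (fun p => ρ p) =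
      ∫ y in (extChartAt (𝓡 n) x).target, localRep x ρ y := by
  simp only [chartIntegral, mfld_simps]
  rfl

/-- The scaled bump section. -/
def bumpSec (x : M) (v : F) (ε : ℝ) : ContMDiffSection (𝓡 n) F ∞ V :=
  secOf x ⟨scaledBump (extChartAt (𝓡 n) x x) v ε, contDiff_scaledBump _ _ _⟩

/-- If a differential operator `K` of order zero with values in top-degree forms agrees under the
integral with an operator `D` whose values vanish at `x` with all their derivatives, then the
values of `K` vanish at `x`: on a bump function of size `ε` and dimension `n` the
integral of `K` is of order `εⁿ`, while that of `D` is `O(εⁿ⁺¹)`. -/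
theorem apply_eq_zero_of_chartIntegral_eq {K D : ContMDiffSection (𝓡 n) F ∞ V → TopSection n M}
    (hKl : IsLinearMap ℝ K) (hK : ∀ x φ φ', JetEq 0 x φ φ' → JetEq 0 x (K φ) (K φ'))
    (hDl : IsLinearMap ℝ D) (hD : IsDiffOp D) (x : M)
    (hflat : ∀ φ k, JetEq k x (D φ) 0)
    (hint : ∀ φ : ContMDiffSection (𝓡 n) F ∞ V, IsCompact (secSupport φ) →
      secSupport φ ⊆ (chartAt (EuclideanSpace ℝ (Fin n)) x).source →
      chartIntegral (achart (EuclideanSpace ℝ (Fin n)) x) (fun p => K φ p) =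
        chartIntegral (achart (EuclideanSpace ℝ (Fin n)) x) (fun p => D φ p))
    (φ : ContMDiffSection (𝓡 n) F ∞ V) : K φ x = 0 := by
  set y₀ := extChartAt (𝓡 n) x x with hy₀
  -- it suffices to show that the coordinate of the form is not positive
  suffices hpos : ∀ φ, ¬ 0 < localRep x (K φ) y₀ by
    have h1 : localRep x (K φ) y₀ = 0 := by
      refine le_antisymm (not_lt.1 (hpos φ)) (not_lt.1 fun h => hpos (-φ) ?_)
      have h2 : K (-φ) = (-1 : ℝ) • K φ := by rw [← hKl.map_smul, neg_one_smul]
      rw [h2, localRep_smul (mem_localDomain ℝ (TopForm n M) x), neg_one_smul]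
      exact neg_pos.2 h
    rw [hy₀, ← triv_eq_localRep (mem_extChartAt_source x)] at h1
    exact triv_inj (s' := (0 : TopSection n M)) (mem_baseSet_trivializationAt ℝ (TopForm n M) x)
      (h1.trans (triv_zero (mem_baseSet_trivializationAt ℝ (TopForm n M) x)).symm)
  intro φ hφ
  set v := localRep x φ y₀
  set sv : ContMDiffSection (𝓡 n) F ∞ V := secOf x
    ⟨fun _ => v, (contDiff_const : ContDiff ℝ ∞ fun _ => v)⟩ with hsv
  have hball : ∀ᶠ y in 𝓝 y₀, y ∈ Metric.ball y₀ (cutoff n F V x).rIn :=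
    Metric.ball_mem_nhds y₀ (cutoff n F V x).rIn_pos
  set h : EuclideanSpace ℝ (Fin n) → ℝ := localRep x (K sv) with hh
  have hsvφ : JetEq 0 x φ sv := by
    rw [jetEq_zero_order_iff]
    refine triv_inj (mem_baseSet_trivializationAt F V x) ?_
    rw [triv_eq_localRep (mem_extChartAt_source x), triv_eq_localRep (mem_extChartAt_source x),
      (localRep_secOf_eventually (V := V) (Metric.mem_ball_self (cutoff n F V x).rIn_pos) _).eq_of_nhds]
  have hh0 : 0 < h y₀ := by
    have h1 : localRep x (K φ) y₀ = h y₀ := by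
      rw [hh, hy₀, ← triv_eq_localRep (mem_extChartAt_source x),
        ← triv_eq_localRep (mem_extChartAt_source x)]
      exact triv_congr (jetEq_zero_order_iff.1 (hK _ _ _ hsvφ))
    rwa [h1] at hφ
  obtain ⟨k, m, g, c, C, hrep, -, -, hC⟩ := exists_linear_rep hDl hD x
  have hg : ∀ i, ∃ C : ℝ, ∀ᶠ y in 𝓝 y₀, ‖localRep x (D (g i)) y‖ ≤ C * ‖y - y₀‖ ^ (k + 1) :=
    fun i => DerivZero.exists_norm_le (k + 1)
      (contDiffAt_localRep (mem_localDomain ℝ (TopForm n M) x) _)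
      (jetEq_zero_iff_derivZero.1 (hflat (g i) (k + 1)))
  choose Cg hCg using hg
  -- the bump functions of size `ε` have `k`-jets of size `ε⁻ᵏ`, while the values of `D` are of size
  -- `ε ^ (k + 1)` on their supports
  obtain ⟨Cb, hCb0, hCb⟩ := norm_jet_scaledBump_le k y₀ v
  have hcont : ContinuousAt h y₀ :=
    (contDiffAt_localRep (mem_localDomain ℝ (TopForm n M) x) _).continuousAt
  have hall := (hcont.eventually (lt_mem_nhds (half_lt_self hh0))).and (hrep.and (hC.and
    ((eventually_all.2 hCg).and (hball.and
      ((eventually_mem_localDomain (mem_localDomain F V x)).and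
      (eventually_mem_localDomain (mem_localDomain ℝ (TopForm n M) x)))))))
  obtain ⟨r, hr, hr'⟩ := Metric.eventually_nhds_iff_ball.1 hall
  set C' : ℝ := ∑ i : Fin m, |C| * Cb * (|Cg i| * 2 ^ (k + 1)) with hC'
  have key : ∀ ε : ℝ, 0 < ε → ε ≤ 1 → 2 * ε < r → h y₀ / 2 ≤ C' * 2 ^ n * ε := by
    intro ε hε hε1 hεr
    set s : ContMDiffSection (𝓡 n) F ∞ V := bumpSec x v ε with hs
    have hsub : Metric.closedBall y₀ (2 * ε) ⊆ Metric.ball y₀ r :=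
      Metric.closedBall_subset_ball hεr
    have hsubt : Metric.closedBall y₀ (2 * ε) ⊆ (extChartAt (𝓡 n) x).target := fun y hy =>
      (hr' y (hsub hy)).2.2.2.2.2.1.1
    -- outside the ball of radius `2 ε` the integrands vanish
    have hzero : ∀ y ∈ (extChartAt (𝓡 n) x).target \ Metric.closedBall y₀ (2 * ε),
        ∀ᶠ p in 𝓝 ((extChartAt (𝓡 n) x).symm y), JetEq 0 p s 0 := by
      intro y hy
      have h1 : ContinuousAt (extChartAt (𝓡 n) x) ((extChartAt (𝓡 n) x).symm y) :=
        continuousAt_extChartAt' ((extChartAt (𝓡 n) x).map_target hy.1)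
      have h2 := h1.eventually (Metric.isClosed_closedBall.isOpen_compl.mem_nhds (by
        rw [(extChartAt (𝓡 n) x).right_inv hy.1]; exact hy.2))
      filter_upwards [h2] with p hp
      rw [jetEq_zero_order_iff]
      change secVal x _ p = 0
      simp only [secVal]
      split_ifs
      · rw [scaledBump_eq_zero v hε hp, smul_zero, map_zero]
      · rfl
    have hzrep : ∀ (ρ : TopSection n M) (y : EuclideanSpace ℝ (Fin n)),
        JetEq 0 ((extChartAt (𝓡 n) x).symm y) ρ 0 → y ∈ (extChartAt (𝓡 n) x).target →
        localRep x ρ y = 0 := by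
      intro ρ y hρ hy
      have h1 : (extChartAt (𝓡 n) x).symm y ∈ (trivializationAt ℝ (TopForm n M) x).baseSet := by
        have := (extChartAt (𝓡 n) x).map_target hy
        rw [extChartAt_source] at this
        exact this
      rw [localRep_eq_triv, triv_congr (jetEq_zero_order_iff.1 hρ), triv_zero h1]
    have hKz : ∀ y ∈ (extChartAt (𝓡 n) x).target \ Metric.closedBall y₀ (2 * ε),
        localRep x (K s) y = 0 := fun y hy => hzrep _ y (by
      have := hK _ _ _ (hzero y hy).self_of_nhds
      rwa [hKl.map_zero] at this) hy.1
    have hDz : ∀ y ∈ (extChartAt (𝓡 n) x).target \ Metric.closedBall y₀ (2 * ε),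
        localRep x (D s) y = 0 := fun y hy => hzrep _ y (by
      have := hD.local (hzero y hy)
      rwa [hDl.map_zero] at this) hy.1
    have hmt : MeasurableSet (extChartAt (𝓡 n) x).target :=
      (isOpen_extChartAt_target x).measurableSet
    have hint' := hint s (isCompact_secSupport_secOf x _) (by
      rw [← extChartAt_source (𝓡 n) x]
      exact (secSupport_secOf x _).trans (cutoffSupport_subset n F V x))
    rw [chartIntegral_achart, chartIntegral_achart,
      setIntegral_eq_of_subset_of_forall_sdiff_eq_zero hmt hsubt hKz,
      setIntegral_eq_of_subset_of_forall_sdiff_eq_zero hmt hsubt hDz] at hint'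
    -- the left-hand side
    have hKs : ∀ y ∈ Metric.closedBall y₀ (2 * ε),
        localRep x (K s) y = unitBump (EuclideanSpace ℝ (Fin n)) (ε⁻¹ • (y - y₀)) * h y := by
      intro y hy
      obtain ⟨-, -, -, -, hb, hd, hd'⟩ := hr' y (hsub hy)
      have h1 : JetEq 0 ((extChartAt (𝓡 n) x).symm y) s
          (unitBump (EuclideanSpace ℝ (Fin n)) (ε⁻¹ • (y - y₀)) • sv) := by
        rw [jetEq_zero_order_iff]
        refine triv_inj hd.2 ?_
        rw [← localRep_eq_triv, ← localRep_eq_triv, localRep_smul hd, hs, bumpSec, hsv,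
          localRep_secOf hd, localRep_secOf hd, smul_comm]
        rfl
      have h2 := triv_congr (x := x) (jetEq_zero_order_iff.1 (hK _ _ _ h1))
      rw [hKl.map_smul, ← localRep_eq_triv, ← localRep_eq_triv, localRep_smul hd'] at h2
      exact h2
    have hKcont : ContinuousOn (localRep x (K s)) (Metric.closedBall y₀ (2 * ε)) :=
      (contDiffOn_localRep x (K s)).continuousOn.mono fun y hy => (hr' y (hsub hy)).2.2.2.2.2.2
    have hKi : IntegrableOn (localRep x (K s)) (Metric.closedBall y₀ (2 * ε)) :=
      hKcont.integrableOn_compact (isCompact_closedBall _ _)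
    have hsub2 : Metric.closedBall y₀ ε ⊆ Metric.closedBall y₀ (2 * ε) :=
      Metric.closedBall_subset_closedBall (by linarith)
    have hlow : h y₀ / 2 * volume.real (Metric.closedBall y₀ ε) ≤
        ∫ y in Metric.closedBall y₀ (2 * ε), localRep x (K s) y := by
      refine (setIntegral_ge_of_const_le_real measurableSet_closedBall
        (measure_closedBall_lt_top.ne) (fun y hy => ?_) (hKi.mono_set hsub2)).trans
        (setIntegral_mono_set hKi ?_ hsub2.eventuallyLE)
      · rw [hKs y (hsub2 hy), unitBump_eq_one hε hy, one_mul]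
        exact (hr' y (hsub (hsub2 hy))).1.le
      · refine (ae_restrict_mem measurableSet_closedBall).mono fun y hy => ?_
        rw [hKs y hy]
        exact mul_nonneg (unitBump _).nonneg ((half_pos hh0).le.trans (hr' y (hsub hy)).1.le)
    -- the right-hand side
    have hup : ‖∫ y in Metric.closedBall y₀ (2 * ε), localRep x (D s) y‖ ≤
        C' * ε * volume.real (Metric.closedBall y₀ (2 * ε)) := by
      refine norm_setIntegral_le_of_norm_le_const measure_closedBall_lt_top fun y hy => ?_
      obtain ⟨-, h1, h2, h3, h4, -, -⟩ := hr' y (hsub hy)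
      rw [h1, hC', Finset.sum_mul]
      refine norm_sum_le_of_le _ fun i _ => ?_
      have h5 : |c i s y| ≤ |C| * (Cb * ε⁻¹ ^ k) := by
        refine (h2 i s).trans ?_
        rw [hs, bumpSec, jet_congr (localRep_secOf_eventually h4 _)]
        exact mul_le_mul (le_abs_self C) (hCb ε hε hε1 y) (norm_nonneg _) (abs_nonneg _)
      have h6 : ‖localRep x (D (g i)) y‖ ≤ |Cg i| * (2 * ε) ^ (k + 1) := by
        refine (h3 i).trans ?_
        rw [Metric.mem_closedBall, dist_eq_norm] at hy
        exact mul_le_mul (le_abs_self _) (by gcongr) (by positivity) (abs_nonneg _)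
      rw [norm_smul, Real.norm_eq_abs]
      calc _ ≤ |C| * (Cb * ε⁻¹ ^ k) * (|Cg i| * (2 * ε) ^ (k + 1)) :=
            mul_le_mul h5 h6 (norm_nonneg _) (by positivity)
        _ = _ := by
          rw [inv_pow, mul_pow, pow_succ ε]
          field_simp
    have h1 := hlow.trans ((hint'.trans_le (le_abs_self _)).trans hup)
    rw [Measure.addHaar_real_closedBall _ _ hε.le,
      Measure.addHaar_real_closedBall _ _ (by positivity), finrank_euclideanSpace_fin] at h1
    have h2 : 0 < volume.real (Metric.ball (0 : EuclideanSpace ℝ (Fin n)) 1) :=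
      ENNReal.toReal_pos (Metric.measure_ball_pos _ _ one_pos).ne' measure_ball_lt_top.ne
    have h3 : 0 < ε ^ n * volume.real (Metric.ball (0 : EuclideanSpace ℝ (Fin n)) 1) := by
      positivity
    refine le_of_mul_le_mul_right ?_ h3
    calc _ ≤ _ := h1
      _ = _ := by ring
  have h1 : ∀ᶠ ε : ℝ in 𝓝[>] 0, h y₀ / 2 ≤ C' * 2 ^ n * ε := by
    filter_upwards [Ioo_mem_nhdsGT (show (0 : ℝ) < min 1 (r / 2) by positivity)] with ε hε
    have h2 := lt_min_iff.1 hε.2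
    exact key ε hε.1 h2.1.le (by linarith [h2.2])
  have h2 : Tendsto (fun ε : ℝ => C' * 2 ^ n * ε) (𝓝[>] 0) (𝓝 (C' * 2 ^ n * 0)) :=
    (tendsto_nhdsWithin_of_tendsto_nhds tendsto_id).const_mul _
  have h3 := ge_of_tendsto h2 h1
  linarith

end Fundamental

/-! ### Supports and integrals of top-degree forms -/

section Support

variable {M : Type*} [TopologicalSpace M] {S T : Type*} [SectionSpace M S] [SectionSpace M T]
  [AddCommGroup S] [Module ℝ S] [JetModel S] [AddCommGroup T] [Module ℝ T] [JetModel T]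

theorem jet_zero_of_notMem_secSupport {s : S} {x : M} (h : x ∉ secSupport s) : JetEq 0 x s 0 := by
  by_contra h'
  exact h (subset_closure h')

theorem eventually_jet_zero {s : S} {x : M} (h : x ∉ secSupport s) : ∀ᶠ y in 𝓝 x, JetEq 0 y s 0 :=
  mem_of_superset (isClosed_closure.isOpen_compl.mem_nhds h) fun _ => jet_zero_of_notMem_secSupport

theorem secSupport_subset {s : S} {K : Set M} (hK : IsClosed K) (h : ∀ x ∉ K, JetEq 0 x s 0) :
    secSupport s ⊆ K := by
  refine closure_minimal (fun x hx => ?_) hK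
  by_contra hx'
  exact hx (h x hx')

theorem secSupport_add_subset (s s' : S) : secSupport (s + s') ⊆ secSupport s ∪ secSupport s' :=
  secSupport_subset (isClosed_closure.union isClosed_closure) fun _ hx =>
    jet_add (jet_zero_of_notMem_secSupport fun h => hx (Or.inl h))
      (jet_zero_of_notMem_secSupport fun h => hx (Or.inr h))

theorem secSupport_smul_subset (r : ℝ) (s : S) : secSupport (r • s) ⊆ secSupport s :=
  secSupport_subset isClosed_closure fun _ hx => jet_smul r (jet_zero_of_notMem_secSupport hx)

theorem secSupport_zero : secSupport (0 : S) = (∅ : Set M) :=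
  Set.subset_empty_iff.1 (secSupport_subset isClosed_empty fun x _ => jet_zero 0 x)

theorem secSupport_fst_subset (s : S × T) : secSupport s.1 ⊆ secSupport s :=
  secSupport_subset isClosed_closure fun _ hx => (jet_zero_of_notMem_secSupport hx).1

theorem secSupport_snd_subset (s : S × T) : secSupport s.2 ⊆ secSupport s :=
  secSupport_subset isClosed_closure fun _ hx => (jet_zero_of_notMem_secSupport hx).2

theorem secSupport_prod_subset (s : S × T) : secSupport s ⊆ secSupport s.1 ∪ secSupport s.2 :=
  secSupport_subset (isClosed_closure.union isClosed_closure) fun _ hx =>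
    ⟨jet_zero_of_notMem_secSupport fun h => hx (Or.inl h),
      jet_zero_of_notMem_secSupport fun h => hx (Or.inr h)⟩

theorem IsDiffOp.secSupport_subset {D : S → T} (hD : IsDiffOp D) (h0 : D 0 = 0) (s : S) :
    secSupport (D s) ⊆ secSupport s :=
  Kupershmidt.secSupport_subset isClosed_closure fun _ hx => by
    have := hD.local (eventually_jet_zero hx)
    rwa [h0] at this

/-- The section `s` has compact support in the set `O`. -/
def CompactIn (O : Set M) (s : S) : Prop := IsCompact (secSupport s) ∧ secSupport s ⊆ O

theorem CompactIn.mono {O : Set M} {s : S} {t : T} (h : CompactIn O s)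
    (hst : secSupport t ⊆ secSupport s) : CompactIn O t :=
  ⟨h.1.of_isClosed_subset isClosed_closure hst, hst.trans h.2⟩

theorem CompactIn.add {O : Set M} {s s' : S} (h : CompactIn O s) (h' : CompactIn O s') :
    CompactIn O (s + s') :=
  ⟨(h.1.union h'.1).of_isClosed_subset isClosed_closure (secSupport_add_subset s s'),
    (secSupport_add_subset s s').trans (Set.union_subset h.2 h'.2)⟩

theorem CompactIn.prodMk {O : Set M} {s : S} {t : T} (h : CompactIn O s) (h' : CompactIn O t) :
    CompactIn O (s, t) :=
  ⟨(h.1.union h'.1).of_isClosed_subset isClosed_closure (secSupport_prod_subset (s, t)),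
    (secSupport_prod_subset (s, t)).trans (Set.union_subset h.2 h'.2)⟩

theorem CompactIn.fst {O : Set M} {s : S × T} (h : CompactIn O s) : CompactIn O s.1 :=
  h.mono (secSupport_fst_subset s)

theorem CompactIn.snd {O : Set M} {s : S × T} (h : CompactIn O s) : CompactIn O s.2 :=
  h.mono (secSupport_snd_subset s)

theorem CompactIn.smul {O : Set M} {s : S} (r : ℝ) (h : CompactIn O s) : CompactIn O (r • s) :=
  h.mono (secSupport_smul_subset r s)

theorem CompactIn.zero (O : Set M) : CompactIn O (0 : S) := by
  rw [CompactIn, secSupport_zero]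
  exact ⟨isCompact_empty, Set.empty_subset O⟩

theorem CompactIn.apply {O : Set M} {s : S} (h : CompactIn O s) {D : S → T} (hD : IsDiffOp D)
    (h0 : D 0 = 0) : CompactIn O (D s) := h.mono (hD.secSupport_subset h0 s)

end Support

section Integral

variable {n : ℕ} {M : Type*} [TopologicalSpace M] [T2Space M]
  [ChartedSpace (EuclideanSpace ℝ (Fin n)) M] [IsManifold (𝓡 n) ∞ M]

/-- The density of a top-degree form in the coordinates of the chart `c`, extended by zero. -/
def chartDensity (c : atlas (EuclideanSpace ℝ (Fin n)) M) (ρ : TopSection n M) :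
    EuclideanSpace ℝ (Fin n) → ℝ :=
  c.1.target.indicator fun y => ((topFormCore n M).localTriv c ⟨c.1.symm y, ρ (c.1.symm y)⟩).2

theorem chartIntegral_eq_integral (c : atlas (EuclideanSpace ℝ (Fin n)) M) (ρ : TopSection n M) :
    chartIntegral c (fun p => ρ p) = ∫ y, chartDensity c ρ y :=
  (integral_indicator c.1.open_target.measurableSet).symm

theorem isLinearMap_chartDensity (c : atlas (EuclideanSpace ℝ (Fin n)) M) :
    IsLinearMap ℝ (chartDensity c) := by
  have h : ∀ y ∈ c.1.target, IsLinearMap ℝ fun v : TopForm n M (c.1.symm y) =>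
      ((topFormCore n M).localTriv c ⟨c.1.symm y, v⟩).2 := fun y hy =>
    ((topFormCore n M).localTriv c).linear ℝ (c.1.map_target hy)
  constructor
  · intro ρ ρ'
    funext y
    by_cases hy : y ∈ c.1.target
    · simp only [chartDensity, Pi.add_apply, Set.indicator_of_mem hy]
      exact (h y hy).map_add _ _
    · simp only [chartDensity, Pi.add_apply, Set.indicator_of_notMem hy, add_zero]
  · intro r ρ
    funext y
    by_cases hy : y ∈ c.1.target
    · simp only [chartDensity, Pi.smul_apply, Set.indicator_of_mem hy]
      exact (h y hy).map_smul _ _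
    · simp only [chartDensity, Pi.smul_apply, Set.indicator_of_notMem hy, smul_zero]

theorem chartDensity_eq_zero {c : atlas (EuclideanSpace ℝ (Fin n)) M} {ρ : TopSection n M}
    {K : Set M} (h : secSupport ρ ⊆ K) {y : EuclideanSpace ℝ (Fin n)} (hy : y ∉ c.1 '' K) :
    chartDensity c ρ y = 0 := by
  by_cases hy' : y ∈ c.1.target
  · have h1 : c.1.symm y ∉ secSupport ρ := fun h' => hy ⟨_, h h', c.1.right_inv hy'⟩
    have h2 : ρ (c.1.symm y) = 0 := jetEq_zero_order_iff.1 (jet_zero_of_notMem_secSupport h1)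
    rw [chartDensity, Set.indicator_of_mem hy', h2]
    exact (((topFormCore n M).localTriv c).linear ℝ (c.1.map_target hy')).map_zero
  · rw [chartDensity, Set.indicator_of_notMem hy']

theorem continuous_chartDensity {X : Type*} [TopologicalSpace X]
    (c : atlas (EuclideanSpace ℝ (Fin n)) M) {ρ : X → TopSection n M}
    (hρ : Continuous fun q : X × M => (⟨q.2, ρ q.1 q.2⟩ : Bundle.TotalSpace ℝ (TopForm n M)))
    {K : Set M} (hK : IsCompact K) (hKc : K ⊆ c.1.source) (h : ∀ a, secSupport (ρ a) ⊆ K) :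
    Continuous fun q : X × EuclideanSpace ℝ (Fin n) => chartDensity c (ρ q.1) q.2 := by
  have hK' : IsCompact (c.1 '' K) := hK.image_of_continuousOn (c.1.continuousOn.mono hKc)
  refine continuous_iff_continuousAt.2 fun ⟨a, y⟩ => ?_
  by_cases hy : y ∈ c.1 '' K
  · have hyt : y ∈ c.1.target := by
      obtain ⟨p, hp, rfl⟩ := hy
      exact c.1.map_source (hKc hp)
    have h1 : ContinuousAt (fun q : X × EuclideanSpace ℝ (Fin n) => (q.1, c.1.symm q.2)) (a, y) :=
      continuousAt_fst.prodMk
        (ContinuousAt.comp (f := fun q : X × EuclideanSpace ℝ (Fin n) => q.2) (g := c.1.symm)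
          (c.1.symm.continuousAt hyt) continuousAt_snd)
    have h2 := ContinuousAt.comp (f := fun q : X × EuclideanSpace ℝ (Fin n) => (q.1, c.1.symm q.2))
      (x := (a, y)) hρ.continuousAt h1
    have h3 : ContinuousAt ((topFormCore n M).localTriv c)
        (⟨c.1.symm y, ρ a (c.1.symm y)⟩ : Bundle.TotalSpace ℝ (TopForm n M)) :=
      ((topFormCore n M).localTriv c).continuousAt
        (((topFormCore n M).localTriv c).mem_source.2 (c.1.map_target hyt))
    have h4 := continuousAt_snd.comp (ContinuousAt.comp
      (f := fun q : X × EuclideanSpace ℝ (Fin n) =>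
        (⟨c.1.symm q.2, ρ q.1 (c.1.symm q.2)⟩ : Bundle.TotalSpace ℝ (TopForm n M)))
      (x := (a, y)) h3 h2)
    refine h4.congr ?_
    filter_upwards [(isOpen_univ.prod c.1.open_target).mem_nhds
      (show (a, y) ∈ Set.univ ×ˢ c.1.target from ⟨trivial, hyt⟩)] with q hq
    rw [chartDensity, Set.indicator_of_mem hq.2]; rfl
  · refine (continuousAt_const (y := (0 : ℝ))).congr ?_
    filter_upwards [(isOpen_univ.prod hK'.isClosed.isOpen_compl).mem_nhds
      (show (a, y) ∈ Set.univ ×ˢ (c.1 '' K)ᶜ from ⟨trivial, hy⟩)] with q hq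
    exact (chartDensity_eq_zero (h q.1) hq.2).symm

theorem integrable_chartDensity {c : atlas (EuclideanSpace ℝ (Fin n)) M} {ρ : TopSection n M}
    (h : CompactIn c.1.source ρ) : Integrable (chartDensity c ρ) := by
  have h1 := continuous_chartDensity (X := Unit) c (ρ := fun _ => ρ)
    (ρ.contMDiff.continuous.comp continuous_snd) h.1 h.2 fun _ => subset_rfl
  have h2 : Continuous (chartDensity c ρ) := h1.comp (Continuous.prodMk_right ())
  refine h2.integrable_of_hasCompactSupport (HasCompactSupport.intro
    (h.1.image_of_continuousOn (c.1.continuousOn.mono h.2)) fun y hy => ?_)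
  exact chartDensity_eq_zero subset_rfl hy

/-- The form `ρ` has compact support in the domain of the chart `c`, and its integral vanishes. -/
def Null (c : atlas (EuclideanSpace ℝ (Fin n)) M) (ρ : TopSection n M) : Prop :=
  CompactIn c.1.source ρ ∧ chartIntegral c (fun p => ρ p) = 0

variable {c : atlas (EuclideanSpace ℝ (Fin n)) M} {ρ ρ' : TopSection n M}

theorem chartIntegral_add (h : CompactIn c.1.source ρ) (h' : CompactIn c.1.source ρ') :
    chartIntegral c (fun p => (ρ + ρ') p) =
      chartIntegral c (fun p => ρ p) + chartIntegral c (fun p => ρ' p) := by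
  rw [chartIntegral_eq_integral, chartIntegral_eq_integral, chartIntegral_eq_integral,
    (isLinearMap_chartDensity c).map_add]
  exact integral_add (integrable_chartDensity h) (integrable_chartDensity h')

theorem chartIntegral_smul (r : ℝ) (ρ : TopSection n M) :
    chartIntegral c (fun p => (r • ρ) p) = r * chartIntegral c (fun p => ρ p) := by
  rw [chartIntegral_eq_integral, chartIntegral_eq_integral, (isLinearMap_chartDensity c).map_smul]
  exact integral_const_mul r _

theorem Null.add (h : Null c ρ) (h' : Null c ρ') : Null c (ρ + ρ') :=
  ⟨h.1.add h'.1, by rw [chartIntegral_add h.1 h'.1, h.2, h'.2, add_zero]⟩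

theorem Null.smul (r : ℝ) (h : Null c ρ) : Null c (r • ρ) :=
  ⟨h.1.smul r, by rw [chartIntegral_smul, h.2, mul_zero]⟩

theorem Null.neg (h : Null c ρ) : Null c (-ρ) := by
  rw [← neg_one_smul ℝ ρ]; exact h.smul _

theorem Null.sub (h : Null c ρ) (h' : Null c ρ') : Null c (ρ - ρ') := by
  rw [sub_eq_add_neg]; exact h.add h'.neg

theorem null_sub_iff (h : CompactIn c.1.source ρ) (h' : CompactIn c.1.source ρ') :
    Null c (ρ - ρ') ↔ chartIntegral c (fun p => ρ p) = chartIntegral c (fun p => ρ' p) := by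
  have h1 : CompactIn c.1.source (-ρ') := by rw [← neg_one_smul ℝ ρ']; exact h'.smul _
  have h2 : chartIntegral c (fun p => (ρ - ρ') p) =
      chartIntegral c (fun p => ρ p) - chartIntegral c (fun p => ρ' p) := by
    rw [sub_eq_add_neg, chartIntegral_add h h1, ← neg_one_smul ℝ ρ', chartIntegral_smul]
    ring
  rw [Null, h2, sub_eq_zero, and_iff_right]
  rw [sub_eq_add_neg]; exact h.add h1

theorem SmFam.continuous_chartIntegral {ρ : ℝ → TopSection n M} (hρ : SmFam ρ) {K : Set M}
    (hK : IsCompact K) (hKc : K ⊆ c.1.source) (h : ∀ t, secSupport (ρ t) ⊆ K) :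
    Continuous fun t => chartIntegral c (fun p => ρ t p) := by
  have h1 : Continuous fun q : ℝ × M =>
      (⟨q.2, ρ q.1 q.2⟩ : Bundle.TotalSpace ℝ (TopForm n M)) := by
    have h2 : ContMDiff _ _ ∞ _ := hρ _ (toEuclidean (E := ℝ)).symm (toEuclidean (E := ℝ)).symm.contDiff
    have h3 := h2.continuous.comp (f := fun q : ℝ × M => (toEuclidean q.1, q.2))
      ((toEuclidean.continuous.comp continuous_fst).prodMk continuous_snd)
    simpa [Function.comp_def] using h3
  have h2 := continuous_chartDensity c h1 hK hKc h
  simp only [chartIntegral_eq_integral]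
  rw [← continuousOn_univ]
  refine continuousOn_integral_of_compact_support
    (hK.image_of_continuousOn (c.1.continuousOn.mono hKc)) (h2.continuousOn) ?_
  exact fun t y _ hy => chartDensity_eq_zero (h t) hy

/-- Differentiation under the integral sign. -/
theorem Null.of_hasVelocity {ρ : ℝ → TopSection n M} (hρ : SmFam ρ) {v : TopSection n M}
    (hv : HasVelocity ρ v) {K : Set M} (hK : IsCompact K) (hKc : K ⊆ c.1.source)
    (hs : ∀ t, secSupport (ρ t) ⊆ K) (h : ∀ t, Null c (ρ t)) : Null c v := by
  obtain ⟨f, hf, hρf, hv'⟩ := hρ.hadamard_line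
  obtain rfl := hasVelocity_unique hv hv'
  have hKcl : IsClosed K := hK.isClosed
  have hft : ∀ t, t ≠ 0 → f t = t⁻¹ • (ρ t - ρ 0) := fun t ht => by
    rw [hρf t, add_sub_cancel_left, inv_smul_smul₀ ht]
  have hfs : ∀ t, secSupport (f t) ⊆ K := by
    intro t
    refine secSupport_subset hKcl fun x hx => ?_
    have h0 : ∀ t, JetEq 0 x (ρ t) 0 := fun t => jet_zero_of_notMem_secSupport fun h => hx (hs t h)
    by_cases ht : t = 0
    · subst ht
      refine jet_zero_iff.2 fun l hl => ?_
      have h1 := hasVelocity_iff.1 hv x l hl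
      have h2 : (fun t => l (ρ t)) = fun _ => 0 := by
        funext t; rw [jet_zero_iff.1 (h0 t) l hl, map_zero]
      rw [h2] at h1
      rw [map_zero]
      exact h1.unique (hasDerivAt_const _ _)
    · rw [hft t ht]
      exact jet_smul _ (jet_sub (h0 t) (h0 0))
  refine ⟨⟨hK.of_isClosed_subset isClosed_closure (hfs 0), (hfs 0).trans hKc⟩, ?_⟩
  have h1 := hf.continuous_chartIntegral hK hKc hfs
  have h2 := Continuous.ext_on (dense_compl_singleton (0 : ℝ)) h1
    (continuous_const (y := (0 : ℝ))) fun t ht => by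
      rw [hft t ht]
      exact (((h t).sub (h 0)).smul _).2
  exact congrFun h2 0

end Integral

/-! ### Operators of order zero and section models -/

/-- Linear differential operators of order zero. -/
structure OrderZero {M S T : Type*} [SectionSpace M S] [SectionSpace M T] [AddCommGroup S]
    [Module ℝ S] [AddCommGroup T] [Module ℝ T] (g : S → T) : Prop where
  linear : IsLinearMap ℝ g
  jet : ∀ {x : M} {s s' : S}, JetEq 0 x s s' → JetEq 0 x (g s) (g s')
  fam : ∀ {N : ℕ} {c : EuclideanSpace ℝ (Fin N) → S}, SmoothFamily c →
    SmoothFamily (fun a => g (c a))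

section OrderZero

variable {M S T U : Type*} [SectionSpace M S] [SectionSpace M T] [SectionSpace M U]
  [AddCommGroup S] [Module ℝ S] [AddCommGroup T] [Module ℝ T] [AddCommGroup U] [Module ℝ U]

theorem OrderZero.isDiffOp {g : S → T} (h : OrderZero g) : IsDiffOp g :=
  ⟨⟨0, fun _ _ _ => h.jet⟩, fun _ _ => h.fam⟩

theorem OrderZero.comp_isDiffOp {g : S → T} (h : OrderZero g) {D : U → S} (hD : IsDiffOp D) :
    IsDiffOp (fun u => g (D u)) := by
  obtain ⟨⟨k, hk⟩, hf⟩ := hD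
  exact ⟨⟨k, fun x u u' hu => h.jet (hk x u u' hu)⟩, fun N c hc => h.fam (hf N c hc)⟩

theorem OrderZero.comp {g : S → T} (h : OrderZero g) {f : U → S} (hf : OrderZero f) :
    OrderZero (fun u => g (f u)) :=
  ⟨⟨fun a b => by rw [hf.linear.map_add, h.linear.map_add],
    fun r a => by rw [hf.linear.map_smul, h.linear.map_smul]⟩,
    fun hu => h.jet (hf.jet hu), fun hc => h.fam (hf.fam hc)⟩

theorem OrderZero.fst : OrderZero (fun z : S × T => z.1) :=
  ⟨⟨fun _ _ => rfl, fun _ _ => rfl⟩, fun h => h.1, fun h => h.1⟩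

theorem OrderZero.snd : OrderZero (fun z : S × T => z.2) :=
  ⟨⟨fun _ _ => rfl, fun _ _ => rfl⟩, fun h => h.2, fun h => h.2⟩

variable [TopologicalSpace M] [JetModel S] [JetModel T]

theorem OrderZero.inl : OrderZero (fun s : S => (s, (0 : T))) :=
  ⟨⟨fun a b => by simp, fun r a => by simp⟩, fun h => ⟨h, jet_refl _ _ _⟩,
    fun h => ⟨h, fam_const _ _⟩⟩

theorem OrderZero.inr : OrderZero (fun t : T => ((0 : S), t)) :=
  ⟨⟨fun a b => by simp, fun r a => by simp⟩, fun h => ⟨jet_refl _ _ _, h⟩,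
    fun h => ⟨fam_const _ _, h⟩⟩

end OrderZero

/-- The properties of spaces of sections of vector bundles over `M` that depend on the smooth
structure of `M`; they are inherited by direct sums. -/
class SectionModel (n : ℕ) {M : outParam (Type*)} [TopologicalSpace M] [T2Space M]
    [ChartedSpace (EuclideanSpace ℝ (Fin n)) M] [IsManifold (𝓡 n) ∞ M] (S : Type*)
    [SectionSpace M S] [AddCommGroup S] [Module ℝ S] : Prop where
  preservesFlat_fun : PreservesFlat S (Fun n M)
  exists_components : ∀ x : M, ∃ Λ : Set (S → Fun n M), (∀ g ∈ Λ, OrderZero g) ∧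
    ∀ k s, (∀ g ∈ Λ, JetEq k x (g s) 0) → JetEq k x s 0
  exists_cutoff_section : ∀ (c : atlas (EuclideanSpace ℝ (Fin n)) M) (K : Set M), IsCompact K →
    K ⊆ c.1.source → ∀ s : S, ∃ s' : S, (∀ᶠ y in 𝓝ˢ K, JetEq 0 y s' s) ∧ CompactIn c.1.source s'
  fundamental : ∀ (K D : S → TopSection n M), OrderZero K → IsLinearMap ℝ D → IsDiffOp D →
    ∀ x : M, (∀ φ k, JetEq k x (D φ) 0) →
    (∀ φ, CompactIn (chartAt (EuclideanSpace ℝ (Fin n)) x).source φ →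
      Null (achart (EuclideanSpace ℝ (Fin n)) x) (K φ - D φ)) → ∀ φ, K φ x = 0

section Prod

variable {n : ℕ} {M : Type*} [TopologicalSpace M] [T2Space M]
  [ChartedSpace (EuclideanSpace ℝ (Fin n)) M] [IsManifold (𝓡 n) ∞ M] {S T : Type*}
  [SectionSpace M S] [AddCommGroup S] [Module ℝ S] [SectionSpace M T] [AddCommGroup T] [Module ℝ T]
  [JetModel S] [JetModel T] [SectionModel n S] [SectionModel n T]

open SectionModel

instance instSectionModelProd : SectionModel n (S × T) where
  preservesFlat_fun := PreservesFlat.prod_left preservesFlat_fun preservesFlat_fun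
  exists_components x := by
    obtain ⟨Λ, h, h'⟩ := exists_components (n := n) (S := S) x
    obtain ⟨Ξ, k, k'⟩ := exists_components (n := n) (S := T) x
    refine ⟨{g | (∃ f ∈ Λ, g = fun z => f z.1) ∨ ∃ f ∈ Ξ, g = fun z => f z.2}, ?_, fun j s hs => ?_⟩
    · rintro g (⟨f, hf, rfl⟩ | ⟨f, hf, rfl⟩)
      · exact (h f hf).comp OrderZero.fst
      · exact (k f hf).comp OrderZero.snd
    · exact ⟨h' j s.1 fun g hg => hs _ (Or.inl ⟨g, hg, rfl⟩),
        k' j s.2 fun g hg => hs _ (Or.inr ⟨g, hg, rfl⟩)⟩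
  exists_cutoff_section c K hK hKc s := by
    obtain ⟨s', h, h'⟩ := exists_cutoff_section c K hK hKc s.1
    obtain ⟨t', k, k'⟩ := exists_cutoff_section c K hK hKc s.2
    exact ⟨(s', t'), by filter_upwards [h, k] with y h1 h2 using ⟨h1, h2⟩, h'.prodMk k'⟩
  fundamental K D hK hDl hD x hflat hint φ := by
    have h1 := fundamental (fun s : S => K (s, 0)) (fun s : S => D (s, 0)) (hK.comp OrderZero.inl)
      ⟨fun a b => by rw [← hDl.map_add]; simp, fun r a => by rw [← hDl.map_smul]; simp⟩
      (hD.comp_jetMap (g := fun s : S => (s, 0)) (by fun_prop)) x (fun s => hflat (s, 0))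
      (fun s hs => hint (s, 0) (hs.prodMk (CompactIn.zero _))) φ.1
    have h2 := fundamental (fun t : T => K (0, t)) (fun t : T => D (0, t)) (hK.comp OrderZero.inr)
      ⟨fun a b => by rw [← hDl.map_add]; simp, fun r a => by rw [← hDl.map_smul]; simp⟩
      (hD.comp_jetMap (g := fun s : T => (0, s)) (by fun_prop)) x (fun s => hflat (0, s))
      (fun s hs => hint (0, s) ((CompactIn.zero _).prodMk hs)) φ.2
    have h3 : K φ = K (φ.1, 0) + K (0, φ.2) := by rw [← hK.linear.map_add]; simp
    rw [h3]
    change K (φ.1, 0) x + K (0, φ.2) x = 0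
    rw [h1, h2, add_zero]

end Prod

/-- Linear differential operators take sections that vanish at a point with all their derivatives
to such sections. -/
theorem preservesFlat (n : ℕ) {M : Type*} [TopologicalSpace M] [T2Space M]
    [ChartedSpace (EuclideanSpace ℝ (Fin n)) M] [IsManifold (𝓡 n) ∞ M] {S T : Type*}
    [SectionSpace M S] [AddCommGroup S] [Module ℝ S] [SectionSpace M T] [AddCommGroup T]
    [Module ℝ T] [SectionModel n S] [SectionModel n T] : PreservesFlat S T := by
  intro D hl hD x φ h k
  obtain ⟨Λ, h1, h2⟩ := SectionModel.exists_components (n := n) (S := T) x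
  refine h2 k _ fun g hg => ?_
  exact SectionModel.preservesFlat_fun (n := n) (fun s => g (D s))
    ⟨fun a b => by rw [hl.map_add, (h1 g hg).linear.map_add],
      fun r a => by rw [hl.map_smul, (h1 g hg).linear.map_smul]⟩
    ((h1 g hg).comp_isDiffOp hD) x φ h k

section Hom

variable {n : ℕ} {M : Type*} [TopologicalSpace M] [T2Space M]
  [ChartedSpace (EuclideanSpace ℝ (Fin n)) M] [IsManifold (𝓡 n) ∞ M]
  {F : Type*} [NormedAddCommGroup F] [NormedSpace ℝ F] [FiniteDimensional ℝ F]
  {V : M → Type*} [TopologicalSpace (Bundle.TotalSpace F V)] [∀ x, AddCommGroup (V x)]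
  [∀ x, Module ℝ (V x)] [∀ x, TopologicalSpace (V x)] [FiberBundle F V] [VectorBundle ℝ F V]
  [ContMDiffVectorBundle ∞ F V (𝓡 n)]
  {F' : Type*} [NormedAddCommGroup F'] [NormedSpace ℝ F'] [FiniteDimensional ℝ F']
  {V' : M → Type*} [TopologicalSpace (Bundle.TotalSpace F' V')] [∀ x, AddCommGroup (V' x)]
  [∀ x, Module ℝ (V' x)] [∀ x, TopologicalSpace (V' x)] [∀ x, IsTopologicalAddGroup (V' x)]
  [∀ x, ContinuousSMul ℝ (V' x)] [FiberBundle F' V'] [VectorBundle ℝ F' V']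
  [ContMDiffVectorBundle ∞ F' V' (𝓡 n)]

/-- The application of a section of `Hom(V, V')` to a section of `V`. -/
def applySec (τ : ContMDiffSection (𝓡 n) (F →L[ℝ] F') ∞ (fun x => V x →L[ℝ] V' x))
    (s : ContMDiffSection (𝓡 n) F ∞ V) : ContMDiffSection (𝓡 n) F' ∞ V' :=
  ⟨fun p => τ p (s p), fun p => ContMDiffAt.clm_bundle_apply (b := fun p => p) (τ.contMDiff p)
    (s.contMDiff p)⟩

theorem triv_applySec {x p : M} (hp : p ∈ (trivializationAt F V x).baseSet)
    (hp' : p ∈ (trivializationAt F' V' x).baseSet)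
    (τ : ContMDiffSection (𝓡 n) (F →L[ℝ] F') ∞ (fun x => V x →L[ℝ] V' x))
    (s : ContMDiffSection (𝓡 n) F ∞ V) :
    triv x (applySec τ s) p = triv x τ p (triv x s p) := by
  have h : triv x τ p = ContinuousLinearMap.inCoordinates F V F' V' x p x p (τ p) := rfl
  rw [h, ContinuousLinearMap.inCoordinates_eq hp hp']
  have h2 : triv x s p = (trivializationAt F V x).continuousLinearEquivAt ℝ p hp (s p) := rfl
  rw [h2]
  simp only [ContinuousLinearMap.comp_apply, ContinuousLinearEquiv.coe_coe,
    ContinuousLinearEquiv.symm_apply_apply]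
  rfl

theorem smoothFamily_applySec {N : ℕ}
    {τ : EuclideanSpace ℝ (Fin N) →
      ContMDiffSection (𝓡 n) (F →L[ℝ] F') ∞ (fun x => V x →L[ℝ] V' x)}
    {s : EuclideanSpace ℝ (Fin N) → ContMDiffSection (𝓡 n) F ∞ V} (hτ : SmoothFamily τ)
    (hs : SmoothFamily s) : SmoothFamily (fun a => applySec (τ a) (s a)) :=
  fun q => ContMDiffAt.clm_bundle_apply (b := fun q : EuclideanSpace ℝ (Fin N) × M => q.2)
    (hτ q) (hs q)

theorem jet_zero_applySec {x : M}
    {τ τ' : ContMDiffSection (𝓡 n) (F →L[ℝ] F') ∞ (fun x => V x →L[ℝ] V' x)}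
    {s s' : ContMDiffSection (𝓡 n) F ∞ V} (hτ : JetEq 0 x τ τ') (hs : JetEq 0 x s s') :
    JetEq 0 x (applySec τ s) (applySec τ' s') := by
  rw [jetEq_zero_order_iff] at *
  change τ x (s x) = τ' x (s' x)
  rw [hτ, hs]

theorem orderZero_applySec
    (τ : ContMDiffSection (𝓡 n) (F →L[ℝ] F') ∞ (fun x => V x →L[ℝ] V' x)) :
    OrderZero (applySec (F := F) (V := V) τ) where
  linear := ⟨fun _ _ => ContMDiffSection.ext fun p => (τ p).map_add _ _,
    fun _ _ => ContMDiffSection.ext fun p => (τ p).map_smul _ _⟩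
  jet h := jet_zero_applySec (jet_refl _ _ _) h
  fam h := smoothFamily_applySec (fam_const _ _) h

theorem localRep_applySec_secOf (x : M) (l : F →L[ℝ] F') (s : ContMDiffSection (𝓡 n) F ∞ V) :
    localRep x (applySec (V := V) (V' := V')
      (secOf x ⟨fun _ => l, (contDiff_const : ContDiff ℝ ∞ fun _ => l)⟩) s)
      =ᶠ[𝓝 (extChartAt (𝓡 n) x x)] fun y => l (localRep x s y) := by
  filter_upwards [localRep_secOf_eventually (V := fun x => V x →L[ℝ] V' x)
      (Metric.mem_ball_self (cutoff n (F →L[ℝ] F') (fun x => V x →L[ℝ] V' x) x).rIn_pos)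
      ⟨fun _ => l, (contDiff_const : ContDiff ℝ ∞ fun _ => l)⟩,
    eventually_mem_localDomain (mem_localDomain F V x),
    eventually_mem_localDomain (mem_localDomain F' V' x)] with y hy hd hd'
  rw [localRep_eq_triv, triv_applySec hd.2 hd'.2, ← localRep_eq_triv, hy, ← localRep_eq_triv]

theorem derivZero_of_forall_dual {E : Type*} [NormedAddCommGroup E] [NormedSpace ℝ E] {k : ℕ}
    {f : E → F} {y : E} (hf : ContDiffAt ℝ ∞ f y)
    (h : ∀ l : F →L[ℝ] ℝ, DerivZero k (fun z => l (f z)) y) : DerivZero k f y := by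
  intro j hj
  ext m
  refine eq_iff_forall_dual.2 fun l => ?_
  have h1 := h l j hj
  rw [show (fun z => l (f z)) = l ∘ f from rfl,
    l.iteratedFDeriv_comp_left hf (natCast_le_infty j)] at h1
  simpa using congrArg (fun a => a m) h1

variable [SigmaCompactSpace M]

instance instSectionModelSection : SectionModel n (ContMDiffSection (𝓡 n) F ∞ V) where
  preservesFlat_fun _ hl hS _ _ h k := flat_of_flat_section hl hS h k
  exists_components x := by
    refine ⟨{g | ∃ l : F →L[ℝ] ℝ, g = applySec (V' := Bundle.Trivial M ℝ)
      (secOf x ⟨fun _ => l, (contDiff_const : ContDiff ℝ ∞ fun _ => l)⟩)}, ?_, fun k s h => ?_⟩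
    · rintro _ ⟨l, rfl⟩
      exact orderZero_applySec _
    · refine jetEq_zero_iff_derivZero.2 (derivZero_of_forall_dual
        (contDiffAt_localRep (mem_localDomain F V x) s) fun l => ?_)
      exact (jetEq_zero_iff_derivZero.1 (h _ ⟨l, rfl⟩)).congr
        (localRep_applySec_secOf x l s).symm
  exists_cutoff_section c K hK hKc s := by
    have hlc : LocallyCompactSpace M := ChartedSpace.locallyCompactSpace (EuclideanSpace ℝ (Fin n)) M
    obtain ⟨L, hL, hKL, hLc⟩ := exists_compact_between hK c.1.open_source hKc
    obtain ⟨χ, h1, h2, -⟩ := exists_contMDiffMap_one_nhds_of_subset_interior (𝓡 n) (n := (⊤ : ℕ∞))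
      hK.isClosed hKL
    have hs' : ∀ y ∉ L, JetEq 0 y (⟨fun p => χ p • s p, χ.contMDiff.smul_section s.contMDiff⟩ :
        ContMDiffSection (𝓡 n) F ∞ V) 0 := fun y hy => by
      rw [jetEq_zero_order_iff]
      change χ y • s y = 0
      rw [h2 y hy, zero_smul]
    have hsupp := secSupport_subset hL.isClosed hs'
    refine ⟨_, ?_, hL.of_isClosed_subset isClosed_closure hsupp, hsupp.trans hLc⟩
    filter_upwards [h1] with y hy
    rw [jetEq_zero_order_iff]
    change χ y • s y = s y
    rw [hy, one_smul]
  fundamental K D hK hDl hD x hflat hint φ := by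
    refine apply_eq_zero_of_chartIntegral_eq hK.linear (fun _ _ _ => hK.jet) hDl hD x hflat
      (fun φ h h' => ?_) φ
    have hc : CompactIn (chartAt (EuclideanSpace ℝ (Fin n)) x).source φ := ⟨h, h'⟩
    exact (null_sub_iff (c := achart (EuclideanSpace ℝ (Fin n)) x)
      (hc.apply hK.isDiffOp hK.linear.map_zero) (hc.apply hD hDl.map_zero)).1 (hint φ hc)

end Hom

/-! ### Dualities and uniqueness of adjoint operators -/

/-- The pairing `pr` has smooth values, is nondegenerate, and is of order zero in each
argument. -/
structure Duality {n : ℕ} {M : Type*} [TopologicalSpace M]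
    [ChartedSpace (EuclideanSpace ℝ (Fin n)) M] [IsManifold (𝓡 n) ∞ M] {S' S : Type*}
    [SectionSpace M S'] [AddCommGroup S'] [Module ℝ S'] [SectionSpace M S] [AddCommGroup S]
    [Module ℝ S] (pr : Pairing n M S' S) where
  /-- the pairing as a smooth top-degree form -/
  sec : S' → S → TopSection n M
  sec_apply : ∀ η s, (fun x => sec η s x) = pr η s
  left : ∀ s, OrderZero (fun η => sec η s)
  right : ∀ η, OrderZero (sec η)
  isDiffOp : IsDiffOp (fun z : S' × S => sec z.1 z.2)
  nondeg_left : ∀ η x, (∀ s, sec η s x = 0) → JetEq 0 x η 0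
  nondeg_right : ∀ s x, (∀ η, sec η s x = 0) → JetEq 0 x s 0

section Instances

variable {n : ℕ} {M : Type*} [TopologicalSpace M] [T2Space M]
  [ChartedSpace (EuclideanSpace ℝ (Fin n)) M] [IsManifold (𝓡 n) ∞ M]

variable (n) in
/-- The natural pairing of `V̂` and `V`. -/
def pairingDuality (F : Type*) [NormedAddCommGroup F] [NormedSpace ℝ F] [FiniteDimensional ℝ F]
    (V : M → Type*) [TopologicalSpace (Bundle.TotalSpace F V)] [∀ x, AddCommGroup (V x)]
    [∀ x, Module ℝ (V x)] [∀ x, TopologicalSpace (V x)] [FiberBundle F V] [VectorBundle ℝ F V]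
    [ContMDiffVectorBundle ∞ F V (𝓡 n)] : Duality (pairing n F V) where
  sec := applySec
  sec_apply _ _ := rfl
  left s := ⟨⟨fun _ _ => rfl, fun _ _ => rfl⟩, fun h => jet_zero_applySec h (jet_refl _ _ _),
    fun h => smoothFamily_applySec h (fam_const _ _)⟩
  right := orderZero_applySec
  isDiffOp := ⟨⟨0, fun _ _ _ h => jet_zero_applySec h.1 h.2⟩,
    fun _ _ h => smoothFamily_applySec h.1 h.2⟩
  nondeg_left η x h := by
    have hx := mem_baseSet_trivializationAt F V x
    have hx' := mem_baseSet_trivializationAt ℝ (TopForm n M) x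
    rw [jetEq_zero_order_iff]
    refine triv_inj (mem_baseSet_trivializationAt (F →L[ℝ] ℝ)
      (fun x => V x →L[ℝ] TopForm n M x) x) ?_
    rw [triv_zero (mem_baseSet_trivializationAt (F →L[ℝ] ℝ)
      (fun x => V x →L[ℝ] TopForm n M x) x)]
    ext v
    have h1 := triv_applySec hx hx' η (secOf x ⟨fun _ => v, (contDiff_const : ContDiff ℝ ∞ fun _ => v)⟩)
    have h2 : triv x (secOf (n := n) (V := V) x
        ⟨fun _ => v, (contDiff_const : ContDiff ℝ ∞ fun _ => v)⟩) x = v := by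
      rw [triv_eq_localRep (mem_extChartAt_source x), (localRep_secOf_eventually
        (Metric.mem_ball_self (cutoff n F V x).rIn_pos) _).eq_of_nhds]
    rw [h2, triv_congr (s' := (0 : TopSection n M)) (h _), triv_zero hx'] at h1
    exact h1.symm
  nondeg_right s x h := by
    have hx := mem_baseSet_trivializationAt F V x
    have hx' := mem_baseSet_trivializationAt ℝ (TopForm n M) x
    rw [jetEq_zero_order_iff]
    refine triv_inj hx (eq_iff_forall_dual.2 fun l => ?_)
    have h1 := (localRep_applySec_secOf (V' := TopForm n M) x l s).eq_of_nhds
    rw [← triv_eq_localRep (mem_extChartAt_source x), ← triv_eq_localRep (mem_extChartAt_source x),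
      triv_congr (s' := (0 : TopSection n M)) (h _), triv_zero hx'] at h1
    rw [triv_zero hx, map_zero, ← h1]

variable {S' S T' T : Type*} [SectionSpace M S'] [AddCommGroup S'] [Module ℝ S']
  [SectionSpace M S] [AddCommGroup S] [Module ℝ S] [SectionSpace M T'] [AddCommGroup T']
  [Module ℝ T'] [SectionSpace M T] [AddCommGroup T] [Module ℝ T]
  [JetModel S'] [JetModel S] [JetModel T'] [JetModel T]

/-- The exchange of the roles of the two spaces. -/
def Duality.swap {pr : Pairing n M S' S} (d : Duality pr) : Duality pr.swap where
  sec s η := d.sec η s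
  sec_apply s η := d.sec_apply η s
  left := d.right
  right := d.left
  isDiffOp := d.isDiffOp.comp_jetMap (g := fun z : S × S' => (z.2, z.1)) (by fun_prop)
  nondeg_left := d.nondeg_right
  nondeg_right := d.nondeg_left

theorem Duality.add_left {pr : Pairing n M S' S} (d : Duality pr) (η η' : S') (s : S) :
    d.sec (η + η') s = d.sec η s + d.sec η' s := (d.left s).linear.map_add _ _

theorem Duality.add_right {pr : Pairing n M S' S} (d : Duality pr) (η : S') (s s' : S) :
    d.sec η (s + s') = d.sec η s + d.sec η s' := (d.right η).linear.map_add _ _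

theorem Duality.zero_left {pr : Pairing n M S' S} (d : Duality pr) (s : S) :
    d.sec 0 s = 0 := (d.left s).linear.map_zero

theorem Duality.zero_right {pr : Pairing n M S' S} (d : Duality pr) (η : S') :
    d.sec η 0 = 0 := (d.right η).linear.map_zero

theorem Duality.neg_left {pr : Pairing n M S' S} (d : Duality pr) (η : S') (s : S) :
    d.sec (-η) s = -d.sec η s := (d.left s).linear.map_neg _

theorem Duality.neg_right {pr : Pairing n M S' S} (d : Duality pr) (η : S') (s : S) :
    d.sec η (-s) = -d.sec η s := (d.right η).linear.map_neg _

theorem Duality.sub_left {pr : Pairing n M S' S} (d : Duality pr) (η η' : S') (s : S) :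
    d.sec (η - η') s = d.sec η s - d.sec η' s := (d.left s).linear.map_sub _ _

theorem Duality.sub_right {pr : Pairing n M S' S} (d : Duality pr) (η : S') (s s' : S) :
    d.sec η (s - s') = d.sec η s - d.sec η s' := (d.right η).linear.map_sub _ _

/-- The pairing of direct sums. -/
def Duality.sum {pr : Pairing n M S' S} {pr' : Pairing n M T' T} (d : Duality pr)
    (d' : Duality pr') : Duality (pr.sum pr') where
  sec η s := d.sec η.1 s.1 + d'.sec η.2 s.2
  sec_apply η s := by
    funext x
    change d.sec η.1 s.1 x + d'.sec η.2 s.2 x = pr η.1 s.1 x + pr' η.2 s.2 x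
    rw [← d.sec_apply, ← d'.sec_apply]
  left s := ⟨⟨fun a b => by simp only [Prod.fst_add, Prod.snd_add, Duality.add_left]; abel,
      fun r a => by
        simp only [Prod.smul_fst, Prod.smul_snd, (d.left s.1).linear.map_smul,
          (d'.left s.2).linear.map_smul, smul_add]⟩,
    fun h => jet_add_add ((d.left s.1).jet h.1) ((d'.left s.2).jet h.2),
    fun h => fam_add ((d.left s.1).fam h.1) ((d'.left s.2).fam h.2)⟩
  right η := ⟨⟨fun a b => by simp only [Prod.fst_add, Prod.snd_add, Duality.add_right]; abel,
      fun r a => by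
        simp only [Prod.smul_fst, Prod.smul_snd, (d.right η.1).linear.map_smul,
          (d'.right η.2).linear.map_smul, smul_add]⟩,
    fun h => jet_add_add ((d.right η.1).jet h.1) ((d'.right η.2).jet h.2),
    fun h => fam_add ((d.right η.1).fam h.1) ((d'.right η.2).fam h.2)⟩
  isDiffOp := (d.isDiffOp.comp_jetMap
      (g := fun z : (S' × T') × S × T => (z.1.1, z.2.1)) (by fun_prop)).add
    (d'.isDiffOp.comp_jetMap (g := fun z : (S' × T') × S × T => (z.1.2, z.2.2)) (by fun_prop))
  nondeg_left η x h := ⟨d.nondeg_left η.1 x fun s => by simpa [d'.zero_right] using h (s, 0),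
    d'.nondeg_left η.2 x fun s => by simpa [d.zero_right] using h (0, s)⟩
  nondeg_right s x h := ⟨d.nondeg_right s.1 x fun η => by simpa [d'.zero_left] using h (η, 0),
    d'.nondeg_right s.2 x fun η => by simpa [d.zero_left] using h (0, η)⟩

end Instances

section Adjoints

variable {n : ℕ} {M : Type*} [TopologicalSpace M] [T2Space M]
  [ChartedSpace (EuclideanSpace ℝ (Fin n)) M] [IsManifold (𝓡 n) ∞ M]
  {U P Q P' Q' S T : Type*}
  [SectionSpace M U] [AddCommGroup U] [Module ℝ U] [JetModel U] [SectionModel n U]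
  [SectionSpace M P] [AddCommGroup P] [Module ℝ P] [JetModel P] [SectionModel n P]
  [SectionSpace M Q] [AddCommGroup Q] [Module ℝ Q] [JetModel Q] [SectionModel n Q]
  [SectionSpace M P'] [AddCommGroup P'] [Module ℝ P'] [JetModel P'] [SectionModel n P']
  [SectionSpace M Q'] [AddCommGroup Q'] [Module ℝ Q'] [JetModel Q'] [SectionModel n Q']
  [SectionSpace M S] [AddCommGroup S] [Module ℝ S] [JetModel S] [SectionModel n S]
  [SectionSpace M T] [AddCommGroup T] [Module ℝ T] [JetModel T] [SectionModel n T]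
  {prP : Pairing n M P' P} {prQ : Pairing n M Q' Q} (dP : Duality prP) (dQ : Duality prQ)
  {c : atlas (EuclideanSpace ℝ (Fin n)) M}

/-- If a form-valued operator of two arguments integrates to zero whenever the first argument has
compact support, it does so whenever the second argument has: cut off the first one. -/
theorem null_of_forall_null {f : S × T → TopSection n M} (hf : IsDiffOp f)
    (h0 : ∀ a, f (a, 0) = 0) {b : T} (hb : CompactIn c.1.source b)
    (h : ∀ a, CompactIn c.1.source a → Null c (f (a, b))) (a : S) : Null c (f (a, b)) := by
  obtain ⟨a', h1, h2⟩ := SectionModel.exists_cutoff_section c (secSupport b) hb.1 hb.2 a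
  have h3 : f (a, b) = f (a', b) := by
    refine ext_jet fun x => ?_
    by_cases hx : x ∈ secSupport b
    · refine hf.local ?_
      have h4 : ∀ᶠ y in 𝓝 x, JetEq 0 y a' a := (eventually_nhdsSet_iff_forall.1 h1) x hx
      exact h4.mono fun y hy => ⟨jet_symm hy, jet_refl _ _ _⟩
    · have h4 : ∀ a, JetEq 0 x (f (a, b)) 0 := fun a => by
        rw [← h0 a]
        exact hf.local ((eventually_jet_zero hx).mono fun y hy => ⟨jet_refl _ _ _, hy⟩)
      exact jet_trans (h4 a) (jet_symm (h4 a'))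
  rw [h3]
  exact h a' h2

include dP dQ in
theorem IsAdjoint.null {T : P → Q} {T' : Q' → P'} (h : IsAdjoint prP prQ T T') (hT : IsDiffOp T)
    (hT0 : T 0 = 0) {p : P} (hp : CompactIn c.1.source p) (q : Q') :
    Null c (dQ.sec q (T p) - dP.sec (T' q) p) := by
  refine (null_sub_iff ((hp.apply hT hT0).apply (dQ.right q).isDiffOp (dQ.zero_right q))
    (hp.apply (dP.right _).isDiffOp (dP.zero_right _))).2 ?_
  rw [dQ.sec_apply, dP.sec_apply]
  exact h c p q hp.1 hp.2

theorem isAdjoint_of_null {T : P → Q} {T' : Q' → P'} (hT : IsDiffOp T) (hT0 : T 0 = 0)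
    (h : ∀ (c : atlas (EuclideanSpace ℝ (Fin n)) M) (p : P) (q : Q'), CompactIn c.1.source p →
      Null c (dQ.sec q (T p) - dP.sec (T' q) p)) : IsAdjoint prP prQ T T' := by
  intro c p q h1 h2
  have hp : CompactIn c.1.source p := ⟨h1, h2⟩
  rw [← dQ.sec_apply, ← dP.sec_apply]
  exact (null_sub_iff ((hp.apply hT hT0).apply (dQ.right q).isDiffOp (dQ.zero_right q))
    (hp.apply (dP.right _).isDiffOp (dP.zero_right _))).1 (h c p q hp)

/-- The adjointness relation holds also if the argument of the adjoint has compact support. -/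
theorem IsAdjoint.null' {T : P → Q} {T' : Q' → P'} (h : IsAdjoint prP prQ T T') (hT : IsDiffOp T)
    (hT0 : T 0 = 0) (hT' : IsDiffOp T') (hT0' : T' 0 = 0) {q : Q'} (hq : CompactIn c.1.source q)
    (p : P) : Null c (dQ.sec q (T p) - dP.sec (T' q) p) := by
  -- the pairings are operators of order zero applied to differential operators
  have h1 : IsDiffOp (fun z : P × Q' => dQ.sec z.2 (T z.1)) := by
    obtain ⟨⟨k, hk⟩, hf⟩ := hT
    refine ⟨⟨k, fun x z z' hz => ?_⟩, fun N a ha => ?_⟩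
    · exact jet_trans ((dQ.left _).jet (jet_mono (Nat.zero_le k) hz.2))
        ((dQ.right _).jet (hk x _ _ hz.1))
    · exact dQ.isDiffOp.2 N (fun b => ((a b).2, T (a b).1)) ⟨ha.2, hf N _ ha.1⟩
  have h2 : IsDiffOp (fun z : P × Q' => dP.sec (T' z.2) z.1) := by
    obtain ⟨⟨k, hk⟩, hf⟩ := hT'
    refine ⟨⟨k, fun x z z' hz => ?_⟩, fun N a ha => ?_⟩
    · exact jet_trans ((dP.left _).jet (hk x _ _ hz.2))
        ((dP.right _).jet (jet_mono (Nat.zero_le k) hz.1))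
    · exact dP.isDiffOp.2 N (fun b => (T' (a b).2, (a b).1)) ⟨hf N _ ha.2, ha.1⟩
  exact null_of_forall_null (f := fun z : P × Q' => dQ.sec z.2 (T z.1) - dP.sec (T' z.2) z.1)
    (h1.sub h2) (fun a => by simp only [hT0', dQ.zero_left, dP.zero_left, sub_zero]) hq
    (fun p hp => h.null dP dQ hT hT0 hp q) p

theorem Duality.eq_zero_of_null {s : P}
    (h : ∀ (c : atlas (EuclideanSpace ℝ (Fin n)) M) (η : P'), CompactIn c.1.source η →
      Null c (dP.sec η s)) : s = 0 := by
  refine ext_jet fun x => dP.nondeg_right s x fun η => ?_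
  refine SectionModel.fundamental (n := n) (fun η => dP.sec η s) (fun _ => 0) (dP.left s)
    ⟨fun _ _ => (add_zero _).symm, fun _ _ => (smul_zero _).symm⟩
    (JetMap.const (0 : TopSection n M)).isDiffOp x (fun _ k => jet_refl k x _) (fun η hη => ?_) η
  rw [sub_zero]
  exact h _ η hη

include dP dQ in
/-- Adjoint operators are unique. -/
theorem IsAdjoint.unique {T : P → Q} {T₁ T₂ : Q' → P'} (h₁ : IsAdjoint prP prQ T T₁)
    (h₂ : IsAdjoint prP prQ T T₂) (hT : IsDiffOp T) (hT0 : T 0 = 0) (q : Q') : T₁ q = T₂ q := by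
  rw [← sub_eq_zero]
  refine dP.swap.eq_zero_of_null fun c p hp => ?_
  have h3 := (h₂.null dP dQ hT hT0 hp q).sub (h₁.null dP dQ hT hT0 hp q)
  rw [sub_sub_sub_cancel_left] at h3
  change Null c (dP.sec (T₁ q - T₂ q) p)
  rwa [dP.sub_left]

theorem lin_orderZero_comp {g : P → Q} (hg : OrderZero g) {D : U → P} (hD : IsDiffOp D)
    (u φ : U) : lin (fun v => g (D v)) u φ = g (lin D u φ) := by
  rw [hg.isDiffOp.lin_comp hD, lin_eq_of_linear hg.linear]

variable {Δ : U → P → Q} {Δ' : U → Q' → P'}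

include dP dQ in
/-- The derivatives of adjoint operators along the fibres are adjoint. -/
theorem IsFormalAdjoint.null_linOp (h : IsFormalAdjoint prP prQ Δ Δ') (hΔ : IsCDiffOp Δ) (u φ : U)
    {p : P} (hp : CompactIn c.1.source p) (q : Q') :
    Null c (dQ.sec q (linOp Δ p u φ) - dP.sec (linOp Δ' q u φ) p) := by
  have h1 : IsDiffOp (fun v => dQ.sec q (Δ v p)) :=
    (dQ.right q).comp_isDiffOp (hΔ.isDiffOp_coeff p)
  have h2 : IsDiffOp (fun v => dP.sec (Δ' v q) p) :=
    (dP.left p).comp_isDiffOp (h.1.isDiffOp_coeff q)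
  have h3 := (h1.sub h2).hasVelocity_lin u φ
  rw [h1.lin_sub h2, lin_orderZero_comp (dQ.right q) (hΔ.isDiffOp_coeff p),
    lin_orderZero_comp (dP.left p) (h.1.isDiffOp_coeff q)] at h3
  refine Null.of_hasVelocity ((h1.sub h2).smFam (smFam_line u φ)) h3 hp.1 hp.2 (fun t => ?_)
    fun t => (h.2 _).null dP dQ (hΔ.isDiffOp_apply _) (hΔ.1 _).map_zero hp q
  have h4 : IsDiffOp (fun p => dQ.sec q (Δ (u + t • φ) p) - dP.sec (Δ' (u + t • φ) q) p) :=
    ((dQ.right q).comp_isDiffOp (hΔ.isDiffOp_apply _)).sub (dP.right _).isDiffOp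
  exact h4.secSupport_subset (by
    rw [(hΔ.1 _).map_zero, dQ.zero_right, dP.zero_right, sub_zero]) p

theorem IsCDiffOp.isDiffOp_linOp_arg_dir (hΔ : IsCDiffOp Δ) (u : U) :
    IsDiffOp (fun z : P × U => linOp Δ z.1 u z.2) :=
  hΔ.isDiffOp_linOp.comp_jetMap (g := fun z : P × U => (u, z.1, z.2)) (by fun_prop)

/-- The derivatives of adjoint operators along the fibres are adjoint also if only the direction of
the derivative has compact support. -/
theorem IsFormalAdjoint.null_linOp_dir (h : IsFormalAdjoint prP prQ Δ Δ') (hΔ : IsCDiffOp Δ)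
    (u : U) {φ : U} (hφ : CompactIn c.1.source φ) (p : P) (q : Q') :
    Null c (dQ.sec q (linOp Δ p u φ) - dP.sec (linOp Δ' q u φ) p) := by
  have h1 : IsDiffOp (fun z : P × U => dQ.sec q (linOp Δ z.1 u z.2)) :=
    (dQ.right q).comp_isDiffOp (hΔ.isDiffOp_linOp_arg_dir u)
  have h2 : IsDiffOp (fun z : P × U => dP.sec (linOp Δ' q u z.2) z.1) := by
    obtain ⟨⟨k, hk⟩, hf⟩ := (h.1.isDiffOp_coeff q).isDiffOp_lin
    refine ⟨⟨k, fun x z z' hz => ?_⟩, fun N a ha => ?_⟩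
    · exact jet_trans ((dP.left _).jet (hk x (u, z.2) (u, z'.2) ⟨jet_refl _ _ _, hz.2⟩))
        ((dP.right _).jet (jet_mono (Nat.zero_le k) hz.1))
    · exact dP.isDiffOp.2 N (fun b => (linOp Δ' q u (a b).2, (a b).1))
        ⟨hf N (fun b => (u, (a b).2)) ⟨fam_const N u, ha.2⟩, ha.1⟩
  exact null_of_forall_null (f := fun z : P × U => dQ.sec q (linOp Δ z.1 u z.2) -
      dP.sec (linOp Δ' q u z.2) z.1) (h1.sub h2)
    (fun a => by rw [(hΔ.linear_linOp_dir a u).map_zero, (h.1.linear_linOp_dir q u).map_zero,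
      dQ.zero_right, dP.zero_left, sub_zero]) hφ
    (fun p hp => h.null_linOp dP dQ hΔ u φ hp q) p

end Adjoints

/-! ### The identity expressing that a Schouten bracket vanishes -/

section Operators

variable {M : Type*} [TopologicalSpace M] {U V P Q R : Type*}
  [SectionSpace M U] [SectionSpace M V] [SectionSpace M P] [SectionSpace M Q] [SectionSpace M R]
  [AddCommGroup U] [Module ℝ U] [AddCommGroup V] [Module ℝ V] [AddCommGroup P] [Module ℝ P]
  [AddCommGroup Q] [Module ℝ Q] [AddCommGroup R] [Module ℝ R]
  [JetModel U] [JetModel V] [JetModel P] [JetModel Q] [JetModel R]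

theorem isLinearMap_add {f g : P → Q} (hf : IsLinearMap ℝ f) (hg : IsLinearMap ℝ g) :
    IsLinearMap ℝ (fun p => f p + g p) :=
  ⟨fun a b => by rw [hf.map_add, hg.map_add]; abel,
    fun r a => by rw [hf.map_smul, hg.map_smul, smul_add]⟩

theorem isLinearMap_sub {f g : P → Q} (hf : IsLinearMap ℝ f) (hg : IsLinearMap ℝ g) :
    IsLinearMap ℝ (fun p => f p - g p) :=
  ⟨fun a b => by rw [hf.map_add, hg.map_add]; abel,
    fun r a => by rw [hf.map_smul, hg.map_smul, smul_sub]⟩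

theorem isLinearMap_comp {f : P → Q} {g : V → P} (hf : IsLinearMap ℝ f) (hg : IsLinearMap ℝ g) :
    IsLinearMap ℝ (fun p => f (g p)) :=
  ⟨fun a b => by rw [hg.map_add, hf.map_add], fun r a => by rw [hg.map_smul, hf.map_smul]⟩

theorem isLinearMap_prodMk {f : P → Q} {g : P → V} (hf : IsLinearMap ℝ f) (hg : IsLinearMap ℝ g) :
    IsLinearMap ℝ (fun p => (f p, g p)) :=
  ⟨fun a b => by rw [hf.map_add, hg.map_add]; rfl,
    fun r a => by rw [hf.map_smul, hg.map_smul]; rfl⟩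

theorem isLinearMap_fst : IsLinearMap ℝ (fun z : P × Q => z.1) := ⟨fun _ _ => rfl, fun _ _ => rfl⟩

theorem isLinearMap_snd : IsLinearMap ℝ (fun z : P × Q => z.2) := ⟨fun _ _ => rfl, fun _ _ => rfl⟩

theorem IsCDiffOp.add {Δ Δ' : U → P → Q} (h : IsCDiffOp Δ) (h' : IsCDiffOp Δ') :
    IsCDiffOp (fun u p => Δ u p + Δ' u p) :=
  ⟨fun u => isLinearMap_add (h.1 u) (h'.1 u), h.2.add h'.2⟩

theorem IsCDiffOp.sub {Δ Δ' : U → P → Q} (h : IsCDiffOp Δ) (h' : IsCDiffOp Δ') :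
    IsCDiffOp (fun u p => Δ u p - Δ' u p) :=
  ⟨fun u => isLinearMap_sub (h.1 u) (h'.1 u), h.2.sub h'.2⟩

theorem IsCDiffOp.prodMk {Δ : U → P → Q} {Δ' : U → P → R} (h : IsCDiffOp Δ) (h' : IsCDiffOp Δ') :
    IsCDiffOp (fun u p => (Δ u p, Δ' u p)) :=
  ⟨fun u => isLinearMap_prodMk (h.1 u) (h'.1 u), h.2.prodMk h'.2⟩

/-- Composition with operators of order zero that preserve jets. -/
theorem IsCDiffOp.comp_jetMap {Δ : U → P → Q} (h : IsCDiffOp Δ) {g : V → U} (hg : JetMap g)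
    {f : R → P} (hf : JetMap f) (hf' : IsLinearMap ℝ f) : IsCDiffOp (fun v r => Δ (g v) (f r)) :=
  ⟨fun v => isLinearMap_comp (h.1 (g v)) hf', h.2.comp_jetMap
    (g := fun z : V × R => (g z.1, f z.2)) (by fun_prop)⟩

theorem IsCBiDiffOp.isCDiffOp_left {B : U → P → Q → R} (h : IsCBiDiffOp B) (q : Q) :
    IsCDiffOp (fun u p => B u p q) :=
  ⟨fun u => h.1 u q, h.2.2.comp_jetMap (g := fun z : U × P => (z.1, z.2, q)) (by fun_prop)⟩

theorem IsCBiDiffOp.add {B B' : U → P → Q → R} (h : IsCBiDiffOp B) (h' : IsCBiDiffOp B') :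
    IsCBiDiffOp (fun u p q => B u p q + B' u p q) :=
  ⟨fun u q => isLinearMap_add (h.1 u q) (h'.1 u q),
    fun u p => isLinearMap_add (h.2.1 u p) (h'.2.1 u p), h.2.2.add h'.2.2⟩

theorem hasVelocity_sub {c c' : ℝ → P} {v v' : P} (h : HasVelocity c v) (h' : HasVelocity c' v') :
    HasVelocity (fun t => c t - c' t) (v - v') :=
  hasVelocity_iff.2 fun x l hl => by
    simpa only [map_sub] using (hasVelocity_iff.1 h x l hl).fun_sub (hasVelocity_iff.1 h' x l hl)

/-- The derivative of `Δ(E)` along a line. -/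
theorem IsCDiffOp.hasVelocity_apply {Δ : U → P → Q} (h : IsCDiffOp Δ) {E : U → P}
    (hE : IsDiffOp E) (u φ : U) : HasVelocity (fun t : ℝ => Δ (u + t • φ) (E (u + t • φ)))
      (linOp Δ (E u) u φ + Δ u (lin E u φ)) := by
  have hu : HasVelocity (fun t : ℝ => u + t • φ) φ := by
    have h0 := (JetMap.id (U := U)).isDiffOp.hasVelocity_lin u φ
    rwa [lin_eq_of_linear (D := fun v : U => v) ⟨fun _ _ => rfl, fun _ _ => rfl⟩] at h0
  have h1 := h.2.hasVelocity_comp (c := fun t : ℝ => (u + t • φ, E (u + t • φ)))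
    ((smFam_line u φ).prodMk (hE.smFam (smFam_line u φ))) (v := (φ, lin E u φ))
    ⟨hu, hE.hasVelocity_lin u φ⟩
  have h2 : lin (fun z : U × P => Δ z.1 z.2) (u + (0 : ℝ) • φ, E (u + (0 : ℝ) • φ)) (φ, lin E u φ) =
      linOp Δ (E u) u φ + Δ u (lin E u φ) := by
    rw [zero_smul, add_zero, h.2.lin_prod, lin_eq_of_linear (h.1 u)]; rfl
  rw [← h2]
  exact h1

theorem lin_left_dir {D : U × V → P} (u φ : U) (v : V) :
    lin D (u, v) (φ, 0) = lin (fun u' => D (u', v)) u φ := by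
  simp [lin]

theorem lin_right_dir {D : U × V → P} (u : U) (v ψ : V) :
    lin D (u, v) (0, ψ) = lin (fun v' => D (u, v')) v ψ := by
  simp [lin]

theorem eq_of_add_self_eq {E : Type*} [AddCommGroup E] [Module ℝ E] {a b : E}
    (h : a + a = b + b) : a = b := by
  rw [← two_smul ℝ, ← two_smul ℝ] at h
  exact smul_right_injective E (two_ne_zero (α := ℝ)) h

end Operators

section AdjointAlgebra

variable {n : ℕ} {M : Type*} [TopologicalSpace M] [T2Space M]
  [ChartedSpace (EuclideanSpace ℝ (Fin n)) M] [IsManifold (𝓡 n) ∞ M]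
  {U P Q P' Q' : Type*}
  [SectionSpace M U] [AddCommGroup U] [Module ℝ U] [JetModel U] [SectionModel n U]
  [SectionSpace M P] [AddCommGroup P] [Module ℝ P] [JetModel P] [SectionModel n P]
  [SectionSpace M Q] [AddCommGroup Q] [Module ℝ Q] [JetModel Q] [SectionModel n Q]
  [SectionSpace M P'] [AddCommGroup P'] [Module ℝ P'] [JetModel P'] [SectionModel n P']
  [SectionSpace M Q'] [AddCommGroup Q'] [Module ℝ Q'] [JetModel Q'] [SectionModel n Q']
  {prP : Pairing n M P' P} {prQ : Pairing n M Q' Q} (dP : Duality prP) (dQ : Duality prQ)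

include dP dQ

theorem IsAdjoint.add {T₁ T₂ : P → Q} {T₁' T₂' : Q' → P'} (h₁ : IsAdjoint prP prQ T₁ T₁')
    (h₂ : IsAdjoint prP prQ T₂ T₂') (hT₁ : IsDiffOp T₁) (hT₂ : IsDiffOp T₂) (h0₁ : T₁ 0 = 0)
    (h0₂ : T₂ 0 = 0) : IsAdjoint prP prQ (fun p => T₁ p + T₂ p) (fun q => T₁' q + T₂' q) := by
  refine isAdjoint_of_null dP dQ (hT₁.add hT₂) (by rw [h0₁, h0₂, add_zero]) fun c p q hp => ?_
  convert (h₁.null dP dQ hT₁ h0₁ hp q).add (h₂.null dP dQ hT₂ h0₂ hp q) using 1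
  rw [dQ.add_right, dP.add_left]
  abel

theorem IsAdjoint.sub {T₁ T₂ : P → Q} {T₁' T₂' : Q' → P'} (h₁ : IsAdjoint prP prQ T₁ T₁')
    (h₂ : IsAdjoint prP prQ T₂ T₂') (hT₁ : IsDiffOp T₁) (hT₂ : IsDiffOp T₂) (h0₁ : T₁ 0 = 0)
    (h0₂ : T₂ 0 = 0) : IsAdjoint prP prQ (fun p => T₁ p - T₂ p) (fun q => T₁' q - T₂' q) := by
  refine isAdjoint_of_null dP dQ (hT₁.sub hT₂) (by rw [h0₁, h0₂, sub_zero]) fun c p q hp => ?_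
  convert (h₁.null dP dQ hT₁ h0₁ hp q).sub (h₂.null dP dQ hT₂ h0₂ hp q) using 1
  rw [dQ.sub_right, dP.sub_left]
  abel

theorem IsFormalAdjoint.add {Δ₁ Δ₂ : U → P → Q} {Δ₁' Δ₂' : U → Q' → P'}
    (h₁ : IsFormalAdjoint prP prQ Δ₁ Δ₁') (h₂ : IsFormalAdjoint prP prQ Δ₂ Δ₂')
    (hΔ₁ : IsCDiffOp Δ₁) (hΔ₂ : IsCDiffOp Δ₂) :
    IsFormalAdjoint prP prQ (fun u p => Δ₁ u p + Δ₂ u p) (fun u q => Δ₁' u q + Δ₂' u q) :=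
  ⟨h₁.1.add h₂.1, fun u => (h₁.2 u).add dP dQ (h₂.2 u) (hΔ₁.isDiffOp_apply u)
    (hΔ₂.isDiffOp_apply u) (hΔ₁.1 u).map_zero (hΔ₂.1 u).map_zero⟩

end AdjointAlgebra

section Identities

variable {n : ℕ} {M : Type*} [TopologicalSpace M] [T2Space M]
  [ChartedSpace (EuclideanSpace ℝ (Fin n)) M] [IsManifold (𝓡 n) ∞ M]
  {U U' P P' : Type*}
  [SectionSpace M U] [AddCommGroup U] [Module ℝ U] [JetModel U] [SectionModel n U]
  [SectionSpace M U'] [AddCommGroup U'] [Module ℝ U'] [JetModel U'] [SectionModel n U']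
  [SectionSpace M P] [AddCommGroup P] [Module ℝ P] [JetModel P] [SectionModel n P]
  [SectionSpace M P'] [AddCommGroup P'] [Module ℝ P'] [JetModel P'] [SectionModel n P']
  {prU : Pairing n M U' U} {prP : Pairing n M P' P} (dU : Duality prU) (dP : Duality prP)

include dU dP in
/-- The vanishing of the Schouten bracket of `A₁` and `A₂`, rewritten by passing to the adjoint in
its first argument.  Here `mᵢ` is the adjoint of the linearization of `Aᵢ^*(w)`. -/
theorem bivector_identity_of_schouten_eq_zero {A₁ A₂ : U → P' → U} {A₁' A₂' : U → U' → P}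
    {B₁ B₂ : U → P → P' → P} {B₁' B₂' : U → P' → P' → P'} {m₁ m₂ : P' → U'} {u : U} {w : U'}
    (hA₁ : IsCDiffOp A₁) (hA₂ : IsCDiffOp A₂)
    (hA₁' : IsFormalAdjoint prP.swap prU A₁ A₁') (hA₂' : IsFormalAdjoint prP.swap prU A₂ A₂')
    (hB₁ : IsCBiDiffOp B₁) (hB₂ : IsCBiDiffOp B₂) (hB₁' : IsCBiDiffOp B₁') (hB₂' : IsCBiDiffOp B₂')
    (hBB₁ : ∀ u ψ, IsAdjoint prP prP (fun p => B₁ u p ψ) (fun q => B₁' u q ψ))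
    (hBB₂ : ∀ u ψ, IsAdjoint prP prP (fun p => B₂ u p ψ) (fun q => B₂' u q ψ))
    (hm₁ : IsAdjoint prU prP (linOp A₁' w u) m₁) (hm₂ : IsAdjoint prU prP (linOp A₂' w u) m₂)
    {ψ : P'} (h : ∀ ψ₁, schouten A₁ A₂ B₁' B₂' u ψ₁ ψ = 0) :
    (linOp A₁' w u (A₂ u ψ) - A₂' u (m₁ ψ)) + (linOp A₂' w u (A₁ u ψ) - A₁' u (m₂ ψ)) =
      B₂ u (A₁' u w) ψ + B₁ u (A₂' u w) ψ := by
  rw [← sub_eq_zero]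
  refine dP.eq_zero_of_null fun c ψ₁ hψ₁ => ?_
  -- the two halves of the identity differ by exchanging the indices; each is obtained by moving the
  -- operators from `ψ₁` to `w` under the integral
  have half : ∀ {A₁ A₂ : U → P' → U} {A₁' A₂' : U → U' → P} {B₂ : U → P → P' → P}
      {B₂' : U → P' → P' → P'} {m₁ : P' → U'}, IsCDiffOp A₁ → IsCDiffOp A₂ →
      IsFormalAdjoint prP.swap prU A₁ A₁' → IsFormalAdjoint prP.swap prU A₂ A₂' →
      IsCBiDiffOp B₂ → IsCBiDiffOp B₂' →
      IsAdjoint prP prP (fun p => B₂ u p ψ) (fun q => B₂' u q ψ) →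
      IsAdjoint prU prP (linOp A₁' w u) m₁ →
      Null c (dP.sec ψ₁ (linOp A₁' w u (A₂ u ψ) - A₂' u (m₁ ψ) - B₂ u (A₁' u w) ψ) -
        dU.sec w (linOp A₁ ψ₁ u (A₂ u ψ) - linOp A₁ ψ u (A₂ u ψ₁) - A₁ u (B₂' u ψ₁ ψ))) := by
    intro A₁ A₂ A₁' A₂' B₂ B₂' m₁ hA₁ hA₂ hA₁' hA₂' hB₂ hB₂' hBB₂ hm₁
    have hlin := (hA₁'.1.isDiffOp_coeff w).isLinearMap_lin u
    have hA₂ψ : CompactIn c.1.source (A₂ u ψ₁) :=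
      hψ₁.apply (hA₂.isDiffOp_apply u) (hA₂.1 u).map_zero
    have hB₂ψ : CompactIn c.1.source (B₂' u ψ₁ ψ) :=
      hψ₁.apply ((hB₂'.isCDiffOp_left ψ).isDiffOp_apply u) ((hB₂'.isCDiffOp_left ψ).1 u).map_zero
    have n1 := hA₁'.null_linOp dP.swap dU hA₁ u (A₂ u ψ) hψ₁ w
    have n2 := (hA₂'.2 u).null dP.swap dU (hA₂.isDiffOp_apply u) (hA₂.1 u).map_zero hψ₁ (m₁ ψ)
    have n3 := hm₁.null dU dP ((hA₁'.1.isDiffOp_linOp_arg_dir u).comp_jetMap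
      (g := fun φ => (w, φ)) (by fun_prop)) hlin.map_zero hA₂ψ ψ
    have n4 := hA₁'.null_linOp_dir dP.swap dU hA₁ u hA₂ψ ψ w
    have n5 := hBB₂.null' dP dP ((hB₂.isCDiffOp_left ψ).isDiffOp_apply u)
      ((hB₂.isCDiffOp_left ψ).1 u).map_zero ((hB₂'.isCDiffOp_left ψ).isDiffOp_apply u)
      ((hB₂'.isCDiffOp_left ψ).1 u).map_zero hψ₁ (A₁' u w)
    have n6 := (hA₁'.2 u).null dP.swap dU (hA₁.isDiffOp_apply u) (hA₁.1 u).map_zero hB₂ψ w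
    convert ((((n2.sub n1).add n3).add n4).sub n5).add n6 using 1
    simp only [dP.sub_right, dU.sub_right, Duality.swap]
    abel
  have h1 := half hA₁ hA₂ hA₁' hA₂' hB₂ hB₂' (hBB₂ u ψ) hm₁
  have h2 := half hA₂ hA₁ hA₂' hA₁' hB₁ hB₁' (hBB₁ u ψ) hm₂
  have h3 := h ψ₁
  have h4 : dU.sec w (schouten A₁ A₂ B₁' B₂' u ψ₁ ψ) = 0 := by rw [h3, dU.zero_right]
  convert h1.add h2 using 1
  simp only [schouten, dU.sub_right, dU.add_right] at h4
  simp only [dP.sub_right, dP.add_right, dU.sub_right]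
  rw [← sub_eq_zero, ← h4]
  abel

end Identities

/-! ### Partial linearizations -/

section PartialLinearization

variable {M : Type*} [TopologicalSpace M] {U V P : Type*}
  [SectionSpace M U] [SectionSpace M V] [SectionSpace M P]
  [AddCommGroup U] [Module ℝ U] [AddCommGroup V] [Module ℝ V] [AddCommGroup P] [Module ℝ P]
  [JetModel U] [JetModel V] [JetModel P]

/-- The linearization of `D` with respect to the first unknown. -/
def linFst (D : U × V → P) (z : U × V) (φ : U) : P := lin (fun u => D (u, z.2)) z.1 φ

theorem linFst_eq_lin (D : U × V → P) (z : U × V) (φ : U) : linFst D z φ = lin D z (φ, 0) :=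
  (lin_left_dir z.1 φ z.2).symm

theorem IsDiffOp.comp_fst {D : U × V → P} (hD : IsDiffOp D) (v : V) :
    IsDiffOp (fun u => D (u, v)) :=
  hD.comp_jetMap (g := fun u => (u, v)) (by fun_prop)

theorem IsDiffOp.isCDiffOp_linFst {D : U × V → P} (hD : IsDiffOp D) : IsCDiffOp (linFst D) := by
  refine ⟨fun z => (hD.comp_fst z.2).isLinearMap_lin z.1, ?_⟩
  simp only [linFst_eq_lin]
  exact hD.isDiffOp_lin.comp_jetMap (g := fun z : (U × V) × U => (z.1, (z.2, 0))) (by fun_prop)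

theorem linOp_linFst_comm {D : U × V → P} (hD : IsDiffOp D) (z : U × V) (φ χ : U) :
    linOp (linFst D) φ z (χ, 0) = linOp (linFst D) χ z (φ, 0) := by
  simp only [linOp, linFst_eq_lin]
  exact hD.lin_comm z (φ, 0) (χ, 0)

theorem linOp_linFst_right {D : U × V → P} (hD : IsDiffOp D) (z : U × V) (φ : U) (η : V) :
    linOp (linFst D) φ z (0, η) = lin (fun u => lin (fun v => D (u, v)) z.2 η) z.1 φ := by
  simp only [linOp, linFst_eq_lin]
  rw [hD.lin_comm z (φ, 0) (0, η), lin_left_dir z.1 φ z.2]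
  simp only [lin_right_dir]

theorem linOp_fst_dir {Q : Type*} [SectionSpace M Q] [AddCommGroup Q] [Module ℝ Q]
    [JetModel Q] (Δ : U → P → Q) (p : P) (z : U × V) (φ : U) :
    linOp (fun (z : U × V) p => Δ z.1 p) p z (φ, 0) = linOp Δ p z.1 φ :=
  lin_left_dir z.1 φ z.2

theorem IsDiffOp.comp_linDir {D : U → P} (hD : IsDiffOp D) (u : U) : IsDiffOp (lin D u) :=
  hD.isDiffOp_lin.comp_jetMap (g := fun φ => (u, φ)) (by fun_prop)

end PartialLinearization

section Compatibility

variable {n : ℕ} {M : Type*} [TopologicalSpace M] [T2Space M] [SigmaCompactSpace M]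
  [ChartedSpace (EuclideanSpace ℝ (Fin n)) M] [IsManifold (𝓡 n) ∞ M]
  {U U' P P' : Type*}
  [SectionSpace M U] [AddCommGroup U] [Module ℝ U] [JetModel U] [SectionModel n U]
  [SectionSpace M U'] [AddCommGroup U'] [Module ℝ U'] [JetModel U'] [SectionModel n U']
  [SectionSpace M P] [AddCommGroup P] [Module ℝ P] [JetModel P] [SectionModel n P]
  [SectionSpace M P'] [AddCommGroup P'] [Module ℝ P'] [JetModel P'] [SectionModel n P']
  {prU : Pairing n M U' U} {prP : Pairing n M P' P} (dU : Duality prU) (dP : Duality prP)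

include dU dP in
/-- Let `G(u, w) = 0` be an equation in two unknowns on which `A` satisfies the bivector equation
`ℓ_G ∘ A - A^* ∘ ℓ_G^* = B(G, ·)`, linearizations with respect to `u`, and whose linearization with
respect to `w` is `A^*`.  Then, on the equation, the derivative of `L = ℓ_G^*` along the vector
field with components `(Aψ, -Lψ)` measures the noncommutativity of these fields. -/
theorem linOp_adjoint_sub_linOp_adjoint {G : U × U' → P} {A : U → P' → U} {A' : U → U' → P}
    {B : U → P → P' → P} {B' : U → P' → P' → P'} {L : U × U' → P' → U'}
    (hG : IsDiffOp G) (hGA : ∀ u w η, lin (fun v => G (u, v)) w η = A' u η)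
    (hA : IsCDiffOp A) (hA' : IsFormalAdjoint prP.swap prU A A')
    (hB : IsCBiDiffOp B) (hB' : IsCBiDiffOp B')
    (hBB : ∀ u ψ, IsAdjoint prP prP (fun p => B u p ψ) (fun q => B' u q ψ))
    (hL : IsFormalAdjoint prU prP (linFst G) L)
    (hE : ∀ z ψ, linFst G z (A z.1 ψ) - A' z.1 (L z ψ) = B z.1 (G z) ψ)
    {z : U × U'} {x : M} (hz : OnShell G z x) (ψ ψ' : P') :
    JetEq 0 x (linOp L ψ' z (A z.1 ψ, - L z ψ) - linOp L ψ z (A z.1 ψ', - L z ψ'))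
      (L z (B' z.1 ψ' ψ)) := by
  have hℓ := hG.isCDiffOp_linFst
  have hBψ := hB.isCDiffOp_left ψ
  have hBψ' := hB'.isCDiffOp_left ψ
  rw [jetEq_iff_sub]
  -- the derivative of the bivector equation in the direction `(φ, 0)`
  have hD : ∀ φ, linOp (fun u p => B u p ψ) (G z) z.1 φ =
      linOp (linFst G) (A z.1 ψ) z (φ, 0) + linFst G z (linOp A ψ z.1 φ)
        - linOp A' (L z ψ) z.1 φ - A' z.1 (linOp L ψ z (φ, 0)) - B z.1 (linFst G z φ) ψ := by
    intro φ
    have hA1 : IsDiffOp (fun z : U × U' => A z.1 ψ) :=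
      (hA.isDiffOp_coeff ψ).comp_jetMap (g := fun z : U × U' => z.1) (by fun_prop)
    have hA2 : IsCDiffOp (fun (z : U × U') η => A' z.1 η) :=
      hA'.1.comp_jetMap (g := fun z : U × U' => z.1) (f := fun η : U' => η)
        (by fun_prop) (by fun_prop) ⟨fun _ _ => rfl, fun _ _ => rfl⟩
    have hB1 : IsCDiffOp (fun (z : U × U') p => B z.1 p ψ) :=
      hBψ.comp_jetMap (g := fun z : U × U' => z.1) (f := fun p : P => p)
        (by fun_prop) (by fun_prop) ⟨fun _ _ => rfl, fun _ _ => rfl⟩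
    have hLψ := hL.1.isDiffOp_coeff ψ
    have h1 := hasVelocity_sub (hℓ.hasVelocity_apply hA1 z (φ, 0))
      (hA2.hasVelocity_apply hLψ z (φ, 0))
    simp only [hE] at h1
    have h2 := hasVelocity_unique (hB1.hasVelocity_apply hG z (φ, 0)) h1
    rw [linOp_fst_dir (fun u p => B u p ψ), linOp_fst_dir A', ← linFst_eq_lin] at h2
    have h3 : lin (fun z : U × U' => A z.1 ψ) z (φ, 0) = linOp A ψ z.1 φ :=
      lin_left_dir z.1 φ z.2
    rw [h3, ← eq_sub_iff_add_eq] at h2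
    change _ = _ - (_ + A' z.1 (linOp L ψ z (φ, 0))) - _ at h2
    rw [h2, sub_add_eq_sub_sub]
  refine dU.nondeg_left _ x fun φ => ?_
  refine SectionModel.fundamental (n := n)
    (fun φ => dU.sec (linOp L ψ' z (A z.1 ψ, - L z ψ) - linOp L ψ z (A z.1 ψ', - L z ψ')
      - L z (B' z.1 ψ' ψ)) φ)
    (fun φ => dP.sec ψ' (linOp (fun u p => B u p ψ) (G z) z.1 φ)) (dU.right _)
    (isLinearMap_comp (dP.right ψ').linear (hBψ.linear_linOp_dir _ _))
    ((dP.right ψ').comp_isDiffOp ((hBψ.isDiffOp_linOp_arg_dir z.1).comp_jetMap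
      (g := fun φ => (G z, φ)) (by fun_prop))) x (fun φ => ?_) (fun φ hφ => ?_) φ
  · exact preservesFlat n (fun p => dP.sec ψ' (linOp (fun u p => B u p ψ) p z.1 φ))
      (isLinearMap_comp (dP.right ψ').linear (hBψ.linear_linOp_arg _ _))
      ((dP.right ψ').comp_isDiffOp ((hBψ.isDiffOp_linOp_arg_dir z.1).comp_jetMap
        (g := fun p => (p, φ)) (by fun_prop))) x (G z) hz
  · set c := achart (EuclideanSpace ℝ (Fin n)) x
    change CompactIn c.1.source φ at hφ
    have hφ0 : CompactIn c.1.source ((φ, 0) : U × U') :=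
      hφ.prodMk (CompactIn.zero _)
    have hAφ : CompactIn c.1.source (linOp A ψ z.1 φ) :=
      hφ.apply ((hA.isDiffOp_coeff ψ).comp_linDir z.1) (hA.linear_linOp_dir ψ z.1).map_zero
    have hLφ : CompactIn c.1.source (linOp L ψ z (φ, 0)) :=
      hφ0.apply ((hL.1.isDiffOp_coeff ψ).comp_linDir z)
      (hL.1.linear_linOp_dir ψ z).map_zero
    have hℓφ := hφ.apply (hℓ.isDiffOp_apply z) (hℓ.1 z).map_zero
    have symm : ∀ χ, linOp (linFst G) φ z (χ, 0) = linOp (linFst G) χ z (φ, 0) :=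
      linOp_linFst_comm hG z φ
    have right : ∀ η, linOp (linFst G) φ z (0, η) = linOp A' η z.1 φ := fun η => by
      rw [linOp_linFst_right hG]
      simp only [hGA]
      rfl
    have split : ∀ χ ψ η, linOp L ψ z (χ, - η) = linOp L ψ z (χ, 0) - linOp L ψ z (0, η) := by
      intro χ ψ η
      rw [← (hL.1.linear_linOp_dir ψ z).map_sub]
      simp
    have n1 := hL.null_linOp dU dP hℓ z (A z.1 ψ, 0) hφ ψ'
    have n2 := hL.null_linOp dU dP hℓ z (A z.1 ψ', 0) hφ ψ
    have n3 := hL.null_linOp dU dP hℓ z (0, L z ψ') hφ ψ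
    have n4 := hL.null_linOp dU dP hℓ z (0, L z ψ) hφ ψ'
    have n5 := (hL.2 z).null dU dP (hℓ.isDiffOp_apply z) (hℓ.1 z).map_zero hAφ ψ'
    have n6 := hA'.null_linOp_dir dP.swap dU hA z.1 hφ ψ (L z ψ')
    have n7 := (hA'.2 z.1).null' dP.swap dU (hA.isDiffOp_apply z.1) (hA.1 z.1).map_zero
      (hA'.1.isDiffOp_apply z.1) (hA'.1.1 z.1).map_zero hLφ ψ'
    have n8 := hL.null_linOp_dir dU dP hℓ z hφ0 (A z.1 ψ') ψ
    have n9 := (hBB z.1 ψ).null dP dP (hBψ.isDiffOp_apply z.1) (hBψ.1 z.1).map_zero hℓφ ψ'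
    have n10 := (hL.2 z).null dU dP (hℓ.isDiffOp_apply z) (hℓ.1 z).map_zero hφ (B' z.1 ψ' ψ)
    rw [symm] at n1 n2
    rw [right] at n3 n4
    convert ((((((((n2.sub n1).sub n5).sub n6).sub n3).add n4).sub n8).sub n7).add n9).add n10
      using 1
    simp only [hD, split, dP.sub_right, dP.add_right, dU.sub_left, Duality.swap]
    abel

end Compatibility

/-! ### The bivector equations of the deformation -/

section Identities

variable {n : ℕ} {M : Type*} [TopologicalSpace M] [T2Space M] [SigmaCompactSpace M]
  [ChartedSpace (EuclideanSpace ℝ (Fin n)) M] [IsManifold (𝓡 n) ∞ M]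
  {U U' P P' : Type*}
  [SectionSpace M U] [AddCommGroup U] [Module ℝ U] [JetModel U] [SectionModel n U]
  [SectionSpace M U'] [AddCommGroup U'] [Module ℝ U'] [JetModel U'] [SectionModel n U']
  [SectionSpace M P] [AddCommGroup P] [Module ℝ P] [JetModel P] [SectionModel n P]
  [SectionSpace M P'] [AddCommGroup P'] [Module ℝ P'] [JetModel P'] [SectionModel n P']
  {prU : Pairing n M U' U} {prP : Pairing n M P' P} (dU : Duality prU) (dP : Duality prP)
  {F : U → P} {ell' : U → P' → U'} {A : Fin 2 → U → P' → U} {A' : Fin 2 → U → U' → P}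
  {B : Fin 2 → U → P → P' → P} {B' : Fin 2 → U → P' → P' → P'} {L₁ L₂ : U × U' → P' → U'}

/-- The component `F + A₁^*(w)` of the deformation. -/
def deformationFst (F : U → P) (A' : Fin 2 → U → U' → P) (z : U × U') : P := F z.1 + A' 0 z.1 z.2

/-- The component `A₂^*(w)` of the deformation. -/
def deformationSnd (A' : Fin 2 → U → U' → P) (z : U × U') : P := A' 1 z.1 z.2

theorem isDiffOp_deformationFst (hF : IsDiffOp F) (hA : IsCDiffOp (A' 0)) :
    IsDiffOp (deformationFst F A') :=
  (hF.comp_jetMap (g := fun z : U × U' => z.1) (by fun_prop)).add hA.2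

theorem linFst_deformationFst (hF : IsDiffOp F) (hA : IsCDiffOp (A' 0)) (z : U × U') (φ : U) :
    linFst (deformationFst F A') z φ = lin F z.1 φ + linOp (A' 0) z.2 z.1 φ :=
  hF.lin_add (hA.isDiffOp_coeff z.2) z.1 φ

/-- A bi-Hamiltonian structure on `F = 0`, together with the adjoints of the linearizations with
respect to `u` of the components of its Kupershmidt deformation. -/
structure IsBiHamiltonian (prU : Pairing n M U' U) (prP : Pairing n M P' P) (F : U → P)
    (ell' : U → P' → U') (A : Fin 2 → U → P' → U) (A' : Fin 2 → U → U' → P)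
    (B : Fin 2 → U → P → P' → P) (B' : Fin 2 → U → P' → P' → P')
    (L₁ L₂ : U × U' → P' → U') : Prop where
  isDiffOp : IsDiffOp F
  bivector : AreBivectors prU prP F ell' A A' B B'
  schouten_eq_zero : ∀ i j u ψ₁ ψ₂, schouten (A i) (A j) (B' i) (B' j) u ψ₁ ψ₂ = 0
  adjoint_fst : IsFormalAdjoint prU prP (linFst (deformationFst F A')) L₁
  adjoint_snd : IsFormalAdjoint prU prP (linFst (deformationSnd A')) L₂

namespace IsBiHamiltonian

variable (h : IsBiHamiltonian prU prP F ell' A A' B B' L₁ L₂)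

include h

theorem cdiff_adjoint (i : Fin 2) : IsCDiffOp (A' i) := (h.bivector i).adjoint.1

theorem isDiffOp_fst : IsDiffOp (deformationFst F A') :=
  isDiffOp_deformationFst h.isDiffOp (h.cdiff_adjoint 0)

theorem isDiffOp_snd : IsDiffOp (deformationSnd A') := (h.cdiff_adjoint 1).2

include dU dP

/-- The identity `bivector_identity_of_schouten_eq_zero` for the pair `Aᵢ`, `Aⱼ`. -/
theorem bivector_identity (i j : Fin 2) {u : U} {w : U'} {mi mj : P' → U'}
    (hi : IsAdjoint prU prP (linOp (A' i) w u) mi) (hj : IsAdjoint prU prP (linOp (A' j) w u) mj)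
    (ψ : P') :
    (linOp (A' i) w u (A j u ψ) - A' j u (mi ψ)) + (linOp (A' j) w u (A i u ψ) - A' i u (mj ψ)) =
      B j u (A' i u w) ψ + B i u (A' j u w) ψ :=
  bivector_identity_of_schouten_eq_zero dU dP (h.bivector i).cdiff (h.bivector j).cdiff
    (h.bivector i).adjoint (h.bivector j).adjoint (h.bivector i).cbidiff (h.bivector j).cbidiff
    (h.bivector i).cbidiff' (h.bivector j).cbidiff' (h.bivector i).adjoint' (h.bivector j).adjoint'
    hi hj fun ψ₁ => h.schouten_eq_zero i j u ψ₁ ψ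

theorem adjoint_linOp_zero (z : U × U') :
    IsAdjoint prU prP (linOp (A' 0) z.2 z.1) (fun ψ => L₁ z ψ - ell' z.1 ψ) := by
  have hF := h.isDiffOp.isDiffOp_lin.comp_jetMap (g := fun φ : U => (z.1, φ)) (by fun_prop)
  have hℓ := h.isDiffOp_fst.isCDiffOp_linFst
  convert (h.adjoint_fst.2 z).sub dU dP ((h.bivector 0).ell_adjoint.2 z.1) (hℓ.isDiffOp_apply z) hF
    (hℓ.1 z).map_zero (h.isDiffOp.isLinearMap_lin z.1).map_zero using 1
  funext φ
  rw [linFst_deformationFst h.isDiffOp (h.cdiff_adjoint 0), add_sub_cancel_left]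

/-- The bivector equation for `A₁` on the equation `F + A₁^*(w) = 0` in the unknown `u`, from
the one on `F = 0` and the vanishing of the bracket of `A₁` with itself. -/
theorem linFst_fst_zero (z : U × U') (ψ : P') :
    linFst (deformationFst F A') z (A 0 z.1 ψ) - A' 0 z.1 (L₁ z ψ) =
      B 0 z.1 (deformationFst F A' z) ψ := by
  have hm := h.adjoint_linOp_zero dU dP z
  have h1 := eq_of_add_self_eq (h.bivector_identity dU dP 0 0 hm hm ψ)
  have h2 := (h.bivector 0).eq z.1 ψ
  rw [((h.cdiff_adjoint 0).1 z.1).map_sub] at h1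
  rw [linFst_deformationFst h.isDiffOp (h.cdiff_adjoint 0), deformationFst,
    ((h.bivector 0).cbidiff.1 z.1 ψ).map_add, ← h1, ← h2]
  abel

/-- The bivector equation for `A₂` on `A₂^*(w) = 0`, which expresses that the bracket of `A₂` with
itself vanishes. -/
theorem linFst_snd_one (z : U × U') (ψ : P') :
    linFst (deformationSnd A') z (A 1 z.1 ψ) - A' 1 z.1 (L₂ z ψ) =
      B 1 z.1 (deformationSnd A' z) ψ :=
  eq_of_add_self_eq (h.bivector_identity dU dP 1 1 (h.adjoint_snd.2 z) (h.adjoint_snd.2 z) ψ)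

/-- The mixed equation, from the one for `A₂` on `F = 0` and the vanishing of the bracket of `A₁`
and `A₂`. -/
theorem linFst_fst_one_add_snd_zero (z : U × U') (ψ : P') :
    (linFst (deformationFst F A') z (A 1 z.1 ψ) - A' 1 z.1 (L₁ z ψ)) +
      (linFst (deformationSnd A') z (A 0 z.1 ψ) - A' 0 z.1 (L₂ z ψ)) =
      B 1 z.1 (deformationFst F A' z) ψ + B 0 z.1 (deformationSnd A' z) ψ := by
  have h1 := h.bivector_identity dU dP 0 1 (h.adjoint_linOp_zero dU dP z) (h.adjoint_snd.2 z) ψ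
  have h2 := (h.bivector 1).eq z.1 ψ
  rw [((h.cdiff_adjoint 1).1 z.1).map_sub, ← sub_eq_zero] at h1
  rw [linFst_deformationFst h.isDiffOp (h.cdiff_adjoint 0), deformationFst,
    ((h.bivector 1).cbidiff.1 z.1 ψ).map_add, ← h2, ← sub_eq_zero, ← h1]
  simp only [linFst, deformationSnd, linOp]
  abel

theorem linOp_adjoint_sub_linOp_adjoint {z : U × U'} {x : M}
    (hz : OnShell (deformation F A') z x) (ψ ψ' : P') :
    JetEq 0 x
      (linOp (fun z ψ => L₁ z ψ + L₂ z ψ) ψ' z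
          (A 0 z.1 ψ + A 1 z.1 ψ, - (L₁ z ψ + L₂ z ψ)) -
        linOp (fun z ψ => L₁ z ψ + L₂ z ψ) ψ z
          (A 0 z.1 ψ' + A 1 z.1 ψ', - (L₁ z ψ' + L₂ z ψ')))
      (L₁ z (B' 0 z.1 ψ' ψ + B' 1 z.1 ψ' ψ) + L₂ z (B' 0 z.1 ψ' ψ + B' 1 z.1 ψ' ψ)) := by
  have hA := fun i => (h.bivector i).cdiff
  have hA' := fun i => (h.bivector i).adjoint
  have hB := fun i => (h.bivector i).cbidiff
  have hB' := fun i => (h.bivector i).cbidiff'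
  have hBB := fun i => (h.bivector i).adjoint'
  have h₁ := h.isDiffOp_fst
  have h₂ := h.isDiffOp_snd
  have hsum : linFst (fun z => deformationFst F A' z + deformationSnd A' z) =
      fun z φ => linFst (deformationFst F A') z φ + linFst (deformationSnd A') z φ := by
    funext z φ
    exact (h₁.comp_fst z.2).lin_add (h₂.comp_fst z.2) z.1 φ
  refine Kupershmidt.linOp_adjoint_sub_linOp_adjoint dU dP
    (G := fun z => deformationFst F A' z + deformationSnd A' z)
    (A := fun u ψ => A 0 u ψ + A 1 u ψ) (A' := fun u η => A' 0 u η + A' 1 u η)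
    (B := fun u p ψ => B 0 u p ψ + B 1 u p ψ) (B' := fun u q ψ => B' 0 u q ψ + B' 1 u q ψ)
    (L := fun z ψ => L₁ z ψ + L₂ z ψ)
    (h₁.add h₂) (fun u w η => ?_) ((hA 0).add (hA 1))
    ((hA' 0).add dP.swap dU (hA' 1) (hA 0) (hA 1)) ((hB 0).add (hB 1)) ((hB' 0).add (hB' 1))
    (fun u ψ => ?_) ?_ (fun z ψ => ?_) (fun k => ?_) ψ ψ'
  · have hc : ∀ i, IsDiffOp (fun v : U' => A' i u v) := fun i =>
      (h.cdiff_adjoint i).isDiffOp_apply u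
    have hF : IsDiffOp (fun _ : U' => F u) := (JetMap.const (F u)).isDiffOp
    have h3 := (hF.add (hc 0)).lin_add (hc 1) w η
    rw [hF.lin_add (hc 0), lin_const, lin_eq_of_linear ((h.cdiff_adjoint 0).1 u),
      lin_eq_of_linear ((h.cdiff_adjoint 1).1 u), zero_add] at h3
    exact h3
  · have hb := fun i => (hB i).isCDiffOp_left ψ
    exact (hBB 0 u ψ).add dP dP (hBB 1 u ψ) ((hb 0).isDiffOp_apply u) ((hb 1).isDiffOp_apply u)
      ((hb 0).1 u).map_zero ((hb 1).1 u).map_zero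
  · rw [hsum]
    exact h.adjoint_fst.add dU dP h.adjoint_snd h₁.isCDiffOp_linFst h₂.isCDiffOp_linFst
  · have e0 := h.linFst_fst_zero dU dP z ψ
    have e1 := h.linFst_snd_one dU dP z ψ
    have e2 := h.linFst_fst_one_add_snd_zero dU dP z ψ
    rw [hsum]
    simp only [(h₁.isCDiffOp_linFst.1 z).map_add, (h₂.isCDiffOp_linFst.1 z).map_add,
      ((h.cdiff_adjoint _).1 z.1).map_add, ((hB _).1 z.1 ψ).map_add]
    rw [← e0, ← e1, ← sub_eq_zero]
    rw [← sub_eq_zero] at e2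
    rw [← e2]
    abel
  · exact jet_add (hz k).1 (hz k).2

end IsBiHamiltonian

end Identities

/-! ### The bivectors on the deformation and their associated operators -/

section Operators

variable {M : Type*} [TopologicalSpace M] {U V P Q R S T : Type*}
  [SectionSpace M U] [SectionSpace M V] [SectionSpace M P] [SectionSpace M Q] [SectionSpace M R]
  [SectionSpace M S] [SectionSpace M T]
  [AddCommGroup U] [Module ℝ U] [AddCommGroup V] [Module ℝ V] [AddCommGroup P] [Module ℝ P]
  [AddCommGroup Q] [Module ℝ Q] [AddCommGroup R] [Module ℝ R] [AddCommGroup S] [Module ℝ S]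
  [AddCommGroup T] [Module ℝ T]
  [JetModel U] [JetModel V] [JetModel P] [JetModel Q] [JetModel R] [JetModel S] [JetModel T]

theorem isLinearMap_neg {f : P → Q} (hf : IsLinearMap ℝ f) : IsLinearMap ℝ (fun p => - f p) :=
  ⟨fun a b => by rw [hf.map_add]; abel, fun r a => by rw [hf.map_smul, smul_neg]⟩

theorem isLinearMap_fst_sub_snd : IsLinearMap ℝ (fun z : P × P => z.1 - z.2) :=
  isLinearMap_sub isLinearMap_fst isLinearMap_snd

theorem IsCDiffOp.neg {Δ : U → P → Q} (h : IsCDiffOp Δ) : IsCDiffOp (fun u p => - Δ u p) :=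
  ⟨fun u => isLinearMap_neg (h.1 u), h.2.neg⟩

theorem IsCBiDiffOp.neg {B : U → P → Q → R} (h : IsCBiDiffOp B) :
    IsCBiDiffOp (fun u p q => - B u p q) :=
  ⟨fun u q => isLinearMap_neg (h.1 u q), fun u p => isLinearMap_neg (h.2.1 u p), h.2.2.neg⟩

theorem IsCBiDiffOp.sub {B B' : U → P → Q → R} (h : IsCBiDiffOp B) (h' : IsCBiDiffOp B') :
    IsCBiDiffOp (fun u p q => B u p q - B' u p q) :=
  ⟨fun u q => isLinearMap_sub (h.1 u q) (h'.1 u q),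
    fun u p => isLinearMap_sub (h.2.1 u p) (h'.2.1 u p), h.2.2.sub h'.2.2⟩

theorem IsCBiDiffOp.prodMk {B : U → P → Q → R} {B' : U → P → Q → S} (h : IsCBiDiffOp B)
    (h' : IsCBiDiffOp B') : IsCBiDiffOp (fun u p q => (B u p q, B' u p q)) :=
  ⟨fun u q => isLinearMap_prodMk (h.1 u q) (h'.1 u q),
    fun u p => isLinearMap_prodMk (h.2.1 u p) (h'.2.1 u p), h.2.2.prodMk h'.2.2⟩

theorem IsCBiDiffOp.comp_jetMap {B : U → P → Q → R} (h : IsCBiDiffOp B) {g : V → U} (hg : JetMap g)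
    {f : S → P} (hf : JetMap f) (hf' : IsLinearMap ℝ f) {k : T → Q} (hk : JetMap k)
    (hk' : IsLinearMap ℝ k) : IsCBiDiffOp (fun v s t => B (g v) (f s) (k t)) :=
  ⟨fun v t => isLinearMap_comp (h.1 (g v) (k t)) hf',
    fun v s => isLinearMap_comp (h.2.1 (g v) (f s)) hk',
    h.2.2.comp_jetMap (g := fun z : V × S × T => (g z.1, f z.2.1, k z.2.2)) (by fun_prop)⟩

end Operators

section Deformed

variable {n : ℕ} {M : Type*} [TopologicalSpace M] [T2Space M] [SigmaCompactSpace M]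
  [ChartedSpace (EuclideanSpace ℝ (Fin n)) M] [IsManifold (𝓡 n) ∞ M]
  {U U' P P' : Type*}
  [SectionSpace M U] [AddCommGroup U] [Module ℝ U] [JetModel U] [SectionModel n U]
  [SectionSpace M U'] [AddCommGroup U'] [Module ℝ U'] [JetModel U'] [SectionModel n U']
  [SectionSpace M P] [AddCommGroup P] [Module ℝ P] [JetModel P] [SectionModel n P]
  [SectionSpace M P'] [AddCommGroup P'] [Module ℝ P'] [JetModel P'] [SectionModel n P']
  {prU : Pairing n M U' U} {prP : Pairing n M P' P} (dU : Duality prU) (dP : Duality prP)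
  {F : U → P} {ell' : U → P' → U'} {A : Fin 2 → U → P' → U} {A' : Fin 2 → U → U' → P}
  {B : Fin 2 → U → P → P' → P} {B' : Fin 2 → U → P' → P' → P'} {L₁ L₂ : U × U' → P' → U'}

/-- The adjoint of the linearization of the deformation. -/
def deformedEllAdjoint (A : Fin 2 → U → P' → U) (L₁ L₂ : U × U' → P' → U') (z : U × U')
    (ψ : P' × P') : U' × U :=
  (L₁ z ψ.1 + L₂ z ψ.2, A 0 z.1 ψ.1 + A 1 z.1 ψ.2)

/-- The adjoints of the operators `Ã₁` and `Ã₂`; here `ell` is the linearization of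
`F + A₁^*(w) + A₂^*(w)` with respect to `u`. -/
def deformedAdjoint (A' : Fin 2 → U → U' → P) (ell : U × U' → U → P) :
    Fin 2 → U × U' → U' × U → P × P :=
  ![fun z q => (A' 0 z.1 q.1, ell z q.2 - A' 0 z.1 q.1),
    fun z q => (A' 1 z.1 q.1 - ell z q.2, - A' 1 z.1 q.1)]

/-- The operators `B̃₁` and `B̃₂` associated with `Ã₁` and `Ã₂`. -/
def deformedAssoc (B : Fin 2 → U → P → P' → P) :
    Fin 2 → U × U' → P × P → P' × P' → P × P :=
  ![fun z p ψ => (B 0 z.1 p.1 (ψ.1 - ψ.2),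
      -(B 0 z.1 p.1 ψ.1 + B 1 z.1 p.1 ψ.2 + B 0 z.1 p.2 ψ.2 + B 1 z.1 p.2 ψ.2)),
    fun z p ψ => (B 0 z.1 p.1 ψ.1 + B 1 z.1 p.1 ψ.1 + B 0 z.1 p.2 ψ.1 + B 1 z.1 p.2 ψ.2,
      B 1 z.1 p.2 (ψ.1 - ψ.2))]

/-- The adjoints of `B̃₁` and `B̃₂` in the first argument. -/
def deformedAssocAdjoint (B' : Fin 2 → U → P' → P' → P') :
    Fin 2 → U × U' → P' × P' → P' × P' → P' × P' :=
  ![fun z q ψ => (B' 0 z.1 q.1 (ψ.1 - ψ.2) - B' 0 z.1 q.2 ψ.1 - B' 1 z.1 q.2 ψ.2,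
      -(B' 0 z.1 q.2 ψ.2 + B' 1 z.1 q.2 ψ.2)),
    fun z q ψ => (B' 0 z.1 q.1 ψ.1 + B' 1 z.1 q.1 ψ.1,
      B' 0 z.1 q.1 ψ.1 + B' 1 z.1 q.1 ψ.2 + B' 1 z.1 q.2 (ψ.1 - ψ.2))]

theorem deformedBivector_zero (L : U × U' → P' → U') (z : U × U') (ψ : P' × P') :
    deformedBivector A L 0 z ψ = (A 0 z.1 ψ.1 - A 0 z.1 ψ.2, L z ψ.2) := rfl

theorem deformedBivector_one (L : U × U' → P' → U') (z : U × U') (ψ : P' × P') :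
    deformedBivector A L 1 z ψ = (A 1 z.1 ψ.1 - A 1 z.1 ψ.2, - L z ψ.1) := rfl

theorem deformedAdjoint_zero (ell : U × U' → U → P) (z : U × U') (q : U' × U) :
    deformedAdjoint A' ell 0 z q = (A' 0 z.1 q.1, ell z q.2 - A' 0 z.1 q.1) := rfl

theorem deformedAdjoint_one (ell : U × U' → U → P) (z : U × U') (q : U' × U) :
    deformedAdjoint A' ell 1 z q = (A' 1 z.1 q.1 - ell z q.2, - A' 1 z.1 q.1) := rfl

theorem deformedAssoc_zero (z : U × U') (p : P × P) (ψ : P' × P') :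
    deformedAssoc B 0 z p ψ = (B 0 z.1 p.1 (ψ.1 - ψ.2),
      -(B 0 z.1 p.1 ψ.1 + B 1 z.1 p.1 ψ.2 + B 0 z.1 p.2 ψ.2 + B 1 z.1 p.2 ψ.2)) := rfl

theorem deformedAssoc_one (z : U × U') (p : P × P) (ψ : P' × P') :
    deformedAssoc B 1 z p ψ = (B 0 z.1 p.1 ψ.1 + B 1 z.1 p.1 ψ.1 + B 0 z.1 p.2 ψ.1 +
      B 1 z.1 p.2 ψ.2, B 1 z.1 p.2 (ψ.1 - ψ.2)) := rfl

theorem deformedAssocAdjoint_zero (z : U × U') (q ψ : P' × P') :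
    deformedAssocAdjoint B' 0 z q ψ =
      (B' 0 z.1 q.1 (ψ.1 - ψ.2) - B' 0 z.1 q.2 ψ.1 - B' 1 z.1 q.2 ψ.2,
        -(B' 0 z.1 q.2 ψ.2 + B' 1 z.1 q.2 ψ.2)) := rfl

theorem deformedAssocAdjoint_one (z : U × U') (q ψ : P' × P') :
    deformedAssocAdjoint B' 1 z q ψ = (B' 0 z.1 q.1 ψ.1 + B' 1 z.1 q.1 ψ.1,
      B' 0 z.1 q.1 ψ.1 + B' 1 z.1 q.1 ψ.2 + B' 1 z.1 q.2 (ψ.1 - ψ.2)) := rfl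

theorem isCBiDiffOp_deformedAssoc (hB : ∀ i, IsCBiDiffOp (B i)) :
    ∀ i, IsCBiDiffOp (deformedAssoc (U' := U') B i) := by
  have hl₁ := isLinearMap_fst (P := P) (Q := P)
  have hl₂ := isLinearMap_snd (P := P) (Q := P)
  have hl₁' := isLinearMap_fst (P := P') (Q := P')
  have hl₂' := isLinearMap_snd (P := P') (Q := P')
  have b₁ := fun i => (hB i).comp_jetMap (g := fun z : U × U' => z.1) (by fun_prop) (by fun_prop)
    hl₁ (by fun_prop) hl₁'
  have b₂ := fun i => (hB i).comp_jetMap (g := fun z : U × U' => z.1) (by fun_prop) (by fun_prop)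
    hl₁ (by fun_prop) hl₂'
  have b₃ := fun i => (hB i).comp_jetMap (g := fun z : U × U' => z.1) (by fun_prop) (by fun_prop)
    hl₂ (by fun_prop) hl₁'
  have b₄ := fun i => (hB i).comp_jetMap (g := fun z : U × U' => z.1) (by fun_prop) (by fun_prop)
    hl₂ (by fun_prop) hl₂'
  have b₅ := (hB 0).comp_jetMap (g := fun z : U × U' => z.1) (by fun_prop) (by fun_prop)
    hl₁ (by fun_prop) (isLinearMap_fst_sub_snd (P := P'))
  have b₆ := (hB 1).comp_jetMap (g := fun z : U × U' => z.1) (by fun_prop) (by fun_prop)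
    hl₂ (by fun_prop) (isLinearMap_fst_sub_snd (P := P'))
  exact Fin.forall_fin_two.2
    ⟨b₅.prodMk ((((b₁ 0).add (b₂ 1)).add (b₄ 0)).add (b₄ 1)).neg,
      ((((b₁ 0).add (b₁ 1)).add (b₃ 0)).add (b₄ 1)).prodMk b₆⟩

theorem isCBiDiffOp_deformedAssocAdjoint (hB : ∀ i, IsCBiDiffOp (B' i)) :
    ∀ i, IsCBiDiffOp (deformedAssocAdjoint (U' := U') B' i) := by
  have hl₁ := isLinearMap_fst (P := P') (Q := P')
  have hl₂ := isLinearMap_snd (P := P') (Q := P')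
  have b₁ := fun i => (hB i).comp_jetMap (g := fun z : U × U' => z.1) (by fun_prop) (by fun_prop)
    hl₁ (by fun_prop) hl₁
  have b₂ := fun i => (hB i).comp_jetMap (g := fun z : U × U' => z.1) (by fun_prop) (by fun_prop)
    hl₁ (by fun_prop) hl₂
  have b₃ := fun i => (hB i).comp_jetMap (g := fun z : U × U' => z.1) (by fun_prop) (by fun_prop)
    hl₂ (by fun_prop) hl₁
  have b₄ := fun i => (hB i).comp_jetMap (g := fun z : U × U' => z.1) (by fun_prop) (by fun_prop)
    hl₂ (by fun_prop) hl₂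
  have b₅ := (hB 0).comp_jetMap (g := fun z : U × U' => z.1) (by fun_prop) (by fun_prop)
    hl₁ (by fun_prop) (isLinearMap_fst_sub_snd (P := P'))
  have b₆ := (hB 1).comp_jetMap (g := fun z : U × U' => z.1) (by fun_prop) (by fun_prop)
    hl₂ (by fun_prop) (isLinearMap_fst_sub_snd (P := P'))
  exact Fin.forall_fin_two.2
    ⟨((b₅.sub (b₃ 0)).sub (b₄ 1)).prodMk ((b₄ 0).add (b₄ 1)).neg,
      ((b₁ 0).add (b₁ 1)).prodMk (((b₁ 0).add (b₂ 1)).add b₆)⟩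

theorem isCDiffOp_deformedBivector (hA : ∀ i, IsCDiffOp (A i)) {L : U × U' → P' → U'}
    (hL : IsCDiffOp L) :
    ∀ i, IsCDiffOp (deformedBivector A L i) := by
  have hl₁ := isLinearMap_fst (P := P') (Q := P')
  have hl₂ := isLinearMap_snd (P := P') (Q := P')
  have b₁ := fun i => (hA i).comp_jetMap (g := fun z : U × U' => z.1) (by fun_prop) (by fun_prop)
    hl₁
  have b₂ := fun i => (hA i).comp_jetMap (g := fun z : U × U' => z.1) (by fun_prop) (by fun_prop)
    hl₂
  have c₁ := hL.comp_jetMap (g := fun z : U × U' => z) (by fun_prop) (by fun_prop) hl₁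
  have c₂ := hL.comp_jetMap (g := fun z : U × U' => z) (by fun_prop) (by fun_prop) hl₂
  exact Fin.forall_fin_two.2
    ⟨((b₁ 0).sub (b₂ 0)).prodMk c₂, ((b₁ 1).sub (b₂ 1)).prodMk c₁.neg⟩

theorem isCDiffOp_deformedAdjoint (hA : ∀ i, IsCDiffOp (A' i)) {ell : U × U' → U → P}
    (hell : IsCDiffOp ell) :
    ∀ i, IsCDiffOp (deformedAdjoint A' ell i) := by
  have b := fun i => (hA i).comp_jetMap (g := fun z : U × U' => z.1) (by fun_prop) (by fun_prop)
    (isLinearMap_fst (P := U') (Q := U))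
  have c := hell.comp_jetMap (g := fun z : U × U' => z) (by fun_prop) (by fun_prop)
    (isLinearMap_snd (P := U') (Q := U))
  exact Fin.forall_fin_two.2 ⟨(b 0).prodMk (c.sub (b 0)), ((b 1).sub c).prodMk (b 1).neg⟩

theorem isCDiffOp_deformedEllAdjoint (hA : ∀ i, IsCDiffOp (A i)) (hL₁ : IsCDiffOp L₁)
    (hL₂ : IsCDiffOp L₂) : IsCDiffOp (deformedEllAdjoint A L₁ L₂) := by
  have hl₁ := isLinearMap_fst (P := P') (Q := P')
  have hl₂ := isLinearMap_snd (P := P') (Q := P')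
  have b₁ := (hA 0).comp_jetMap (g := fun z : U × U' => z.1) (by fun_prop) (by fun_prop) hl₁
  have b₂ := (hA 1).comp_jetMap (g := fun z : U × U' => z.1) (by fun_prop) (by fun_prop) hl₂
  have c₁ := hL₁.comp_jetMap (g := fun z : U × U' => z) (by fun_prop) (by fun_prop) hl₁
  have c₂ := hL₂.comp_jetMap (g := fun z : U × U' => z) (by fun_prop) (by fun_prop) hl₂
  exact (c₁.add c₂).prodMk (b₁.add b₂)

namespace IsBiHamiltonian

variable (h : IsBiHamiltonian prU prP F ell' A A' B B' L₁ L₂)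

include h

theorem isDiffOp_deformation : IsDiffOp (deformation F A') := h.isDiffOp_fst.prodMk h.isDiffOp_snd

theorem lin_deformation (z q : U × U') :
    lin (deformation F A') z q = (linFst (deformationFst F A') z q.1 + A' 0 z.1 q.2,
      linFst (deformationSnd A') z q.1 + A' 1 z.1 q.2) := by
  have hF : IsDiffOp (fun _ : U' => F z.1) := (JetMap.const (F z.1)).isDiffOp
  have h0 := h.cdiff_adjoint 0
  have h1 : lin (fun v => deformationFst F A' (z.1, v)) z.2 q.2 = A' 0 z.1 q.2 := by
    have := hF.lin_add (h0.isDiffOp_apply z.1) z.2 q.2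
    rwa [lin_const, lin_eq_of_linear (h0.1 z.1), zero_add] at this
  have h2 : lin (fun v => deformationSnd A' (z.1, v)) z.2 q.2 = A' 1 z.1 q.2 :=
    lin_eq_of_linear ((h.cdiff_adjoint 1).1 z.1) z.2 q.2
  rw [← h1, ← h2]
  refine (h.isDiffOp_fst.lin_prodMk h.isDiffOp_snd z q).trans (Prod.ext ?_ ?_)
  · exact h.isDiffOp_fst.lin_prod z.1 q.1 z.2 q.2
  · exact h.isDiffOp_snd.lin_prod z.1 q.1 z.2 q.2

include dU dP

theorem adjoint_deformation :
    IsFormalAdjoint (prU.sum prU.swap) (prP.sum prP) (lin (deformation F A'))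
      (deformedEllAdjoint A L₁ L₂) := by
  have hA := fun i => (h.bivector i).cdiff
  have hA' := h.cdiff_adjoint
  have hAA := fun i => (h.bivector i).adjoint
  have h₁ := h.isDiffOp_fst.isCDiffOp_linFst
  have h₂ := h.isDiffOp_snd.isCDiffOp_linFst
  refine ⟨isCDiffOp_deformedEllAdjoint hA h.adjoint_fst.1 h.adjoint_snd.1, fun z => ?_⟩
  refine isAdjoint_of_null (dU.sum dU.swap) (dP.sum dP)
    (h.isDiffOp_deformation.comp_linDir z) (h.isDiffOp_deformation.isLinearMap_lin z).map_zero
    fun c p ψ hp => ?_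
  have hp₁ := hp.fst
  have hp₂ := hp.snd
  have n1 := (h.adjoint_fst.2 z).null dU dP (h₁.isDiffOp_apply z) (h₁.1 z).map_zero hp₁ ψ.1
  have n2 := (h.adjoint_snd.2 z).null dU dP (h₂.isDiffOp_apply z) (h₂.1 z).map_zero hp₁ ψ.2
  have n3 := fun i ψ => ((hAA i).2 z.1).null' dP.swap dU ((hA i).isDiffOp_apply z.1)
    ((hA i).1 z.1).map_zero ((hA' i).isDiffOp_apply z.1) ((hA' i).1 z.1).map_zero hp₂ ψ
  convert ((n1.add n2).sub (n3 0 ψ.1)).sub (n3 1 ψ.2) using 1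
  rw [h.lin_deformation]
  simp only [Duality.sum, Duality.swap, deformedEllAdjoint, dP.add_right, dU.add_left,
    dU.add_right]
  abel

theorem adjoint_sum :
    IsFormalAdjoint prU prP
      (fun z φ => linFst (deformationFst F A') z φ + linFst (deformationSnd A') z φ)
      (fun z ψ => L₁ z ψ + L₂ z ψ) :=
  h.adjoint_fst.add dU dP h.adjoint_snd h.isDiffOp_fst.isCDiffOp_linFst
    h.isDiffOp_snd.isCDiffOp_linFst

theorem adjoint_deformedBivector (i : Fin 2) :
    IsFormalAdjoint (prP.sum prP).swap (prU.sum prU.swap)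
      (deformedBivector A (fun z ψ => L₁ z ψ + L₂ z ψ) i)
      (deformedAdjoint A'
        (fun z φ => linFst (deformationFst F A') z φ + linFst (deformationSnd A') z φ) i) := by
  have hA := fun i => (h.bivector i).cdiff
  have hAA := fun i => (h.bivector i).adjoint
  have hℓ := h.isDiffOp_fst.isCDiffOp_linFst.add h.isDiffOp_snd.isCDiffOp_linFst
  have hL := h.adjoint_sum dU dP
  have htA := isCDiffOp_deformedBivector hA hL.1
  refine ⟨isCDiffOp_deformedAdjoint h.cdiff_adjoint hℓ i, fun z => ?_⟩
  refine isAdjoint_of_null (dP.sum dP).swap (dU.sum dU.swap) ((htA i).isDiffOp_apply z)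
    ((htA i).1 z).map_zero fun c ψ q hψ => ?_
  have n1 : ∀ (i : Fin 2) {ψ : P'}, CompactIn c.1.source ψ → _ := fun i ψ hψ =>
    ((hAA i).2 z.1).null dP.swap dU ((hA i).isDiffOp_apply z.1) ((hA i).1 z.1).map_zero hψ q.1
  have n2 : ∀ {ψ : P'}, CompactIn c.1.source ψ → _ := fun {ψ} hψ =>
    (hL.2 z).null' dU dP (hℓ.isDiffOp_apply z) (hℓ.1 z).map_zero (hL.1.isDiffOp_apply z)
      (hL.1.1 z).map_zero hψ q.2
  have hψ₁ := hψ.fst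
  have hψ₂ := hψ.snd
  revert i
  refine Fin.forall_fin_two.2 ⟨?_, ?_⟩
  · convert ((n1 0 hψ₁).sub (n1 0 hψ₂)).sub (n2 hψ₂) using 1
    simp only [Duality.sum, Duality.swap, deformedBivector_zero, deformedAdjoint_zero,
      dP.add_right, dU.add_left, dU.sub_right, dP.sub_right]
    abel
  · convert ((n1 1 hψ₁).sub (n1 1 hψ₂)).add (n2 hψ₁) using 1
    simp only [Duality.sum, Duality.swap, deformedBivector_one, deformedAdjoint_one,
      dP.add_right, dU.add_left, dU.sub_right, dP.sub_right, dU.neg_left, dP.neg_right]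
    abel

omit dU in
theorem adjoint_deformedAssoc (i : Fin 2) (z : U × U') (ψ : P' × P') :
    IsAdjoint (prP.sum prP) (prP.sum prP) (fun p => deformedAssoc B i z p ψ)
      (fun q => deformedAssocAdjoint B' i z q ψ) := by
  have hB := fun i => (h.bivector i).cbidiff
  have hBB := fun i => (h.bivector i).adjoint'
  have htB := (isCBiDiffOp_deformedAssoc (U' := U') hB i).isCDiffOp_left ψ
  refine isAdjoint_of_null (dP.sum dP) (dP.sum dP) (htB.isDiffOp_apply z) (htB.1 z).map_zero
    fun c p q hp => ?_
  have n : ∀ (i : Fin 2) (ψ q : P') {p : P}, CompactIn c.1.source p → _ := fun i ψ q p hp =>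
    (hBB i z.1 ψ).null dP dP (((hB i).isCDiffOp_left ψ).isDiffOp_apply z.1)
      (((hB i).isCDiffOp_left ψ).1 z.1).map_zero hp q
  have hp₁ := hp.fst
  have hp₂ := hp.snd
  clear htB
  revert i
  refine Fin.forall_fin_two.2 ⟨?_, ?_⟩
  · convert ((((n 0 (ψ.1 - ψ.2) q.1 hp₁).sub (n 0 ψ.1 q.2 hp₁)).sub (n 1 ψ.2 q.2 hp₁)).sub
      (n 0 ψ.2 q.2 hp₂)).sub (n 1 ψ.2 q.2 hp₂) using 1
    simp only [Duality.sum, deformedAssoc_zero, deformedAssocAdjoint_zero,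
      dP.add_right, dP.neg_right, dP.sub_left, dP.add_left, dP.neg_left]
    abel
  · convert ((((n 0 ψ.1 q.1 hp₁).add (n 1 ψ.1 q.1 hp₁)).add (n 0 ψ.1 q.1 hp₂)).add
      (n 1 ψ.2 q.1 hp₂)).add (n 1 (ψ.1 - ψ.2) q.2 hp₂) using 1
    simp only [Duality.sum, deformedAssoc_one, deformedAssocAdjoint_one,
      dP.add_right, dP.add_left]
    abel

theorem deformedBivector_eq (i : Fin 2) (z : U × U') (ψ : P' × P') :
    lin (deformation F A') z (deformedBivector A (fun z ψ => L₁ z ψ + L₂ z ψ) i z ψ) -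
      deformedAdjoint A'
        (fun z φ => linFst (deformationFst F A') z φ + linFst (deformationSnd A') z φ) i z
        (deformedEllAdjoint A L₁ L₂ z ψ) = deformedAssoc B i z (deformation F A' z) ψ := by
  have hℓ₁ := h.isDiffOp_fst.isCDiffOp_linFst
  have hℓ₂ := h.isDiffOp_snd.isCDiffOp_linFst
  have hA' := h.cdiff_adjoint
  have hB := fun i => (h.bivector i).cbidiff
  have e0 := h.linFst_fst_zero dU dP z
  have e1 := h.linFst_snd_one dU dP z
  have e2 := h.linFst_fst_one_add_snd_zero dU dP z
  have hd : deformation F A' z = (deformationFst F A' z, deformationSnd A' z) := rfl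
  have e2' : ∀ ψ, B 1 z.1 (deformationFst F A' z) ψ =
      (linFst (deformationFst F A') z (A 1 z.1 ψ) - A' 1 z.1 (L₁ z ψ)) +
      (linFst (deformationSnd A') z (A 0 z.1 ψ) - A' 0 z.1 (L₂ z ψ)) -
      B 0 z.1 (deformationSnd A' z) ψ := fun ψ => by rw [e2 ψ, add_sub_cancel_right]
  rw [h.lin_deformation, hd]
  revert i
  refine Fin.forall_fin_two.2 ⟨Prod.ext ?_ ?_, Prod.ext ?_ ?_⟩ <;>
  · simp only [deformedBivector_zero, deformedBivector_one, deformedAdjoint_zero,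
      deformedAdjoint_one, deformedAssoc_zero, deformedAssoc_one, deformedEllAdjoint, Prod.fst_sub, Prod.snd_sub,
      ((hB _).2.1 z.1 _).map_sub, e2', ← e0, ← e1, (hℓ₁.1 z).map_sub, (hℓ₂.1 z).map_sub,
      (hℓ₁.1 z).map_add, (hℓ₂.1 z).map_add, ((hA' _).1 z.1).map_add, ((hA' _).1 z.1).map_neg]
    abel

theorem areBivectors_deformedBivector :
    AreBivectors (prU.sum prU.swap) (prP.sum prP) (deformation F A') (deformedEllAdjoint A L₁ L₂)
      (deformedBivector A (fun z ψ => L₁ z ψ + L₂ z ψ))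
      (deformedAdjoint A'
        (fun z φ => linFst (deformationFst F A') z φ + linFst (deformationSnd A') z φ))
      (deformedAssoc B) (deformedAssocAdjoint B') := fun i =>
  { ell_adjoint := h.adjoint_deformation dU dP
    cdiff := isCDiffOp_deformedBivector (fun i => (h.bivector i).cdiff) (h.adjoint_sum dU dP).1 i
    adjoint := h.adjoint_deformedBivector dU dP i
    cbidiff := isCBiDiffOp_deformedAssoc (fun i => (h.bivector i).cbidiff) i
    cbidiff' := isCBiDiffOp_deformedAssocAdjoint (fun i => (h.bivector i).cbidiff') i
    adjoint' := h.adjoint_deformedAssoc dP i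
    eq := h.deformedBivector_eq dU dP i }

end IsBiHamiltonian

end Deformed

/-! ### The brackets of the deformed bivectors -/

section DeformedBrackets

variable {n : ℕ} {M : Type*} [TopologicalSpace M] [T2Space M] [SigmaCompactSpace M]
  [ChartedSpace (EuclideanSpace ℝ (Fin n)) M] [IsManifold (𝓡 n) ∞ M]
  {U U' P P' : Type*}
  [SectionSpace M U] [AddCommGroup U] [Module ℝ U] [JetModel U] [SectionModel n U]
  [SectionSpace M U'] [AddCommGroup U'] [Module ℝ U'] [JetModel U'] [SectionModel n U']
  [SectionSpace M P] [AddCommGroup P] [Module ℝ P] [JetModel P] [SectionModel n P]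
  [SectionSpace M P'] [AddCommGroup P'] [Module ℝ P'] [JetModel P'] [SectionModel n P']
  {prU : Pairing n M U' U} {prP : Pairing n M P' P} (dU : Duality prU) (dP : Duality prP)
  {F : U → P} {ell' : U → P' → U'} {A : Fin 2 → U → P' → U} {A' : Fin 2 → U → U' → P}
  {B : Fin 2 → U → P → P' → P} {B' : Fin 2 → U → P' → P' → P'} {L₁ L₂ : U × U' → P' → U'}

/-- The argument to which `L` is applied in the second component of the operator `Ãᵢ`. -/
def deformedArg : Fin 2 → P' × P' → P' := ![fun ψ => ψ.2, fun ψ => -ψ.1]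

/-- The sign `σᵢ` for which `Ãᵢ ψ = σᵢ (e, 0) - (A λ, -L λ)`, where `A = A₁ + A₂`, `λ` is the
`deformedArg` of `ψ` and `e = A₁ ψ₁ + A₂ ψ₂` is a component of `ℓ^*` of the deformation. -/
def deformedSign : Fin 2 → ℝ := ![1, -1]

theorem deformedArg_zero (ψ : P' × P') : deformedArg 0 ψ = ψ.2 := rfl

theorem deformedArg_one (ψ : P' × P') : deformedArg 1 ψ = - ψ.1 := rfl

theorem deformedSign_zero : deformedSign 0 = 1 := rfl

theorem deformedSign_one : deformedSign 1 = -1 := rfl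

theorem isLinearMap_deformedArg : ∀ i, IsLinearMap ℝ (deformedArg (P' := P') i) :=
  Fin.forall_fin_two.2 ⟨isLinearMap_snd, isLinearMap_neg isLinearMap_fst⟩

theorem jetMap_deformedArg : ∀ i, JetMap (deformedArg (P' := P') i) :=
  Fin.forall_fin_two.2 ⟨by change JetMap fun ψ : P' × P' => ψ.2; fun_prop,
    by change JetMap fun ψ : P' × P' => -ψ.1; fun_prop⟩

theorem deformedBivector_eq_arg (hA : ∀ i, IsCDiffOp (A i)) {L : U × U' → P' → U'}
    (hL : IsCDiffOp L) (z : U × U') (ψ : P' × P') : ∀ i, deformedBivector A L i z ψ =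
      (A i z.1 (ψ.1 - ψ.2), L z (deformedArg i ψ)) := by
  refine Fin.forall_fin_two.2 ⟨?_, ?_⟩
  · rw [deformedBivector_zero, deformedArg_zero, ((hA 0).1 z.1).map_sub]
  · rw [deformedBivector_one, deformedArg_one, ((hA 1).1 z.1).map_sub, (hL.1 z).map_neg]

theorem deformedBivector_eq_sign (hA : ∀ i, IsCDiffOp (A i)) {L : U × U' → P' → U'}
    (hL : IsCDiffOp L) (z : U × U') (ψ : P' × P') : ∀ i, deformedBivector A L i z ψ =
      deformedSign i • (A 0 z.1 ψ.1 + A 1 z.1 ψ.2, 0) -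
        (A 0 z.1 (deformedArg i ψ) + A 1 z.1 (deformedArg i ψ), - L z (deformedArg i ψ)) := by
  refine Fin.forall_fin_two.2 ⟨?_, ?_⟩
  · rw [deformedBivector_zero, deformedArg_zero, deformedSign_zero, one_smul, Prod.mk_sub_mk]
    exact Prod.ext (by simp only; abel) (by simp)
  · rw [deformedBivector_one, deformedArg_one, deformedSign_one, neg_one_smul, Prod.neg_mk,
      Prod.mk_sub_mk, (hL.1 z).map_neg, ((hA 0).1 z.1).map_neg, ((hA 1).1 z.1).map_neg]
    exact Prod.ext (by simp only; abel) (by simp)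

theorem linOp_deformedBivector (hA : ∀ i, IsCDiffOp (A i)) {L : U × U' → P' → U'}
    (hL : IsCDiffOp L) (i : Fin 2) (z q : U × U') (ψ : P' × P') :
    linOp (deformedBivector A L i) ψ z q =
      (linOp (A i) (ψ.1 - ψ.2) z.1 q.1, linOp L (deformedArg i ψ) z q) := by
  have h1 : IsDiffOp (fun z : U × U' => A i z.1 (ψ.1 - ψ.2)) :=
    ((hA i).isDiffOp_coeff (ψ.1 - ψ.2)).comp_jetMap (g := fun z : U × U' => z.1) (by fun_prop)
  have h2 := h1.lin_prodMk (hL.isDiffOp_coeff (deformedArg i ψ)) z q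
  simp only [linOp, deformedBivector_eq_arg hA hL]
  exact h2

theorem deformedAssocAdjoint_fst_sub_snd (hB : ∀ i, IsCBiDiffOp (B' i)) (z : U × U')
    (q ψ : P' × P') : ∀ i,
    (deformedAssocAdjoint B' i z q ψ).1 - (deformedAssocAdjoint B' i z q ψ).2 =
      B' i z.1 (q.1 - q.2) (ψ.1 - ψ.2) := by
  refine Fin.forall_fin_two.2 ⟨?_, ?_⟩ <;>
  · simp only [deformedAssocAdjoint_zero, deformedAssocAdjoint_one, ((hB _).1 z.1 _).map_sub,
      ((hB _).2.1 z.1 _).map_sub]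
    abel

/-- The terms `Ãᵢ(B̃ⱼ^*)` and `Ãⱼ(B̃ᵢ^*)` of the bracket have, as the second component of their sum,
`L` applied to this expression. -/
theorem deformedArg_deformedAssocAdjoint (hB : ∀ i, IsCBiDiffOp (B' i)) (z : U × U')
    (q ψ : P' × P') : ∀ i j, deformedArg i (deformedAssocAdjoint B' j z q ψ) +
        deformedArg j (deformedAssocAdjoint B' i z q ψ) =
      -((B' 0 z.1 (deformedArg i q) (deformedArg j ψ) +
          B' 1 z.1 (deformedArg i q) (deformedArg j ψ)) +
        (B' 0 z.1 (deformedArg j q) (deformedArg i ψ) +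
          B' 1 z.1 (deformedArg j q) (deformedArg i ψ))) := by
  simp only [Fin.forall_fin_two]
  refine ⟨⟨?_, ?_⟩, ?_, ?_⟩ <;>
  · simp only [deformedAssocAdjoint_zero, deformedAssocAdjoint_one, deformedArg_zero,
      deformedArg_one, ((hB _).2.1 z.1 _).map_sub, ((hB _).1 z.1 _).map_neg,
      ((hB _).2.1 z.1 _).map_neg]
    abel

namespace IsBiHamiltonian

variable (h : IsBiHamiltonian prU prP F ell' A A' B B' L₁ L₂)

include h dU dP

/-- The second component of the bracket consists of derivatives of `L` along the fields `Ãᵢ ψ`.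
Modulo the component `A₁ ψ₁ + A₂ ψ₂` of `ℓ^*` of the deformation these fields have components
`(Aλ, -Lλ)` up to sign, and on the deformation the derivatives of `L` along the latter are
expressed by the operators `Bᵢ^*`. -/
theorem bracketsVanish_deformedBivector :
    BracketsVanish (deformation F A') (deformedEllAdjoint A L₁ L₂)
      (deformedBivector A (fun z ψ => L₁ z ψ + L₂ z ψ)) (deformedAssocAdjoint B') := by
  intro i j
  have hA := fun i => (h.bivector i).cdiff
  have hB := fun i => (h.bivector i).cbidiff'
  have hL := (h.adjoint_sum dU dP).1
  obtain ⟨L, hLdef⟩ : ∃ L, L = fun z ψ => L₁ z ψ + L₂ z ψ := ⟨_, rfl⟩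
  have hLz : ∀ z ψ, L₁ z ψ + L₂ z ψ = L z ψ := fun _ _ => by rw [hLdef]
  have key := fun {z : U × U'} {x : M} (hz : OnShell (deformation F A') z x) ψ ψ' =>
    jetEq_iff_sub.1 (h.linOp_adjoint_sub_linOp_adjoint dU dP hz ψ ψ')
  rw [← hLdef] at hL ⊢
  simp only [hLz] at key
  set μ : P' × P' → P' := fun ψ =>
    deformedSign j • deformedArg i ψ + deformedSign i • deformedArg j ψ with hμ
  have hμl : IsLinearMap ℝ μ :=
    ⟨fun a b => by simp only [hμ, (isLinearMap_deformedArg _).map_add]; module,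
      fun r a => by simp only [hμ, (isLinearMap_deformedArg _).map_smul]; module⟩
  have hμj : JetMap μ := by
    have h1 := jetMap_deformedArg (P' := P') i
    have h2 := jetMap_deformedArg (P' := P') j
    fun_prop
  have hbox : IsCBiDiffOp (fun (z : U × U') (ψ : P' × P') (e : U' × U) =>
      ((0, linOp L (μ ψ) z (e.2, 0)) : U × U')) := by
    refine ⟨fun z e => ?_, fun z ψ => ?_, ?_⟩
    · exact isLinearMap_prodMk ⟨fun _ _ => (add_zero _).symm, fun _ _ => (smul_zero _).symm⟩
        (isLinearMap_comp (f := fun p => linOp L p z (e.2, 0)) (g := μ)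
          (hL.linear_linOp_arg z (e.2, 0)) hμl)
    · exact isLinearMap_prodMk ⟨fun _ _ => (add_zero _).symm, fun _ _ => (smul_zero _).symm⟩
        (isLinearMap_comp (f := linOp L (μ ψ) z) (g := fun e : U' × U => (e.2, 0))
          (hL.linear_linOp_dir (μ ψ) z) (isLinearMap_prodMk isLinearMap_snd
          ⟨fun _ _ => (add_zero _).symm, fun _ _ => (smul_zero _).symm⟩))
    · exact (JetMap.const (0 : U)).isDiffOp.prodMk (hL.isDiffOp_linOp.comp_jetMap
        (g := fun z : (U × U') × (P' × P') × U' × U => (z.1, μ z.2.1, (z.2.2.2, 0)))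
        (by fun_prop))
  have hbox' : IsCBiDiffOp (fun (z : U × U') (e : U' × U) (ψ : P' × P') =>
      -((0, linOp L (μ ψ) z (e.2, 0)) : U × U')) :=
    IsCBiDiffOp.neg ⟨fun z ψ => hbox.2.1 z ψ, fun z e => hbox.1 z e, hbox.2.2.comp_jetMap
      (g := fun z : (U × U') × (U' × U) × P' × P' => (z.1, z.2.2, z.2.1)) (by fun_prop)⟩
  -- these operators absorb the terms of the derivatives of `L` along the fields `(e, 0)`
  refine ⟨_, _, hbox', hbox, fun z x hz ψ ψ' => ?_⟩
  have hdir : ∀ (i : Fin 2) (χ : P') (ψ : P' × P'), linOp L χ z (deformedBivector A L i z ψ) =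
      deformedSign i • linOp L χ z (A 0 z.1 ψ.1 + A 1 z.1 ψ.2, 0) - linOp L χ z
        (A 0 z.1 (deformedArg i ψ) + A 1 z.1 (deformedArg i ψ), - L z (deformedArg i ψ)) := by
    intro i χ ψ
    rw [deformedBivector_eq_sign hA hL, (hL.linear_linOp_dir χ z).map_sub,
      (hL.linear_linOp_dir χ z).map_smul]
  -- the first component is the bracket of `Aᵢ` and `Aⱼ` at `ψ₁ - ψ₂`
  have hfst : (schouten (deformedBivector A L i) (deformedBivector A L j)
      (deformedAssocAdjoint B' i) (deformedAssocAdjoint B' j) z ψ ψ').1 = 0 := by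
    rw [← h.schouten_eq_zero i j z.1 (ψ.1 - ψ.2) (ψ'.1 - ψ'.2), schouten, schouten]
    simp only [linOp_deformedBivector hA hL, Prod.fst_sub, Prod.fst_add,
      deformedBivector_eq_arg hA hL, deformedAssocAdjoint_fst_sub_snd hB]
  have k1 := key hz (deformedArg j ψ') (deformedArg i ψ)
  have k2 := key hz (deformedArg i ψ') (deformedArg j ψ)
  refine ⟨?_, ?_⟩
  · rw [hfst]
    simpa using jet_zero 0 x
  · rw [jetEq_iff_sub]
    convert jet_neg (jet_add k1 k2) using 1
    have h3 := congrArg (L z) (deformedArg_deformedAssocAdjoint hB z ψ ψ' i j)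
    rw [(hL.1 z).map_neg, (hL.1 z).map_add, (hL.1 z).map_add, eq_neg_iff_add_eq_zero] at h3
    simp only [schouten, linOp_deformedBivector hA hL, hdir, Prod.snd_sub, Prod.snd_add,
      Prod.snd_neg, deformedEllAdjoint, hμ, (hL.linear_linOp_arg z _).map_add,
      (hL.linear_linOp_arg z _).map_smul]
    rw [← sub_eq_zero, ← neg_eq_zero, ← h3]
    simp only [deformedBivector_eq_arg hA hL]
    abel

end IsBiHamiltonian

end DeformedBrackets

/-! ### Regular and normal equations -/

section RegularNormal

variable {n : ℕ} {M : Type*} [TopologicalSpace M] [T2Space M] [SigmaCompactSpace M]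
  [ChartedSpace (EuclideanSpace ℝ (Fin n)) M] [IsManifold (𝓡 n) ∞ M]
  {U U' P P' Q : Type*}
  [SectionSpace M U] [AddCommGroup U] [Module ℝ U] [JetModel U] [SectionModel n U]
  [SectionSpace M U'] [AddCommGroup U'] [Module ℝ U'] [JetModel U'] [SectionModel n U']
  [SectionSpace M P] [AddCommGroup P] [Module ℝ P] [JetModel P] [SectionModel n P]
  [SectionSpace M P'] [AddCommGroup P'] [Module ℝ P'] [JetModel P'] [SectionModel n P']
  [SectionSpace M Q] [AddCommGroup Q] [Module ℝ Q] [JetModel Q] [SectionModel n Q]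
  {prU : Pairing n M U' U} {prP : Pairing n M P' P} (dU : Duality prU) (dP : Duality prP)
  {F : U → P}

/-- On a regular equation, operators that vanish on the equation do so with all derivatives. -/
theorem IsRegular.jetEq_zero (hreg : IsRegular n F) {D : U → Q} (hD : IsDiffOp D)
    (h0 : ∀ u x, OnShell F u x → JetEq 0 x (D u) 0) {u : U} {x : M} (hu : OnShell F u x) (k : ℕ) :
    JetEq k x (D u) 0 := by
  obtain ⟨Λ, hΛ, hΛ'⟩ := SectionModel.exists_components (n := n) (S := Q) x
  refine hΛ' k _ fun g hg => ?_
  have hgz : ∀ {x s}, JetEq 0 x s 0 → JetEq 0 x (g s) 0 := fun {x s} hs => by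
    simpa only [(hΛ g hg).linear.map_zero] using (hΛ g hg).jet hs
  obtain ⟨Δ, hΔ, hΔ'⟩ := hreg (fun v => g (D v)) ((hΛ g hg).comp_isDiffOp hD)
    fun v y hv => hgz (h0 v y hv)
  rw [hΔ' u]
  exact preservesFlat n (Δ u) (hΔ.1 u) (hΔ.isDiffOp_apply u) x (F u) hu k

/-- On a normal equation, `Δ ∘ ℓ_F = 0` implies `Δ = 0` also for vector-valued operators. -/
theorem IsNormal.jetEq_zero (hnor : IsNormal n F) {Δ : U → P → Q} (hΔ : IsCDiffOp Δ)
    (h0 : ∀ u x, OnShell F u x → ∀ φ, JetEq 0 x (Δ u (lin F u φ)) 0) {u : U} {x : M}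
    (hu : OnShell F u x) (p : P) : JetEq 0 x (Δ u p) 0 := by
  obtain ⟨Λ, hΛ, hΛ'⟩ := SectionModel.exists_components (n := n) (S := Q) x
  refine hΛ' 0 _ fun g hg => ?_
  have hgz : ∀ {x s}, JetEq 0 x s 0 → JetEq 0 x (g s) 0 := fun {x s} hs => by
    simpa only [(hΛ g hg).linear.map_zero] using (hΛ g hg).jet hs
  exact hnor (fun v p => g (Δ v p)) ⟨fun v => isLinearMap_comp (hΛ g hg).linear (hΔ.1 v),
    (hΛ g hg).comp_isDiffOp hΔ.2⟩ (fun v y hv φ => hgz (h0 v y hv φ)) u x hu p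

/-- On a regular and normal equation, a `𝒞`-differential operator that annihilates `F` vanishes,
and so do all derivatives of its coefficients. -/
theorem IsNormal.jetEq_zero_of_apply_eq_zero (hF : IsDiffOp F) (hreg : IsRegular n F)
    (hnor : IsNormal n F) {Δ : U → P → Q} (hΔ : IsCDiffOp Δ) (h0 : ∀ u, Δ u (F u) = 0) {u : U}
    {x : M} (hu : OnShell F u x) (p : P) (k : ℕ) : JetEq k x (Δ u p) 0 := by
  refine hreg.jetEq_zero (hΔ.isDiffOp_coeff p) (fun u x hu => ?_) hu k
  refine hnor.jetEq_zero hΔ (fun u x hu φ => ?_) hu p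
  -- linearize the equation `Δ(F) = 0`; the coefficients of `ℓ_Δ` are applied to `F`
  have h1 := hΔ.lin_apply hF u φ
  simp only [h0] at h1
  rw [lin_const] at h1
  rw [← neg_eq_of_add_eq_zero_right h1.symm]
  exact jet_neg (preservesFlat n (fun p => linOp Δ p u φ) (hΔ.linear_linOp_arg u φ)
    ((hΔ.isDiffOp_linOp_arg_dir u).comp_jetMap (g := fun p => (p, φ)) (by fun_prop)) x (F u) hu 0)

include dP in
/-- If `Δ` annihilates a regular and normal `F`, then the adjoint `Δ'` also vanishes on the equation
with all derivatives: under the integral, `⟨q, ·⟩ ∘ Δ` is represented by the order-zero operator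
`⟨Δ' q, ·⟩`, so the fundamental lemma applies. -/
theorem IsNormal.jetEq_zero_adjoint (hF : IsDiffOp F) (hreg : IsRegular n F)
    (hnor : IsNormal n F) {Δ : U → P → P} {Δ' : U → P' → P'} (hΔ : IsCDiffOp Δ)
    (hΔ' : IsFormalAdjoint prP prP Δ Δ') (h0 : ∀ u, Δ u (F u) = 0) {u : U}
    {x : M} (hu : OnShell F u x) (q : P') (k : ℕ) : JetEq k x (Δ' u q) 0 := by
  refine hreg.jetEq_zero (hΔ'.1.isDiffOp_coeff q) (fun u x hu => ?_) hu k
  refine dP.nondeg_left _ x fun p => ?_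
  refine SectionModel.fundamental (n := n) (fun p => dP.sec (Δ' u q) p)
    (fun p => dP.sec q (Δ u p)) (dP.right _) (isLinearMap_comp (dP.right q).linear (hΔ.1 u))
    ((dP.right q).comp_isDiffOp (hΔ.isDiffOp_apply u)) x (fun p k => ?_) (fun p hp => ?_) p
  · exact preservesFlat n (dP.sec q) (dP.right q).linear (dP.right q).isDiffOp x _
      (IsNormal.jetEq_zero_of_apply_eq_zero hF hreg hnor hΔ h0 hu p) k
  · set c := achart (EuclideanSpace ℝ (Fin n)) x
    change CompactIn c.1.source p at hp
    have h1 := (hΔ'.2 u).null dP dP (hΔ.isDiffOp_apply u) (hΔ.1 u).map_zero hp q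
    simpa only [neg_sub, neg_one_smul] using h1.smul (-1)

include dU dP in
/-- On a regular and normal equation, the operators `Bᵢ^*` associated with bivectors `Aᵢ` are
unique, hence so are the brackets. -/
theorem BracketsVanish.of_isRegular_isNormal {ell₁ ell₂ : U → P' → U'} {A : Fin 2 → U → P' → U}
    {A₁' A₂' : Fin 2 → U → U' → P} {B₁ B₂ : Fin 2 → U → P → P' → P}
    {B₁' B₂' : Fin 2 → U → P' → P' → P'} (hF : IsDiffOp F) (hreg : IsRegular n F)
    (hnor : IsNormal n F) (h₁ : AreBivectors prU prP F ell₁ A A₁' B₁ B₁')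
    (h₂ : AreBivectors prU prP F ell₂ A A₂' B₂ B₂') (h : BracketsVanish F ell₁ A B₁') :
    BracketsVanish F ell₂ A B₂' := by
  have hell : ell₁ = ell₂ := by
    funext u ψ
    exact ((h₁ 0).ell_adjoint.2 u).unique dU dP ((h₂ 0).ell_adjoint.2 u) (hF.comp_linDir u)
      (hF.isLinearMap_lin u).map_zero ψ
  have hA : ∀ i u η, A₁' i u η = A₂' i u η := fun i u η =>
    ((h₁ i).adjoint.2 u).unique dP.swap dU ((h₂ i).adjoint.2 u) ((h₁ i).cdiff.isDiffOp_apply u)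
      ((h₁ i).cdiff.1 u).map_zero η
  subst hell
  -- the difference of the operators `B₁^*` and `B₂^*` vanishes on the equation
  have hB : ∀ i {u x}, OnShell F u x → ∀ q ψ k,
      JetEq k x (B₁' i u q ψ - B₂' i u q ψ) 0 := by
    intro i u x hu q ψ k
    have hb₁ := (h₁ i).cbidiff.isCDiffOp_left ψ
    have hb₂ := (h₂ i).cbidiff.isCDiffOp_left ψ
    have hb₁' := (h₁ i).cbidiff'.isCDiffOp_left ψ
    have hb₂' := (h₂ i).cbidiff'.isCDiffOp_left ψ
    refine IsNormal.jetEq_zero_adjoint dP hF hreg hnor (hb₁.sub hb₂)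
      (Δ' := fun u q => B₁' i u q ψ - B₂' i u q ψ)
      ⟨hb₁'.sub hb₂', fun u => ((h₁ i).adjoint' u ψ).sub dP dP ((h₂ i).adjoint' u ψ)
        (hb₁.isDiffOp_apply u) (hb₂.isDiffOp_apply u) (hb₁.1 u).map_zero (hb₂.1 u).map_zero⟩
      (fun u => ?_) hu q k
    rw [← (h₁ i).eq, ← (h₂ i).eq, hA, sub_self]
  intro i j
  obtain ⟨box₁, box₂, hbox₁, hbox₂, hbox⟩ := h i j
  refine ⟨box₁, box₂, hbox₁, hbox₂, fun u x hu ψ ψ' => jet_trans ?_ (hbox u x hu ψ ψ')⟩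
  have hAB : ∀ i j, JetEq 0 x (A i u (B₁' j u ψ ψ' - B₂' j u ψ ψ')) 0 := fun i j =>
    preservesFlat n (A i u) ((h₁ i).cdiff.1 u) ((h₁ i).cdiff.isDiffOp_apply u) x _
      (hB j hu ψ ψ') 0
  rw [jetEq_iff_sub]
  convert jet_add (hAB i j) (hAB j i) using 1
  rw [((h₁ i).cdiff.1 u).map_sub, ((h₁ j).cdiff.1 u).map_sub, schouten, schouten]
  abel

end RegularNormal

end Kupershmidt

end

open Kupershmidt in
theorem mainTheorem1 {n : ℕ} {M : Type*} [TopologicalSpace M] [T2Space M] [SigmaCompactSpace M]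
    [ChartedSpace (EuclideanSpace ℝ (Fin n)) M] [IsManifold (𝓡 n) ∞ M]
    -- the vector bundle `π : E → M` of the unknowns `u`
    {FE : Type*} [NormedAddCommGroup FE] [NormedSpace ℝ FE] [FiniteDimensional ℝ FE]
    {E : M → Type*} [TopologicalSpace (Bundle.TotalSpace FE E)] [∀ x, AddCommGroup (E x)]
    [∀ x, Module ℝ (E x)] [∀ x, TopologicalSpace (E x)] [FiberBundle FE E] [VectorBundle ℝ FE E]
    [ContMDiffVectorBundle ∞ FE E (𝓡 n)]
    -- the vector bundle `α` in which `F` takes its values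
    {Fα : Type*} [NormedAddCommGroup Fα] [NormedSpace ℝ Fα] [FiniteDimensional ℝ Fα]
    {α : M → Type*} [TopologicalSpace (Bundle.TotalSpace Fα α)] [∀ x, AddCommGroup (α x)]
    [∀ x, Module ℝ (α x)] [∀ x, TopologicalSpace (α x)] [FiberBundle Fα α] [VectorBundle ℝ Fα α]
    [ContMDiffVectorBundle ∞ Fα α (𝓡 n)]
    -- the equation `F = 0`
    (F : ContMDiffSection (𝓡 n) FE ∞ E → ContMDiffSection (𝓡 n) Fα ∞ α)
    (hF : IsDiffOp F)
    -- `ℓ_F^*`, the bivectors `A₁`, `A₂`, their adjoints, and the operators `Bᵢ`, `Bᵢ^*`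
    (ell' : ContMDiffSection (𝓡 n) FE ∞ E → HatSection n Fα α → HatSection n FE E)
    (A : Fin 2 → ContMDiffSection (𝓡 n) FE ∞ E → HatSection n Fα α →
      ContMDiffSection (𝓡 n) FE ∞ E)
    (A' : Fin 2 → ContMDiffSection (𝓡 n) FE ∞ E → HatSection n FE E →
      ContMDiffSection (𝓡 n) Fα ∞ α)
    (B : Fin 2 → ContMDiffSection (𝓡 n) FE ∞ E → ContMDiffSection (𝓡 n) Fα ∞ α →
      HatSection n Fα α → ContMDiffSection (𝓡 n) Fα ∞ α)
    (B' : Fin 2 → ContMDiffSection (𝓡 n) FE ∞ E → HatSection n Fα α → HatSection n Fα α →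
      HatSection n Fα α)
    (hA : AreBivectors (pairing n FE E) (pairing n Fα α) F ell' A A' B B')
    -- all Schouten brackets vanish
    (hAA : ∀ i j u ψ₁ ψ₂, schouten (A i) (A j) (B' i) (B' j) u ψ₁ ψ₂ = 0)
    -- `L₁ = ℓ^*_{F + A₁^*(w)}` and `L₂ = ℓ^*_{A₂^*(w)}`, linearizations with respect to `u` only
    (L₁ L₂ : ContMDiffSection (𝓡 n) FE ∞ E × HatSection n FE E → HatSection n Fα α →
      HatSection n FE E)
    (hL₁ : IsFormalAdjoint (pairing n FE E) (pairing n Fα α)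
      (fun z φ => lin (fun u => F u + A' 0 u z.2) z.1 φ) L₁)
    (hL₂ : IsFormalAdjoint (pairing n FE E) (pairing n Fα α)
      (fun z φ => lin (fun u => A' 1 u z.2) z.1 φ) L₂) :
    -- the operators `Ã₁`, `Ã₂` are bivectors on `Ẽ`, and their brackets vanish up to trivial terms
    (∃ tell' tA' tB tB',
      AreBivectors ((pairing n FE E).sum (pairing n FE E).swap)
        ((pairing n Fα α).sum (pairing n Fα α)) (deformation F A') tell'
        (deformedBivector A (fun z ψ => L₁ z ψ + L₂ z ψ)) tA' tB tB' ∧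
      BracketsVanish (deformation F A') tell'
        (deformedBivector A (fun z ψ => L₁ z ψ + L₂ z ψ)) tB') ∧
    -- if `Ẽ` is regular and normal, the brackets vanish for all choices of the operators `B̃ᵢ`
    (IsRegular n (deformation F A') → IsNormal n (deformation F A') →
      ∀ tell' tA' tB tB',
        AreBivectors ((pairing n FE E).sum (pairing n FE E).swap)
          ((pairing n Fα α).sum (pairing n Fα α)) (deformation F A') tell'
          (deformedBivector A (fun z ψ => L₁ z ψ + L₂ z ψ)) tA' tB tB' →
        BracketsVanish (deformation F A') tell'
          (deformedBivector A (fun z ψ => L₁ z ψ + L₂ z ψ)) tB') := by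
  have h : IsBiHamiltonian (pairing n FE E) (pairing n Fα α) F ell' A A' B B' L₁ L₂ :=
    ⟨hF, hA, hAA, hL₁, hL₂⟩
  have dU := pairingDuality n FE E
  have dP := pairingDuality n Fα α
  refine ⟨⟨_, _, _, _, h.areBivectors_deformedBivector dU dP,
    h.bracketsVanish_deformedBivector dU dP⟩, fun hreg hnor tell' tA' tB tB' ht => ?_⟩
  exact BracketsVanish.of_isRegular_isNormal (dU.sum dU.swap) (dP.sum dP) h.isDiffOp_deformation
    hreg hnor (h.areBivectors_deformedBivector dU dP) ht (h.bracketsVanish_deformedBivector dU dP)
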